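/- **Proposition (Affine rational elliptic surfaces).** Let $v_i\in\mathbb Z^2\setminus\{0\}$, $i\in\mathbb Z/m\mathbb Z$, be distinct primitive vectors, labelled counterclockwise (in one turn around the origin), such that $\mathbb R_{\ge 0}\cdot\{v_1,\dots,v_m\}=\mathbb R^2$ and no simplex $\mathrm{Conv}\{0,v_i,v_{i+1}\}$ contains a lattice point in its interior. Let $P$ be the union of these simplices, a possibly non-convex polygon with edges $[v_i,v_{i+1}]$ and corners $v_i$ (a corner may be flat). Let $u_i$ be the primitive vector in the direction of $v_{i+1}-v_i$, let the affine length of the edge $[v_i,v_{i+1}]$ be the integer $\ell_i\ge 1$ with $v_{i+1}-v_i=\ell_i u_i$, and let $\det(u_{i-1},u_i)$ be the order of the corner $v_i$ (it is negative at non-convex corners). *Terminology.* A tropical surface with singularities $(\mathcal B,\mathcal P)$ consists of: an oriented topological surface $\mathcal B$, possibly with boundary; a finite set $\Delta$ of interior points, called singular points; an integral affine structure on $\mathcal B\setminus\Delta$, given by oriented charts with values in the closed half plane and with transition maps in $SL_2(\mathbb Z)\ltimes\mathbb Z^2$; and a finite decomposition $\mathcal P$ of $\mathcal B$ into embedded lattice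 polygons (not necessarily convex) that meet along common faces. The polygons are integral affinely embedded away from $\Delta$, and the singular points lie in the relative interiors of edges of $\mathcal P$. A singular point has multiplicity $k\in\mathbb Z$ if, in some oriented basis, its monodromy is $\begin{pmatrix}1&k\\0&1\end{pmatrix}$; here the monodromy is the linear part of the change of an oriented integral affine chart that is continued once counterclockwise around the point ($k\le 0$ is allowed, and $k=0$ means that the monodromy is trivial). An affine circle is a topological circle in $\mathcal B$ whose intersection with $\mathcal B\setminus\Delta$ is an affine submanifold. Then there exist two tropical surfaces with singularities $(\mathcal A,\mathcal P)$ and $(\mathcal A',\mathcal P')$ with the following properties. All polygons of $\mathcal P$, and all polygons of $\mathcal P'$ other than the polygon $P$ in (2), are convex. 1. Both $\mathcal A$ and $\mathcal A'$ are closed discs whose boundaries are affine circles, of affine length the number of lattice points in the boundary of $P$. 2. The interior of $\mathcal A$ contains an affine circle $C$ which is the union of $m$ distinct edges $E_i$ ($i\in\mathbb Z/m\mathbb Z$) of $\mathcal P$ and which bounds an open disc $D$ in the interior of $\mathcal A$. The polygon $P$, with its edges $[v_i,v_{i+1}]$, is a polygon of $\mathcal P'$, embedded in the interior of $\mathcal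 A'$. 3. $\mathcal A$ has "outer" singular points, one on each $E_i\subset C$, and $\mathcal A'$ has "inner" singular points, one on each edge $[v_i,v_{i+1}]$ of $P\subset\mathcal A'$. They correspond one-to-one to the edges of $P$, and the one corresponding to $[v_i,v_{i+1}]$ has multiplicity $\ell_i$. 4. $\mathcal A$ has "inner" singular points in $D$, and $\mathcal A'$ has "outer" singular points in the complement of $P$. In each case they correspond one-to-one to the corners of $P$, and the one corresponding to $v_i$ has multiplicity $\det(u_{i-1},u_i)$. 5. The points in (3) and (4) are all the singular points of $\mathcal A$ and of $\mathcal A'$, and the sum of the multiplicities of the singular points is $12$ for each of the two surfaces. -/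

import Mathlib

open Set Filter Topology
open scoped Matrix NNReal

/-- The real plane `ℝ²`. Only its topology, vector space structure and lattice matter. -/
abbrev Plane : Type := Fin 2 → ℝ

/-- The lattice `ℤ²`. -/
abbrev LatticeVec : Type := Fin 2 → ℤ

namespace LatticeVec

/-- The inclusion `ℤ² ⊆ ℝ²`. -/
def toPlane (w : LatticeVec) : Plane := fun k => (w k : ℝ)

/-- The divisibility of a lattice vector; this is the affine (lattice) length of the segment
from a lattice point `p` to the lattice point `p + w`. -/
def len (w : LatticeVec) : ℤ := (Int.gcd (w 0) (w 1) : ℤ)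

/-- A lattice vector is primitive if its coordinates are coprime. -/
def IsPrimitive (w : LatticeVec) : Prop := Int.gcd (w 0) (w 1) = 1

/-- The primitive vector in the direction of a nonzero lattice vector (the division is exact). -/
def primDir (w : LatticeVec) : LatticeVec := fun k => w k / w.len

/-- The determinant `det (a, b)` of two lattice vectors. -/
def det2 (a b : LatticeVec) : ℤ := a 0 * b 1 - a 1 * b 0

end LatticeVec

/-! ### The polygons -/

/-- The simplex `{0, a, b}`. -/
def simplex (a b : LatticeVec) : Set Plane :=
  convexHull ℝ {0, a.toPlane, b.toPlane}

/-- Distinct primitive vectors `v_i`, `i ∈ ℤ/m`, labelled counterclockwise (in one turn around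
the origin), whose nonnegative combinations fill the plane, and such that no simplex
`{0, v_i, v_{i+1}}` has a lattice point in its interior. -/
structure IsPolygonData {m : ℕ} [NeZero m] (v : ZMod m → LatticeVec) : Prop where
  distinct : Function.Injective v
  primitive : ∀ i, (v i).IsPrimitive
  counterclockwise : ∃ θ : ℕ → ℝ, (∀ j k : ℕ, j < k → k < m → θ j < θ k) ∧
    (∀ k : ℕ, k < m → θ k < θ 0 + 2 * Real.pi) ∧
    ∀ k : ℕ, k < m → ∃ ρ : ℝ, 0 < ρ ∧
      (v (k : ZMod m)).toPlane = ρ • ![Real.cos (θ k), Real.sin (θ k)]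
  spanning : Submodule.span ℝ≥0 (Set.range fun i => (v i).toPlane) = ⊤
  no_interior : ∀ i, ∀ w : LatticeVec, w.toPlane ∉ interior (simplex (v i) (v (i + 1)))

section Polygon

variable {m : ℕ} (v : ZMod m → LatticeVec)

/-- The polygon `P`, the union of the simplices `{0, v_i, v_{i+1}}`. -/
def polygon : Set Plane := ⋃ i, simplex (v i) (v (i + 1))

/-- The edge `[v_i, v_{i+1}]` of `P`. -/
def polygonEdge (i : ZMod m) : Set Plane := segment ℝ (v i).toPlane (v (i + 1)).toPlane

/-- The affine length of the edge `[v_i, v_{i+1}]`. -/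
def edgeLength (i : ZMod m) : ℤ := (v (i + 1) - v i).len

/-- The primitive vector `u_i` in the direction of `v_{i+1} - v_i`. -/
def edgeDir (i : ZMod m) : LatticeVec := (v (i + 1) - v i).primDir

/-- The order `det (u_{i-1}, u_i)` of the corner `v_i`. -/
def cornerOrder (i : ZMod m) : ℤ := LatticeVec.det2 (edgeDir v (i - 1)) (edgeDir v i)

/-- The number of lattice points in the boundary of `P`. -/
noncomputable def boundaryLatticePoints : ℕ :=
  Set.ncard {w : LatticeVec | w.toPlane ∈ frontier (polygon v)}

end Polygon

/-! ### Integral affine surfaces with singularities -/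

/-- The orientation preserving integral affine transformation `x ↦ M x + b` of the plane,
with `M ∈ SL₂(ℤ)` and `b ∈ ℤ²`. -/
def intAff (M : Matrix.SpecialLinearGroup (Fin 2) ℤ) (b : LatticeVec) (x : Plane) : Plane :=
  (M.1.map (fun n : ℤ => (n : ℝ))) *ᵥ x + b.toPlane

/-- The closed upper half plane. -/
abbrev HalfPlane : Type := {x : Plane // 0 ≤ x 1}

/-- An oriented integral affine surface with (finitely many) singularities, possibly with
boundary: a topological surface `B` with a finite set `Δ` of singular points in its interior, and
an atlas of `B ∖ Δ` with values in the half plane and with transition maps locally in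
`SL₂(ℤ) ⋉ ℤ²`. -/
structure IntegralAffineSurface where
  carrier : Type
  [top : TopologicalSpace carrier]
  t2 : T2Space carrier
  second_countable : SecondCountableTopology carrier
  /-- the discriminant locus `Δ` -/
  sing : Finset carrier
  /-- the surface is a manifold, without boundary, near the singular points -/
  chart_at_sing : ∀ p ∈ sing, ∃ h : OpenPartialHomeomorph carrier Plane, p ∈ h.source
  /-- the (oriented) integral affine charts -/
  atlas : Set (OpenPartialHomeomorph carrier HalfPlane)
  atlas_avoids : ∀ e ∈ atlas, ∀ p ∈ sing, p ∉ e.source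
  atlas_covers : ∀ x, x ∉ sing → ∃ e ∈ atlas, x ∈ e.source
  atlas_compatible : ∀ e ∈ atlas, ∀ e' ∈ atlas, ∀ x, x ∈ e.source → x ∈ e'.source →
    ∃ M b, ∀ᶠ y in 𝓝 x, (e' y : Plane) = intAff M b (e y)

attribute [instance] IntegralAffineSurface.top

namespace IntegralAffineSurface

variable (B : IntegralAffineSurface)

/-- The boundary `∂B`: the points that a chart sends to the boundary line of the half plane. -/
def boundary : Set B.carrier :=
  {x | ∃ e ∈ B.atlas, x ∈ e.source ∧ (e x : Plane) 1 = 0}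

/-- `B` is (homeomorphic to) the closed disc, with `∂B` corresponding to the unit circle. -/
def IsDisc : Prop :=
  ∃ h : B.carrier ≃ₜ Metric.closedBall (0 : EuclideanSpace ℝ (Fin 2)) 1,
    ∀ x, x ∈ B.boundary ↔ ‖(h x : EuclideanSpace ℝ (Fin 2))‖ = 1

/-- `D` is an open disc in `B` bounded by `C`: there is an embedded closed disc with
interior `D` and boundary circle `C`, and `D` is open in `B` and does not meet `∂B`. -/
def IsOpenDiscBoundedBy (D C : Set B.carrier) : Prop :=
  IsOpen D ∧ Disjoint D B.boundary ∧
  ∃ f : Metric.closedBall (0 : EuclideanSpace ℝ (Fin 2)) 1 → B.carrier, IsEmbedding f ∧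
    f '' {z | ‖(z : EuclideanSpace ℝ (Fin 2))‖ < 1} = D ∧
    f '' {z | ‖(z : EuclideanSpace ℝ (Fin 2))‖ = 1} = C

/-- `C` is an affine circle of affine length `L`: a topological circle that away from the
singular points is an affine submanifold. The circle is parametrized by affine length, that is, in
every chart the parametrization is locally `s ↦ x + s • w` with `w` a primitive lattice vector. -/
def IsAffineCircle (C : Set B.carrier) (L : ℝ) : Prop :=
  0 < L ∧ ∃ γ : ℝ → B.carrier, Continuous γ ∧ Function.Periodic γ L ∧
    Set.InjOn γ (Set.Ico 0 L) ∧ Set.range γ = C ∧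
    ∀ t, ∀ e ∈ B.atlas, γ t ∈ e.source → ∃ w : LatticeVec, w.IsPrimitive ∧
      ∀ᶠ s in 𝓝 (0 : ℝ), (e (γ (t + s)) : Plane) = (e (γ t) : Plane) + s • w.toPlane

/-- `f` is near `x ∉ Δ` an oriented integral affine coordinate. -/
def IsAffineAt (f : B.carrier → Plane) (x : B.carrier) : Prop :=
  ∃ e ∈ B.atlas, x ∈ e.source ∧ ∃ M b, ∀ᶠ y in 𝓝 x, f y = intAff M b (e y)

/-- `F` is a continuation of an oriented integral affine coordinate along the path
`γ : [0, 1] → B ∖ Δ`: each `F t` is such a coordinate near `γ t`, and `F s`, `F t` have the same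
germ at `γ s` if `s` is close to `t`. -/
def IsContinuation (γ : ℝ → B.carrier) (F : ℝ → B.carrier → Plane) : Prop :=
  ∀ t ∈ Set.Icc (0 : ℝ) 1, B.IsAffineAt (F t) (γ t) ∧
    ∀ᶠ s in 𝓝[Set.Icc (0 : ℝ) 1] t, ∀ᶠ y in 𝓝 (γ s), F s y = F t y

/-- The topological coordinate `h` (with connected target) is orientation preserving.
For a homeomorphism onto a connected plane domain this can be tested at one
point: there `h`, compared with an oriented affine coordinate `f`, has positive Jacobian. -/
def IsOriented (h : OpenPartialHomeomorph B.carrier Plane) : Prop :=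
  ∃ z ∈ h.target, ∃ f, B.IsAffineAt f (h.symm z) ∧
    ∃ T : Plane →L[ℝ] Plane, HasFDerivAt (fun y => f (h.symm y)) T z ∧
      0 < LinearMap.det (T : Plane →ₗ[ℝ] Plane)

/-- The matrix with rows `(1, k)` and `(0, 1)`. -/
def shear (k : ℤ) : Matrix.SpecialLinearGroup (Fin 2) ℤ :=
  ⟨!![1, k; 0, 1], by simp [Matrix.det_fin_two]⟩

/-- The singular point `p` has multiplicity `k`: in a suitable oriented basis its monodromy is
`shear k`. Here `h` is an oriented coordinate of a neighbourhood of `p` (onto an open square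
around `0`) that contains no other singular point, and some integral affine coordinate, continued
once along the counterclockwise circle of radius `r` around `p`, returns as its image
under an affine transformation with linear part `shear k`. -/
def HasMultiplicity (p : B.carrier) (k : ℤ) : Prop :=
  p ∈ B.sing ∧ ∃ (h : OpenPartialHomeomorph B.carrier Plane) (r R : ℝ),
    0 < r ∧ r < R ∧ h.target = Metric.ball 0 R ∧ p ∈ h.source ∧ h p = 0 ∧
    (∀ q ∈ h.source, q ∈ B.sing → q = p) ∧ B.IsOriented h ∧
    ∃ F : ℝ → B.carrier → Plane,
      B.IsContinuation
        (fun t => h.symm ![r * Real.cos (2 * Real.pi * t), r * Real.sin (2 * Real.pi * t)]) F ∧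
      ∃ b : LatticeVec, ∀ᶠ y in 𝓝 (h.symm ![r, 0]), F 1 y = intAff (shear k) b (F 0 y)

end IntegralAffineSurface

/-! ### Polyhedral decompositions -/

/-- A lattice polygon, not necessarily convex: a compact region whose frontier is a simple closed
polygonal curve with vertices (`corner`) in `ℤ²`. Flat corners are allowed. -/
structure LatticePolygon where
  n : ℕ
  three_le : 3 ≤ n
  corner : ZMod n → LatticeVec
  region : Set Plane
  corner_injective : Function.Injective corner
  simple : ∀ i j, i ≠ j →
    segment ℝ (corner i).toPlane (corner (i + 1)).toPlane ∩
        segment ℝ (corner j).toPlane (corner (j + 1)).toPlane ⊆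
      {(corner i).toPlane, (corner (i + 1)).toPlane} ∩
        {(corner j).toPlane, (corner (j + 1)).toPlane}
  compact : IsCompact region
  interior_nonempty : (interior region).Nonempty
  frontier_eq : frontier region =
    ⋃ i, segment ℝ (corner i).toPlane (corner (i + 1)).toPlane

namespace LatticePolygon

/-- The edges of a lattice polygon. -/
def edges (σ : LatticePolygon) : Set (Set Plane) :=
  Set.range fun i => segment ℝ (σ.corner i).toPlane (σ.corner (i + 1)).toPlane

/-- The proper faces of a lattice polygon: the empty face, the corners and the edges. -/
def properFaces (σ : LatticePolygon) : Set (Set Plane) :=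
  {∅} ∪ (Set.range fun i => {(σ.corner i).toPlane}) ∪ σ.edges

/-- A lattice polygon that is convex, with all its corners being vertices (extreme points). -/
def IsConvex (σ : LatticePolygon) : Prop :=
  Convex ℝ σ.region ∧ ∀ i, (σ.corner i).toPlane ∈ Set.extremePoints ℝ σ.region

end LatticePolygon

/-- A tropical surface `(B, 𝒫)`: an integral affine surface with singularities and a finite
polyhedral decomposition into embedded lattice polygons that meet along common faces.
The interiors of the polygons and the vertices avoid `Δ`, so singular points can
occur only in the relative interiors of edges. Away from `Δ` the polygons are integral affinely
embedded, up to and including their edges and corners; in particular at each vertex (which is a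
nonsingular integral point) the tangent wedges of the polygons form a fan in an affine chart,
and the tangent direction of an edge is invariant under the monodromy of points on it. -/
structure TropicalSurface extends IntegralAffineSurface where
  /-- labels of the maximal cells -/
  Cell : Type
  finite_cell : Finite Cell
  cell : Cell → LatticePolygon
  /-- the embedding of the polygon (only its values on the polygon matter) -/
  emb : Cell → Plane → carrier
  emb_continuous : ∀ j, ContinuousOn (emb j) (cell j).region
  emb_injective : ∀ j, Set.InjOn (emb j) (cell j).region
  covers : ∀ x : carrier, ∃ j, x ∈ emb j '' (cell j).region
  corner_nonsing : ∀ j i, emb j ((cell j).corner i).toPlane ∉ sing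
  interior_nonsing : ∀ j, ∀ x ∈ interior (cell j).region, emb j x ∉ sing
  emb_affine : ∀ j, ∀ x ∈ (cell j).region, ∀ e ∈ atlas, emb j x ∈ e.source →
    ∃ M b, ∀ᶠ y in 𝓝[(cell j).region] x, (e (emb j y) : Plane) = intAff M b y
  face_to_face : ∀ j k, j ≠ k → ∃ f ∈ (cell j).properFaces, ∃ g ∈ (cell k).properFaces,
    emb j '' (cell j).region ∩ emb k '' (cell k).region = emb j '' f ∧ emb j '' f = emb k '' g

/-- The edges of the polyhedral decomposition, as subsets of the surface. -/
def TropicalSurface.edges (A : TropicalSurface) : Set (Set A.carrier) :=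
  {E | ∃ j, ∃ s ∈ (A.cell j).edges, E = A.emb j '' s}

/-!
A lattice triangle `{0, v i, v (i + 1)}` without interior lattice points and with primitive `v i`,
`v (i + 1)` has lattice height one over its edge opposite to `0`
(`det2_eq_gcd_of_no_interior`). Hence the corners and edge directions of the polygon form a closed
chain of oriented lattice bases `(v i, u i)`, in which consecutive bases differ by two shears:
`v (i + 1) = v i + ℓ i • u i` along an edge and `u i = u (i + 1) + c (i + 1) • v (i + 1)` at a
corner, where `c` is the order of the corner (`IsPolygonData.fan`). The identity `∑ ℓ + ∑ c = 12` is
Noether's formula for toric surfaces (`LatticeVec.sum_shear_eq_twelve`). It is proved with a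
potential on oriented lattice bases that grows by the shear parameter in each step, except for a
jump by `-12` once in each turn around the origin.

Both surfaces are the disc `{gauge ≤ 2}` in the plane, where `gauge` is the function that is linear
on the cones over the edges of the polygon and equal to `1` on its boundary. The affine structure is
that of the plane near the origin, and that of a cylinder near the boundary. More precisely, near
the `i`-th ray there is a piecewise linear coordinate `tau i`, which measures the affine length
along the level curves of the gauge from the ray, normalized outside of the polygon so that these curves
are as long as its boundary; and `(tau i, gauge)` is, up to orientation, an affine chart of the
outer structure. The inner chart at the `i`-th ray differs from it by a shear by `c i` on one side of the
ray (`affRel_fold`), so that a point of the ray at which the structure changes from inner to outer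
is singular of multiplicity `c i` (`hasMultiplicity_rayPt`). Outer charts at consecutive rays differ
by a translation outside of the polygon and by a shear by `ℓ i` inside of it
(`affRel_outer_of_mem_cone`), so that the midpoint of the `i`-th edge is singular of multiplicity
`ℓ i` (`hasMultiplicity_midPt`).

The only freedom is the gauge `r` at which the structure changes on the rays. For `r = 1 / 2` these
singular points lie inside of the polygon, whose boundary becomes an affine circle in the process;
for `r = 3 / 2` they lie outside of it, so that the polygon keeps the affine structure of the plane.
The cells are lattice rectangles (`rectangleMap`) outside of the polygon, and inside of it either
the triangles over the edges (`triangleMap`) or the polygon itself. The level curves of the gauge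
beyond `r` and at or beyond `1` are affine circles (`isAffineCircle_gauge`) whose length is the
number of lattice points in the boundary of the polygon (`boundaryLatticePoints_eq`).
-/

/-! ### Noether's formula for chains of lattice bases -/

/-- A Dedekind-sum-like function of a primitive vector `(x, y)` with `y > 0`, defined along the
Euclidean algorithm: for `y > 1` the vector `(x, y)` is compared with the unique `(z, w)` with
`x * w - y * z = 1` and `0 < w < y`. -/
def farey (x : ℤ) (y : ℕ) : ℚ :=
  if h : y ≤ 1 then 3 - x
  else
    farey ((x * (Int.gcdA x y % y) - 1) / y) (Int.gcdA x y % y).toNat - 3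
      + ((Int.gcdA x y % y).toNat : ℚ) / y + y / ((Int.gcdA x y % y).toNat : ℚ)
termination_by y
decreasing_by
  have h1 := Int.emod_lt_of_pos (Int.gcdA x y) (show (0 : ℤ) < y by omega)
  have h2 := Int.emod_nonneg (Int.gcdA x y) (show (y : ℤ) ≠ 0 by omega)
  omega

theorem farey_step {x z : ℤ} {y w : ℕ} (hw : 0 < w) (hwy : w < y) (h : x * w - y * z = 1) :
    farey x y = farey z w - 3 + (w : ℚ) / y + y / (w : ℚ) := by
  have hg : Int.gcd x y = 1 := by
    rw [← Int.isCoprime_iff_gcd_eq_one]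
    exact ⟨w, -z, by linarith⟩
  have hb := Int.gcd_eq_gcd_ab x y
  rw [hg] at hb
  push_cast at hb
  have hdvd : (y : ℤ) ∣ w - Int.gcdA x y := by
    have hc : IsCoprime (y : ℤ) x := (Int.isCoprime_iff_gcd_eq_one.2 hg).symm
    refine hc.dvd_of_dvd_mul_left ⟨z + Int.gcdB x y, ?_⟩
    linarith
  have hmod : Int.gcdA x y % y = w := by
    have h4 : (w : ℤ) % y = w := Int.emod_eq_of_lt (by omega) (by omega)
    have h5 := (Int.emod_eq_emod_iff_emod_sub_eq_zero (m := (w : ℤ)) (n := y)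
      (k := Int.gcdA x y)).2 (Int.emod_eq_zero_of_dvd hdvd)
    omega
  have hz : (x * (w : ℤ) - 1) / y = z := by
    rw [show x * (w : ℤ) - 1 = y * z by linarith]
    exact Int.mul_ediv_cancel_left _ (by omega)
  rw [farey, dif_neg (by omega), hmod, hz]
  simp

theorem farey_one (x : ℤ) : farey x 1 = 3 - x := by
  rw [farey, dif_pos le_rfl]

/-- The reciprocity law of `farey`. -/
theorem farey_reciprocity {x z : ℤ} {y w : ℕ} (hy : 0 < y) (hw : 0 < w)
    (h : x * w - y * z = 1) :
    farey z w - farey x y = 3 - (w : ℚ) / y - y / (w : ℚ) := by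
  induction hn : y + w using Nat.strong_induction_on generalizing x y z w with
  | _ n ih =>
  rcases lt_trichotomy w y with hlt | heq | hgt
  · rw [farey_step hw hlt h]; ring
  · subst heq
    have h1 : w = 1 := by
      have : (w : ℤ) ∣ 1 := ⟨x - z, by linarith⟩
      have := Int.eq_one_of_dvd_one (by omega) this
      omega
    subst h1
    rw [farey_one, farey_one]
    have : (z : ℚ) = x - 1 := by
      have : z = x - 1 := by push_cast at h; linarith
      rw [this]; push_cast; ring
    rw [this]; norm_num
  · obtain ⟨k, rfl⟩ := Nat.exists_eq_add_of_lt hgt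
    have hk : y + k + 1 = y + (k + 1) := by ring
    rw [hk] at *
    have h1 : z * ((k + 1 : ℕ) : ℤ) - ((y + (k + 1) : ℕ) : ℤ) * (z - x) = 1 := by
      push_cast at h ⊢; linarith
    have h2 : x * ((k + 1 : ℕ) : ℤ) - (y : ℤ) * (z - x) = 1 := by
      push_cast at h ⊢; linarith
    have e1 := farey_step (Nat.succ_pos k) (by omega) h1
    have e2 := ih (y + (k + 1)) (by omega) hy (Nat.succ_pos k) h2 rfl
    rw [e1]
    have hyq : (y : ℚ) ≠ 0 := by positivity
    have hkq : ((k + 1 : ℕ) : ℚ) ≠ 0 := by positivity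
    have hs : ((y + (k + 1) : ℕ) : ℚ) = y + (k + 1 : ℕ) := by push_cast; ring
    have hsq : (y : ℚ) + (k + 1 : ℕ) ≠ 0 := by positivity
    rw [hs]
    have : farey (z - x) (k + 1) = farey x y + 3 - ((k + 1 : ℕ) : ℚ) / y
      - y / ((k + 1 : ℕ) : ℚ) := by linarith
    rw [this]
    generalize ((k + 1 : ℕ) : ℚ) = b at *
    field_simp
    ring

namespace LatticeVec

/-- The half of `ℤ² ∖ 0` consisting of the vectors with argument in `(0, π]`. -/
def IsUpper (p : LatticeVec) : Prop := 0 < p 1 ∨ (p 1 = 0 ∧ p 0 < 0)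

theorem IsUpper.add {p q : LatticeVec} (hp : p.IsUpper) (hq : q.IsUpper) : (p + q).IsUpper := by
  unfold IsUpper at *
  simp only [Pi.add_apply]
  omega

theorem isUpper_neg {p : LatticeVec} (hp : p ≠ 0) : (-p).IsUpper ↔ ¬ p.IsUpper := by
  have : ¬ (p 0 = 0 ∧ p 1 = 0) := fun h => hp (by ext k; fin_cases k <;> simp [h])
  unfold IsUpper
  simp only [Pi.neg_apply]
  omega

theorem ne_zero_of_det2_eq_one {a b : LatticeVec} (h : det2 a b = 1) : a ≠ 0 ∧ b ≠ 0 := by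
  constructor <;> rintro rfl <;> simp [det2] at h

/-- The potential of an oriented lattice basis `(a, b)` with `a` in the upper half plane. -/
def upperPotential (a b : LatticeVec) : ℚ :=
  if a 1 = 0 then b 0 + 6 else farey (a 0) (a 1).toNat - (b 1 : ℚ) / a 1

open Classical in
/-- The potential of an oriented lattice basis: the value of a homomorphism from the universal
central extension of `SL₂(ℤ)` to `ℤ`, on the lift given by the branch `(0, 2π]` of the argument
of the first basis vector. -/
noncomputable def potential (a b : LatticeVec) : ℚ :=
  if a.IsUpper then upperPotential a b else upperPotential (-a) (-b) + 6

/-- The potential changes linearly under shears that fix the first basis vector. -/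
theorem upperPotential_sub {a b : LatticeVec} (h : det2 a b = 1) (ha : a.IsUpper) (n : ℤ) :
    upperPotential a (b - n • a) = upperPotential a b + n := by
  unfold upperPotential
  by_cases h0 : a 1 = 0
  · have h1 : a 0 = -1 := by
      have : a 0 * b 1 = 1 := by simpa [det2, h0] using h
      rcases Int.eq_one_or_neg_one_of_mul_eq_one this with h | h
      · unfold IsUpper at ha; omega
      · exact h
    simp [h0, h1]; ring
  · have : (a 1 : ℚ) ≠ 0 := by exact_mod_cast h0
    simp [h0]; field_simp; ring

theorem potential_sub {a b : LatticeVec} (h : det2 a b = 1) (n : ℤ) :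
    potential a (b - n • a) = potential a b + n := by
  unfold potential
  split_ifs with ha
  · exact upperPotential_sub h ha n
  · have ha' := (isUpper_neg (ne_zero_of_det2_eq_one h).1).2 ha
    have := upperPotential_sub (a := -a) (b := -b) (by simpa [det2] using h) ha' n
    rw [← sub_eq_zero] at this ⊢
    rw [← this, show -(b - n • a) = -b - n • -a by rw [smul_neg]; abel]; ring

/-- The potential grows by `3` in a quarter turn: the reciprocity law of Dedekind sums. -/
theorem upperPotential_rotate {a b : LatticeVec} (h : det2 a b = 1) (ha : a.IsUpper)
    (hb : b.IsUpper) : upperPotential b (-a) = upperPotential a b + 3 := by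
  unfold upperPotential IsUpper det2 at *
  by_cases ha0 : a 1 = 0
  · exfalso
    have h1 : a 0 * b 1 = 1 := by simpa [ha0] using h
    rcases Int.eq_one_or_neg_one_of_mul_eq_one' h1 with h | h <;> omega
  have hap : 0 < a 1 := by omega
  by_cases hb0 : b 1 = 0
  · have h1 : a 1 * (-b 0) = 1 := by rw [hb0] at h; linarith
    have h2 := Int.eq_one_or_neg_one_of_mul_eq_one' h1
    have h3 : a 1 = 1 := by omega
    have h4 : b 0 = -1 := by omega
    simp [hb0, h3, farey_one]
    ring
  · have hbp : 0 < b 1 := by omega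
    have := farey_reciprocity (x := a 0) (y := (a 1).toNat) (z := b 0) (w := (b 1).toNat)
      (by omega) (by omega) (by
        rw [Int.toNat_of_nonneg hap.le, Int.toNat_of_nonneg hbp.le]; exact h)
    have ea : (((a 1).toNat : ℕ) : ℚ) = a 1 := by
      exact_mod_cast congrArg (Int.cast : ℤ → ℚ) (Int.toNat_of_nonneg hap.le)
    have eb : (((b 1).toNat : ℕ) : ℚ) = b 1 := by
      exact_mod_cast congrArg (Int.cast : ℤ → ℚ) (Int.toNat_of_nonneg hbp.le)
    rw [ea, eb] at this
    simp only [ha0, hb0, if_false, Pi.neg_apply, Int.cast_neg]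
    rw [neg_div]
    linarith

open Classical in
/-- A unit shear that fixes the second basis vector increases the potential by `1`, up to the jump
when the first basis vector enters the upper half plane. -/
theorem potential_add {a b : LatticeVec} (h : det2 a b = 1) :
    potential (a + b) b = potential a b + 1 - if ¬ a.IsUpper ∧ (a + b).IsUpper then 12 else 0 := by
  -- the two cases for `a` in the upper half plane, by factoring the shear through quarter turns
  have key1 : ∀ {a b : LatticeVec}, det2 a b = 1 → a.IsUpper → (a + b).IsUpper →
      upperPotential (a + b) b = upperPotential a b + 1 := by
    intro a b h ha hab
    have h1 : det2 a (a + b) = 1 := by simp [det2] at *; linarith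
    have h2 : det2 (a + b) (-a) = 1 := by simp [det2] at *; linarith
    have e1 := upperPotential_rotate h1 ha hab
    have e2 := upperPotential_sub h ha (-1)
    have e3 := upperPotential_sub h2 hab (-1)
    rw [show b - (-1 : ℤ) • a = a + b by simp; abel] at e2
    rw [show -a - (-1 : ℤ) • (a + b) = b by simp] at e3
    push_cast at *; linarith
  have key2 : ∀ {a b : LatticeVec}, det2 a b = 1 → a.IsUpper → ¬ (a + b).IsUpper →
      upperPotential (-(a + b)) (-b) + 6 = upperPotential a b + 1 := by
    intro a b h ha hab
    have h2 : det2 (-(a + b)) a = 1 := by simp [det2] at *; linarith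
    have h1 : (-(a + b)).IsUpper := by
      refine (isUpper_neg ?_).2 hab
      intro h0; rw [h0] at h2; simp [det2] at h2
    have e1 := upperPotential_rotate h2 h1 ha
    have e2 := upperPotential_sub h ha (-1)
    have e3 := upperPotential_sub h2 h1 (-1)
    rw [show b - (-1 : ℤ) • a = - -(a + b) by simp; abel] at e2
    rw [show a - (-1 : ℤ) • -(a + b) = -b by simp] at e3
    push_cast at *; linarith
  have hn : det2 (-a) (-b) = 1 := by simpa [det2] using h
  have hadd : det2 (a + b) b = 1 := by simp [det2] at *; linarith
  have e : -a + -b = -(a + b) := by abel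
  have hab0 := (ne_zero_of_det2_eq_one hadd).1
  have ha0 := (ne_zero_of_det2_eq_one h).1
  by_cases ha : a.IsUpper <;> by_cases hab : (a + b).IsUpper <;>
    simp only [potential, ha, hab, not_true, not_false_iff, if_true, if_false, and_true,
      and_false]
  · rw [key1 h ha hab]; ring
  · rw [key2 h ha hab]; ring
  · have := key2 hn ((isUpper_neg ha0).2 ha) (by rw [e, isUpper_neg hab0]; exact not_not.2 hab)
    rw [e, neg_neg, neg_neg] at this
    linarith
  · have := key1 hn ((isUpper_neg ha0).2 ha) (by rw [e, isUpper_neg hab0]; exact hab)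
    rw [e] at this
    linarith

open Classical in
theorem potential_add_nsmul {a b : LatticeVec} (h : det2 a b = 1) (n : ℕ) :
    potential (a + n • b) b =
      potential a b + n - if ¬ a.IsUpper ∧ (a + n • b).IsUpper then 12 else 0 := by
  induction n with
  | zero => simp
  | succ n ih =>
    have h1 : det2 (a + n • b) b = 1 := by simp [det2] at *; linarith
    have h2 : det2 (a + (n + 1) • b) b = 1 := by simp [det2] at *; linarith
    have := potential_add h1
    have e : a + n • b + b = a + (n + 1) • b := by rw [add_smul, one_smul, add_assoc]
    rw [e] at this
    rw [this, ih]
    have hb0 := (ne_zero_of_det2_eq_one h).2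
    have ha0 := (ne_zero_of_det2_eq_one h).1
    -- an upper `a` stays upper, or leaves the upper half plane for good
    have hA : ¬ (a.IsUpper ∧ ¬ (a + n • b).IsUpper ∧ (a + (n + 1) • b).IsUpper) := by
      rintro ⟨ha, h3, h4⟩
      have hbU : b.IsUpper := by
        have := ((isUpper_neg (ne_zero_of_det2_eq_one h1).1).2 h3).add h4
        rwa [← e, neg_add_cancel_left] at this
      refine h3 ?_
      clear * - ha hbU
      induction n with
      | zero => rwa [zero_smul, add_zero]
      | succ n ih => rw [add_smul, one_smul, ← add_assoc]; exact ih.add hbU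
    have hB : ¬ a.IsUpper → (a + n • b).IsUpper → (a + (n + 1) • b).IsUpper := by
      intro ha hm
      have hbU : b.IsUpper := by
        by_contra hb
        have hb' := (isUpper_neg hb0).2 hb
        have h3 := ((isUpper_neg ha0).2 ha).add hm
        rw [neg_add_cancel_left] at h3
        rcases Nat.eq_zero_or_pos n with rfl | hn0
        · simp [IsUpper] at h3
        · have h4 : (n • -b).IsUpper := by
            clear * - hn0 hb'
            induction n, hn0 using Nat.le_induction with
            | base => simpa using hb'
            | succ k _ ih => rw [add_smul, one_smul]; exact ih.add hb'
          have h5 := h4.add h3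
          simp [IsUpper] at h5
      rw [← e]; exact hm.add hbU
    clear * - hA hB
    generalize a + n • b = p at *
    generalize a + (n + 1) • b = q at *
    push_cast
    by_cases ha : a.IsUpper <;> by_cases hp : p.IsUpper <;> by_cases hq : q.IsUpper <;>
      simp [ha, hp, hq] at hA hB ⊢ <;> ring

open Classical in
/-- **Noether's formula for toric surfaces**: in a closed chain of lattice bases
`(v_i, u_i)` connected by shears `v_{i+1} = v_i + ℓ_i u_i`, `u_i = u_{i+1} + c_{i+1} v_{i+1}`,
the shear parameters sum to `12` for each turn around the origin. -/
theorem sum_shear_eq_twelve {m : ℕ} [NeZero m] (v u : ZMod m → LatticeVec) (l : ZMod m → ℕ)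
    (c : ZMod m → ℤ) (hdet : ∀ i, det2 (v i) (u i) = 1)
    (hv : ∀ i, v (i + 1) = v i + l i • u i) (hu : ∀ i, u i = u (i + 1) + c (i + 1) • v (i + 1))
    (hcross : ∃! i, ¬ (v i).IsUpper ∧ (v (i + 1)).IsUpper) :
    ∑ i, (l i : ℤ) + ∑ i, c i = 12 := by
  have step : ∀ i, potential (v (i + 1)) (u (i + 1)) - potential (v i) (u i) =
      l i + c (i + 1) - if ¬ (v i).IsUpper ∧ (v (i + 1)).IsUpper then 12 else 0 := by
    intro i
    have h1 := potential_add_nsmul (hdet i) (l i)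
    have h2 : det2 (v (i + 1)) (u i) = 1 := by
      have := hdet i; rw [hv]; simp [det2] at *; linarith
    have h3 := potential_sub h2 (c (i + 1))
    rw [← hv] at h1
    rw [show u i - c (i + 1) • v (i + 1) = u (i + 1) by rw [hu i]; simp] at h3
    rw [h3, h1]; ring
  have hs : ∀ f : ZMod m → ℚ, ∑ i, f (i + 1) = ∑ i, f i := fun f =>
    Equiv.sum_comp (Equiv.addRight (1 : ZMod m)) f
  have h0 : ∑ i, (potential (v (i + 1)) (u (i + 1)) - potential (v i) (u i)) = 0 := by
    rw [Finset.sum_sub_distrib, hs (fun i => potential (v i) (u i)), sub_self]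
  simp_rw [step] at h0
  obtain ⟨i₀, hi, huniq⟩ := hcross
  have hc : ∑ i, (if ¬ (v i).IsUpper ∧ (v (i + 1)).IsUpper then (12 : ℚ) else 0) = 12 := by
    rw [Finset.sum_eq_single i₀]
    · exact if_pos hi
    · intro j _ hj; exact if_neg fun h => hj (huniq j h)
    · simp
  rw [Finset.sum_sub_distrib, Finset.sum_add_distrib, hc, hs (fun i => (c i : ℚ))] at h0
  have : ((∑ i, (l i : ℤ) + ∑ i, c i : ℤ) : ℚ) = 12 := by push_cast; linarith
  exact_mod_cast this

end LatticeVec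

/-! ### Integral affine germs -/

theorem intAff_apply (M : Matrix.SpecialLinearGroup (Fin 2) ℤ) (b : LatticeVec) (x : Plane) :
    intAff M b x = ![M.1 0 0 * x 0 + M.1 0 1 * x 1 + b 0, M.1 1 0 * x 0 + M.1 1 1 * x 1 + b 1] := by
  ext k
  fin_cases k <;> simp [intAff, LatticeVec.toPlane]

theorem intAff_comp (M M' : Matrix.SpecialLinearGroup (Fin 2) ℤ) (b b' : LatticeVec) :
    ∃ b'', ∀ x, intAff M b (intAff M' b' x) = intAff (M * M') b'' x := by
  refine ⟨M.1 *ᵥ b' + b, fun x => ?_⟩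
  simp only [intAff_apply]
  ext k
  fin_cases k <;> simp [Matrix.mul_apply, Fin.sum_univ_two] <;> ring

theorem intAff_one_zero (x : Plane) : intAff 1 0 x = x := by
  rw [intAff_apply]; ext k; fin_cases k <;> simp

/-- Along the filter `l`, the map `g` is the composition of `f` with an oriented integral affine
transformation. -/
def AffRel {X : Type*} (l : Filter X) (f g : X → Plane) : Prop :=
  ∃ M b, ∀ᶠ y in l, g y = intAff M b (f y)

namespace AffRel

variable {X : Type*} {l : Filter X} {f g k : X → Plane}

theorem of_eventuallyEq (h : ∀ᶠ y in l, g y = f y) : AffRel l f g :=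
  ⟨1, 0, h.mono fun y hy => by rw [intAff_one_zero, hy]⟩

theorem refl (l : Filter X) (f : X → Plane) : AffRel l f f :=
  of_eventuallyEq (Eventually.of_forall fun _ => rfl)

theorem trans (h : AffRel l f g) (h' : AffRel l g k) : AffRel l f k := by
  obtain ⟨M, b, h⟩ := h
  obtain ⟨M', b', h'⟩ := h'
  obtain ⟨b'', hb⟩ := intAff_comp M' M b' b
  exact ⟨M' * M, b'', by filter_upwards [h, h'] with y h1 h2; rw [h2, h1, hb]⟩

/-- To exhibit an integral affine relation it is enough to give the integral coefficients. -/
theorem of_coeff (a b c d p q : ℤ) (hdet : a * d - b * c = 1)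
    (h : ∀ᶠ y in l, g y 0 = a * f y 0 + b * f y 1 + p ∧ g y 1 = c * f y 0 + d * f y 1 + q) :
    AffRel l f g := by
  let M : Matrix.SpecialLinearGroup (Fin 2) ℤ :=
    ⟨Matrix.of ![![a, b], ![c, d]], by rw [Matrix.det_fin_two]; simpa using hdet⟩
  refine ⟨M, ![p, q], h.mono fun y hy => ?_⟩
  rw [intAff_apply]
  ext k
  fin_cases k <;> simp [M, hy.1, hy.2]

theorem symm (h : AffRel l f g) : AffRel l g f := by
  obtain ⟨M, b, h⟩ := h
  have hd : M.1 0 0 * M.1 1 1 - M.1 0 1 * M.1 1 0 = 1 := by rw [← Matrix.det_fin_two, M.2]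
  have hr : (M.1 0 0 * M.1 1 1 - M.1 0 1 * M.1 1 0 : ℝ) = 1 := by exact_mod_cast hd
  refine of_coeff (M.1 1 1) (-M.1 0 1) (-M.1 1 0) (M.1 0 0) (-(M.1 1 1 * b 0 - M.1 0 1 * b 1))
    (-(-M.1 1 0 * b 0 + M.1 0 0 * b 1)) (by linarith) (h.mono fun y hy => ?_)
  rw [hy, intAff_apply]
  simp only [Matrix.cons_val_zero, Matrix.cons_val_one]
  push_cast
  constructor
  · linear_combination (-f y 0) * hr
  · linear_combination (-f y 1) * hr

theorem mono (h : AffRel l f g) {l' : Filter X} (hl : l' ≤ l) : AffRel l' f g := by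
  obtain ⟨M, b, h⟩ := h
  exact ⟨M, b, hl h⟩

end AffRel

/-! ### Topology of the plane -/

open Classical in
/-- An open partial homeomorphism that matches the subsets `p` and `q` restricts to one between
the subtypes. -/
noncomputable def OpenPartialHomeomorph.restrictSubtype {α β : Type*} [TopologicalSpace α]
    [TopologicalSpace β] (e : OpenPartialHomeomorph α β) (p : α → Prop) (q : β → Prop)
    (hpq : ∀ x ∈ e.source, p x ↔ q (e x)) (a₀ : Subtype p) (b₀ : Subtype q) :
    OpenPartialHomeomorph (Subtype p) (Subtype q) where
  toFun := fun x => if h : q (e x) then ⟨e x, h⟩ else b₀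
  invFun := fun y => if h : p (e.symm y) then ⟨e.symm y, h⟩ else a₀
  source := Subtype.val ⁻¹' e.source
  target := Subtype.val ⁻¹' e.target
  map_source' := fun x hx => by
    have : q (e x) := (hpq x hx).1 x.2
    rw [mem_preimage, dif_pos this]
    exact e.map_source hx
  map_target' := fun y hy => by
    have : p (e.symm y) := (hpq _ (e.map_target hy)).2 (by rw [e.right_inv hy]; exact y.2)
    rw [mem_preimage, dif_pos this]
    exact e.map_target hy
  left_inv' := fun x hx => by
    have h1 : q (e x) := (hpq x hx).1 x.2
    have h2 : p (e.symm (e x)) := by rw [e.left_inv hx]; exact x.2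
    simp only [dif_pos h1, dif_pos h2]
    exact Subtype.ext (e.left_inv hx)
  right_inv' := fun y hy => by
    have h1 : p (e.symm y) := (hpq _ (e.map_target hy)).2 (by rw [e.right_inv hy]; exact y.2)
    have h2 : q (e (e.symm y)) := by rw [e.right_inv hy]; exact y.2
    simp only [dif_pos h1, dif_pos h2]
    exact Subtype.ext (e.right_inv hy)
  open_source := e.open_source.preimage continuous_subtype_val
  open_target := e.open_target.preimage continuous_subtype_val
  continuousOn_toFun := by
    rw [Topology.IsInducing.continuousOn_iff ⟨rfl⟩ (g := Subtype.val)]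
    refine (e.continuousOn.comp continuous_subtype_val.continuousOn fun x hx => hx).congr
      fun x hx => ?_
    have : q (e x) := (hpq x hx).1 x.2
    simp only [Function.comp, dif_pos this]
  continuousOn_invFun := by
    rw [Topology.IsInducing.continuousOn_iff ⟨rfl⟩ (g := Subtype.val)]
    refine (e.symm.continuousOn.comp continuous_subtype_val.continuousOn fun x hx => hx).congr
      fun y hy => ?_
    have : p (e.symm y) := (hpq _ (e.map_target hy)).2 (by rw [e.right_inv hy]; exact y.2)
    simp only [Function.comp, dif_pos this]

namespace OpenPartialHomeomorph

variable {α β : Type*} [TopologicalSpace α] [TopologicalSpace β] (e : OpenPartialHomeomorph α β)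
  (p : α → Prop) (q : β → Prop) (hpq : ∀ x ∈ e.source, p x ↔ q (e x)) (a₀ : Subtype p)
  (b₀ : Subtype q)

theorem restrictSubtype_apply {x : Subtype p} (hx : (x : α) ∈ e.source) :
    (e.restrictSubtype p q hpq a₀ b₀ x : β) = e x :=
  congrArg Subtype.val (dif_pos ((hpq x hx).1 x.2))

end OpenPartialHomeomorph

/-- A closed plane region is bounded by `F` if its other points are interior and the points of
`F` leave the region when they are pushed away from some centre. -/
theorem frontier_eq_of_push {R F : Set Plane} (hR : IsClosed R) (hF : F ⊆ R)
    (ho : IsOpen (R \ F)) (p : Plane) (h : ∀ x ∈ F, ∀ ε : ℝ, 0 < ε → x + ε • (x - p) ∉ R) :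
    frontier R = F ∧ interior R = R \ F := by
  have hi : interior R = R \ F := by
    refine Subset.antisymm (fun x hx => ⟨interior_subset hx, fun hxF => ?_⟩)
      (interior_maximal sdiff_subset ho)
    have hc : Tendsto (fun ε : ℝ => x + ε • (x - p)) (𝓝[>] 0) (𝓝 x) := by
      have : Continuous fun ε : ℝ => x + ε • (x - p) := by fun_prop
      have h2 := this.tendsto 0
      simp only [zero_smul, add_zero] at h2
      exact h2.mono_left nhdsWithin_le_nhds
    obtain ⟨ε, h1, h2⟩ := ((hc.eventually (mem_interior_iff_mem_nhds.1 hx)).and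
      self_mem_nhdsWithin).exists
    exact h x hxF ε h2 h1
  refine ⟨?_, hi⟩
  rw [hR.frontier_eq, hi, sdiff_sdiff_cancel_left hF]

/-! ### Reflexive polygons as unimodular fans -/

/-- The determinant of two vectors of the plane. -/
def detR (a b : Plane) : ℝ := a 0 * b 1 - a 1 * b 0

theorem detR_toPlane (a b : LatticeVec) :
    detR a.toPlane b.toPlane = (LatticeVec.det2 a b : ℤ) := by
  simp [detR, LatticeVec.det2, LatticeVec.toPlane]

/-- The combinatorial data of a (possibly non-convex) reflexive polygon: the corners `v i`, the
primitive edge vectors `u i`, the edge lengths `l i` and the corner orders `c i`. Each pair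
`(v i, u i)` is an oriented lattice basis, and the half open cones spanned by `v i` and
`v (i + 1)` partition the plane without the origin. -/
structure ReflexiveFan (m : ℕ) [NeZero m] where
  v : ZMod m → LatticeVec
  u : ZMod m → LatticeVec
  l : ZMod m → ℕ
  c : ZMod m → ℤ
  three_le : 3 ≤ m
  l_pos : ∀ i, 0 < l i
  det_eq : ∀ i, LatticeVec.det2 (v i) (u i) = 1
  v_succ : ∀ i, v (i + 1) = v i + l i • u i
  u_eq : ∀ i, u i = u (i + 1) + c (i + 1) • v (i + 1)
  sector : ∀ x : Plane, x ≠ 0 →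
    ∃! i, 0 ≤ detR (v i).toPlane x ∧ 0 < detR x (v (i + 1)).toPlane

namespace ReflexiveFan

variable {m : ℕ} [NeZero m] (F : ReflexiveFan m)

theorem det_succ (i : ZMod m) : LatticeVec.det2 (F.v i) (F.v (i + 1)) = F.l i := by
  have := F.det_eq i
  rw [F.v_succ]
  simp [LatticeVec.det2] at *
  linear_combination (F.l i : ℤ) * this

theorem sum_l_add_sum_c : ∑ i, (F.l i : ℤ) + ∑ i, F.c i = 12 := by
  refine LatticeVec.sum_shear_eq_twelve F.v F.u F.l F.c F.det_eq F.v_succ F.u_eq ?_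
  have hne : (![1, 0] : Plane) ≠ 0 := fun h => by simpa using congrFun h 0
  refine (existsUnique_congr fun i => ?_).1 (F.sector ![1, 0] hne)
  have hd := F.det_succ i
  have hl := F.l_pos i
  simp only [detR, LatticeVec.toPlane, LatticeVec.IsUpper, LatticeVec.det2] at *
  simp only [Matrix.cons_val_zero, Matrix.cons_val_one, mul_zero, mul_one, zero_sub, one_mul,
    zero_mul, sub_zero]
  rw [neg_nonneg, Int.cast_nonpos, Int.cast_pos]
  generalize F.v i 0 = a, F.v i 1 = b, F.v (i + 1) 0 = p, F.v (i + 1) 1 = q at *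
  have hd' : 0 < a * q - b * p := by rw [hd]; exact_mod_cast hl
  constructor
  · rintro ⟨h1, h2⟩
    refine ⟨?_, Or.inl h2⟩
    rintro (h | ⟨h, h'⟩)
    · omega
    · subst h; nlinarith
  · rintro ⟨h1, h2⟩
    push Not at h1
    refine ⟨h1.1, ?_⟩
    rcases h2 with h2 | ⟨rfl, h3⟩
    · exact h2
    · nlinarith [h1.1]

end ReflexiveFan

theorem detR_polar (ρ σ a b : ℝ) :
    detR (ρ • ![Real.cos a, Real.sin a]) (σ • ![Real.cos b, Real.sin b]) =
      ρ * σ * Real.sin (b - a) := by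
  rw [Real.sin_sub]; simp [detR]; ring

theorem exists_polar {x : Plane} (hx : x ≠ 0) :
    ∃ ρ φ : ℝ, 0 < ρ ∧ x = ρ • ![Real.cos φ, Real.sin φ] := by
  have hz : (⟨x 0, x 1⟩ : ℂ) ≠ 0 := by
    intro h
    refine hx ?_
    have h0 := congrArg Complex.re h
    have h1 := congrArg Complex.im h
    ext k; fin_cases k
    · simpa using h0
    · simpa using h1
  refine ⟨‖(⟨x 0, x 1⟩ : ℂ)‖, Complex.arg ⟨x 0, x 1⟩, norm_pos_iff.2 hz, ?_⟩
  ext k; fin_cases k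
  · simp [Complex.norm_mul_cos_arg]
  · simp [Complex.norm_mul_sin_arg]

theorem exists_between_of_le_of_lt (f : ℕ → ℝ) (n : ℕ) (y : ℝ) (h0 : f 0 ≤ y) (hn : y < f n) :
    ∃ k < n, f k ≤ y ∧ y < f (k + 1) := by
  induction n with
  | zero => exact absurd hn (not_lt.2 h0)
  | succ n ih =>
    rcases lt_or_ge y (f n) with h | h
    · obtain ⟨k, hk, h'⟩ := ih h
      exact ⟨k, by omega, h'⟩
    · exact ⟨n, by omega, h, hn⟩

/-- A direction `φ` in the turn starting at `a₀` lies in the cone between the directions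
`a` and `b` if the sines say so. -/
theorem mem_Ico_of_sin {a₀ a b φ : ℝ} (ha : a₀ ≤ a)
    (hb : b ≤ a₀ + 2 * Real.pi) (hab : a < b) (h0 : a₀ ≤ φ)
    (h1 : φ < a₀ + 2 * Real.pi) (hs : 0 ≤ Real.sin (φ - a)) (hs' : 0 < Real.sin (b - φ)) :
    a ≤ φ ∧ φ < b := by
  have hpi := Real.pi_pos
  have hneg : ∀ t : ℝ, -Real.pi ≤ t → t ≤ 0 → Real.sin t ≤ 0 := fun t h h' =>
    Real.sin_nonpos_of_nonpos_of_neg_pi_le h' h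
  rcases lt_or_ge φ a with h | h
  · exfalso
    have h3 : φ - a ≤ -Real.pi := by
      by_contra hc
      push Not at hc
      exact absurd hs (not_le.2 (Real.sin_neg_of_neg_of_neg_pi_lt (by linarith) hc))
    have h4 : Real.sin (b - φ - 2 * Real.pi) = Real.sin (b - φ) := Real.sin_sub_two_pi _
    have := hneg (b - φ - 2 * Real.pi) (by linarith) (by linarith)
    linarith
  · refine ⟨h, ?_⟩
    have h3 : φ - a ≤ Real.pi := by
      by_contra hc
      push Not at hc
      have h4 : Real.sin (φ - a - 2 * Real.pi) = Real.sin (φ - a) := Real.sin_sub_two_pi _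
      have := Real.sin_neg_of_neg_of_neg_pi_lt (x := φ - a - 2 * Real.pi) (by linarith)
        (by linarith)
      linarith
    by_contra hc
    push Not at hc
    have := hneg (b - φ) (by linarith) (by linarith)
    linarith

/-- The triangle `{0, a, b}` in barycentric coordinates, which are quotients of determinants. -/
theorem mem_simplex_iff {a b : LatticeVec} (h : 0 < LatticeVec.det2 a b) {x : Plane} :
    x ∈ simplex a b ↔ 0 ≤ detR a.toPlane x ∧ 0 ≤ detR x b.toPlane ∧
      detR a.toPlane x + detR x b.toPlane ≤ detR a.toPlane b.toPlane := by
  have hd : 0 < detR a.toPlane b.toPlane := by rw [detR_toPlane]; exact_mod_cast h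
  generalize hA : a.toPlane = A at *
  generalize hB : b.toPlane = B at *
  rw [simplex, hA, hB]
  constructor
  · intro hx
    refine convexHull_min (t := {x | 0 ≤ detR A x ∧ 0 ≤ detR x B ∧
      detR A x + detR x B ≤ detR A B}) ?_ ?_ hx
    · rintro y (rfl | rfl | rfl)
      · simpa [detR] using hd.le
      · refine ⟨le_of_eq ?_, hd.le, le_of_eq ?_⟩ <;> simp [detR] <;> ring
      · refine ⟨hd.le, le_of_eq ?_, le_of_eq ?_⟩ <;> simp [detR] <;> ring
    · rintro y ⟨hy1, hy2, hy3⟩ z ⟨hz1, hz2, hz3⟩ s t hs ht hst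
      have e1 : detR A (s • y + t • z) = s * detR A y + t * detR A z := by simp [detR]; ring
      have e2 : detR (s • y + t • z) B = s * detR y B + t * detR z B := by simp [detR]; ring
      refine ⟨?_, ?_, ?_⟩
      · rw [e1]; positivity
      · rw [e2]; positivity
      · rw [e1, e2]
        have : t = 1 - s := by linarith
        nlinarith [mul_le_mul_of_nonneg_left hy3 hs, mul_le_mul_of_nonneg_left hz3 ht]
  · rintro ⟨h1, h2, h3⟩
    have hc := convex_convexHull ℝ ({0, A, B} : Set Plane)
    have m0 : (0 : Plane) ∈ convexHull ℝ ({0, A, B} : Set Plane) :=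
      subset_convexHull _ _ (by simp)
    have mA : A ∈ convexHull ℝ ({0, A, B} : Set Plane) := subset_convexHull _ _ (by simp)
    have mB : B ∈ convexHull ℝ ({0, A, B} : Set Plane) := subset_convexHull _ _ (by simp)
    set D := detR A B with hD
    have e : x = (detR x B / D) • A + (detR A x / D) • B := by
      ext k; fin_cases k <;> simp [detR] at * <;> field_simp <;> rw [hD] <;> ring
    rcases eq_or_lt_of_le (add_nonneg h1 h2) with h0 | h0
    · have h1' : detR A x = 0 := by linarith
      have h2' : detR x B = 0 := by linarith
      rw [e, h1', h2']; simpa using m0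
    · set S := detR A x + detR x B with hS
      have hy : (detR x B / S) • A + (detR A x / S) • B ∈
          convexHull ℝ ({0, A, B} : Set Plane) :=
        hc mA mB (by positivity) (by positivity) (by field_simp; linarith)
      have := hc m0 hy (a := 1 - S / D) (b := S / D)
        (by rw [sub_nonneg, div_le_one hd]; exact h3) (by positivity) (by ring)
      rw [smul_zero, zero_add, smul_add, smul_smul, smul_smul] at this
      rw [e]
      convert this using 3 <;> field_simp

/-- A lattice triangle `{0, a, b}` without interior lattice points, with `a` and `b` primitive,
has lattice height `1` over the edge `[a, b]`. -/
theorem det2_eq_gcd_of_no_interior {a b : LatticeVec} (ha : a.IsPrimitive) (hb : b.IsPrimitive)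
    (hd : 0 < LatticeVec.det2 a b) (hno : ∀ w : LatticeVec, w.toPlane ∉ interior (simplex a b)) :
    LatticeVec.det2 a b = (b - a).len := by
  unfold LatticeVec.len
  set d := LatticeVec.det2 a b with hdd
  -- the gcd divides the determinant, so it suffices to show the converse divisibility
  have hgd : (Int.gcd ((b - a) 0) ((b - a) 1) : ℤ) ∣ d := by
    have h0 : (Int.gcd ((b - a) 0) ((b - a) 1) : ℤ) ∣ b 0 - a 0 := Int.gcd_dvd_left ..
    have h1 : (Int.gcd ((b - a) 0) ((b - a) 1) : ℤ) ∣ b 1 - a 1 := Int.gcd_dvd_right ..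
    have : d = a 0 * (b 1 - a 1) - a 1 * (b 0 - a 0) := by rw [hdd, LatticeVec.det2]; ring
    rw [this]
    exact dvd_sub (h1.mul_left _) (h0.mul_left _)
  suffices hdg : d ∣ (Int.gcd ((b - a) 0) ((b - a) 1) : ℤ) from
    Int.dvd_antisymm hd.le (by positivity) hdg hgd
  rcases eq_or_lt_of_le (show 1 ≤ d from hd) with h1 | h1
  · rw [← h1]; exact one_dvd _
  -- a lattice point `w` at height `1` over the edge `[0, a]`, close to that edge
  have hbez := Int.gcd_eq_gcd_ab (a 0) (a 1)
  rw [show Int.gcd (a 0) (a 1) = 1 from ha] at hbez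
  set x := Int.gcdA (a 0) (a 1)
  set y := Int.gcdB (a 0) (a 1)
  push_cast at hbez
  set w₀ : LatticeVec := ![-y, x] with hw₀
  set n := LatticeVec.det2 w₀ b / d with hn
  set w : LatticeVec := w₀ - n • a with hw
  have hdw : LatticeVec.det2 a w = 1 := by
    simp [LatticeVec.det2, hw, hw₀, Matrix.vecHead, Matrix.vecTail]; linarith
  set j := LatticeVec.det2 w b with hj
  have hjmod : j = LatticeVec.det2 w₀ b % d := by
    have : j = LatticeVec.det2 w₀ b - n * d := by
      rw [hj, hw, hdd]; simp [LatticeVec.det2]; ring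
    rw [this, hn, Int.emod_def]; ring
  have hj0 : 0 ≤ j := by rw [hjmod]; exact Int.emod_nonneg _ (by omega)
  have hjd : j < d := by rw [hjmod]; exact Int.emod_lt_of_pos _ hd
  have hcomb : ∀ k, d * w k = j * a k + b k := by
    intro k
    have := hdw
    rw [hj, hdd]
    simp only [LatticeVec.det2] at *
    fin_cases k <;> simp only [Fin.zero_eta, Fin.mk_one]
    · linear_combination b 0 * this
    · linear_combination b 1 * this
  have hjne : j ≠ 0 := by
    intro h0
    have h : ∀ k, d ∣ b k := fun k => ⟨w k, by have := hcomb k; rw [h0] at this; linarith⟩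
    have h3 := Int.dvd_coe_gcd (h 0) (h 1)
    rw [show Int.gcd (b 0) (b 1) = 1 from hb] at h3
    have := Int.le_of_dvd one_pos h3
    omega
  have hjlast : j = d - 1 := by
    by_contra hne
    refine hno w (mem_interior.2 ⟨{x : Plane | 0 < detR a.toPlane x ∧ 0 < detR x b.toPlane ∧
      detR a.toPlane x + detR x b.toPlane < detR a.toPlane b.toPlane}, ?_, ?_, ?_⟩)
    · rintro z ⟨h1, h2, h3⟩
      exact (mem_simplex_iff hd).2 ⟨h1.le, h2.le, h3.le⟩
    · have c1 : Continuous fun x : Plane => detR a.toPlane x := by unfold detR; fun_prop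
      have c2 : Continuous fun x : Plane => detR x b.toPlane := by unfold detR; fun_prop
      exact (isOpen_lt continuous_const c1).inter ((isOpen_lt continuous_const c2).inter
        (isOpen_lt (c1.add c2) continuous_const))
    · refine ⟨?_, ?_, ?_⟩
      · rw [detR_toPlane, hdw]; norm_num
      · rw [detR_toPlane]; exact_mod_cast (by omega : 0 < j)
      · rw [detR_toPlane, detR_toPlane, detR_toPlane, hdw, ← hdd, ← hj]
        exact_mod_cast (by omega : 1 + j < d)
  refine Int.dvd_coe_gcd ⟨w 0 - a 0, ?_⟩ ⟨w 1 - a 1, ?_⟩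
  · have := hcomb 0; rw [hjlast] at this; simp only [Pi.sub_apply]; linarith
  · have := hcomb 1; rw [hjlast] at this; simp only [Pi.sub_apply]; linarith

theorem LatticeVec.len_smul_primDir (w : LatticeVec) : w.len • w.primDir = w := by
  ext k
  have h : w.len ∣ w k := by
    fin_cases k
    · exact Int.gcd_dvd_left ..
    · exact Int.gcd_dvd_right ..
  simpa [LatticeVec.primDir] using Int.mul_ediv_cancel' h

theorem edge_eq {m : ℕ} (v : ZMod m → LatticeVec) (i : ZMod m) :
    v (i + 1) = v i + edgeLength v i • edgeDir v i := by
  rw [edgeLength, edgeDir, LatticeVec.len_smul_primDir, add_sub_cancel]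

namespace IsPolygonData

variable {m : ℕ} [NeZero m] {v : ZMod m → LatticeVec}

/-- The arguments of the corners, with the argument of the first corner repeated one turn later:
consecutive arguments differ by less than `π`. -/
theorem exists_angles (hv : IsPolygonData v) : ∃ θ : ℕ → ℝ, (∀ k < m, θ k < θ (k + 1)) ∧
    (∀ k < m, θ (k + 1) < θ k + Real.pi) ∧ θ m = θ 0 + 2 * Real.pi ∧
    ∀ k ≤ m, ∃ ρ : ℝ, 0 < ρ ∧
      (v (k : ZMod m)).toPlane = ρ • ![Real.cos (θ k), Real.sin (θ k)] := by
  obtain ⟨θ', hmono, hturn, hdir⟩ := hv.counterclockwise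
  have hm : 0 < m := NeZero.pos m
  set θ : ℕ → ℝ := fun k => if k < m then θ' k else θ' 0 + 2 * Real.pi with hθ
  have hlt : ∀ k < m, θ k = θ' k := fun k hk => if_pos hk
  have hθm : θ m = θ' 0 + 2 * Real.pi := if_neg (lt_irrefl m)
  have h0 : θ 0 = θ' 0 := hlt 0 hm
  have hdir' : ∀ k ≤ m, ∃ ρ : ℝ, 0 < ρ ∧
      (v (k : ZMod m)).toPlane = ρ • ![Real.cos (θ k), Real.sin (θ k)] := by
    intro k hk
    rcases hk.lt_or_eq with h | rfl
    · rw [hlt k h]; exact hdir k h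
    · obtain ⟨ρ, hρ, h⟩ := hdir 0 hm
      refine ⟨ρ, hρ, ?_⟩
      rw [hθm, Real.cos_add_two_pi, Real.sin_add_two_pi, ← h]
      simp
  have hinc : ∀ k < m, θ k < θ (k + 1) := by
    intro k hk
    rw [hlt k hk]
    rcases Nat.lt_or_ge (k + 1) m with h | h
    · rw [hlt _ h]; exact hmono k (k + 1) (Nat.lt_succ_self k) h
    · rw [show k + 1 = m by omega, hθm]; exact hturn k hk
  refine ⟨θ, hinc, fun k hk => ?_, by rw [hθm, h0], hdir'⟩
  -- a gap of at least `π` would confine all corners to a half plane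
  by_contra hgap
  push Not at hgap
  set e : Plane := ![Real.cos (θ (k + 1)), Real.sin (θ (k + 1))] with he
  have hle : θ (k + 1) ≤ θ 0 + 2 * Real.pi := by
    rw [h0]
    rcases Nat.lt_or_ge (k + 1) m with h | h
    · rw [hlt _ h]; exact (hturn _ h).le
    · rw [show k + 1 = m by omega, hθm]
  have hmono' : ∀ i j : ℕ, i ≤ j → j < m → θ' i ≤ θ' j := by
    intro i j hij hj
    rcases hij.lt_or_eq with h | rfl
    · exact (hmono i j h hj).le
    · exact le_rfl
  have hpos : ∀ i, 0 ≤ detR e (v i).toPlane := by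
    intro i
    obtain ⟨ρ, hρ, h⟩ := hdir i.val (ZMod.val_lt i)
    rw [ZMod.natCast_zmod_val] at h
    have hs : 0 ≤ Real.sin (θ' i.val - θ (k + 1)) := by
      have hi := ZMod.val_lt i
      have h1 := hmono' 0 i.val (Nat.zero_le _) hi
      have h2 := hturn _ hi
      rw [hlt k hk] at hgap
      rcases Nat.lt_or_ge k i.val with hki | hki
      · have h3 := hmono' (k + 1) i.val hki hi
        rw [← hlt (k + 1) (by omega)] at h3
        have h4 := hmono' 0 k (Nat.zero_le _) hk
        exact Real.sin_nonneg_of_nonneg_of_le_pi (by linarith) (by linarith)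
      · have h3 := hmono' i.val k hki hk
        rw [← Real.sin_add_two_pi]
        exact Real.sin_nonneg_of_nonneg_of_le_pi (by linarith) (by linarith)
    rw [he, h, ← one_smul ℝ (![Real.cos (θ (k + 1)), Real.sin (θ (k + 1))] : Plane), detR_polar]
    positivity
  have hall : ∀ x : Plane, 0 ≤ detR e x := by
    intro x
    have hx : x ∈ Submodule.span ℝ≥0 (Set.range fun i => (v i).toPlane) := by
      rw [hv.spanning]; trivial
    induction hx using Submodule.span_induction with
    | mem x h => obtain ⟨i, rfl⟩ := h; exact hpos i
    | zero => simp [detR]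
    | add x y _ _ hx hy =>
      have : detR e (x + y) = detR e x + detR e y := by simp [detR]; ring
      rw [this]; exact add_nonneg hx hy
    | smul a x _ hx =>
      have : detR e (a • x) = a * detR e x := by
        simp [detR, NNReal.smul_def]; ring
      rw [this]; exact mul_nonneg a.2 hx
  have h1 := hall ![Real.sin (θ (k + 1)), -Real.cos (θ (k + 1))]
  have h2 := Real.sin_sq_add_cos_sq (θ (k + 1))
  simp [detR, he] at h1
  nlinarith

theorem det_pos (hv : IsPolygonData v) (i : ZMod m) :
    0 < LatticeVec.det2 (v i) (v (i + 1)) := by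
  obtain ⟨θ, hinc, hgap, -, hdir⟩ := hv.exists_angles
  have hi := ZMod.val_lt i
  obtain ⟨ρ, hρ, h⟩ := hdir i.val hi.le
  obtain ⟨σ, hσ, h'⟩ := hdir (i.val + 1) hi
  rw [Nat.cast_add, Nat.cast_one, ZMod.natCast_zmod_val] at h'
  rw [ZMod.natCast_zmod_val] at h
  have : (0 : ℝ) < detR (v i).toPlane (v (i + 1)).toPlane := by
    rw [h, h', detR_polar]
    have := Real.sin_pos_of_pos_of_lt_pi (x := θ (i.val + 1) - θ i.val)
      (by linarith [hinc _ hi]) (by linarith [hgap _ hi])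
    positivity
  rw [detR_toPlane] at this
  exact_mod_cast this

theorem three_le (hv : IsPolygonData v) : 3 ≤ m := by
  obtain ⟨θ, hinc, hgap, hturn, -⟩ := hv.exists_angles
  have := NeZero.pos m
  have hpi := Real.pi_pos
  by_contra h
  have : m = 1 ∨ m = 2 := by omega
  rcases this with rfl | rfl
  · have := hgap 0 (by norm_num)
    norm_num at *; linarith
  · have h1 := hgap 0 (by norm_num)
    have h2 := hgap 1 (by norm_num)
    norm_num at *; linarith

theorem sector (hv : IsPolygonData v) (x : Plane) (hx : x ≠ 0) :
    ∃! i, 0 ≤ detR (v i).toPlane x ∧ 0 < detR x (v (i + 1)).toPlane := by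
  obtain ⟨θ, hinc, hgap, hturn, hdir⟩ := hv.exists_angles
  obtain ⟨ρ, φ₀, hρ, hx⟩ := exists_polar hx
  have hpi := Real.pi_pos
  obtain ⟨n, ⟨hn0, hn1⟩, -⟩ := existsUnique_add_zsmul_mem_Ico (Real.two_pi_pos) φ₀ (θ 0)
  set φ := φ₀ + n • (2 * Real.pi) with hφ
  have hxφ : x = ρ • ![Real.cos φ, Real.sin φ] := by
    rw [hx, hφ, zsmul_eq_mul, Real.cos_add_int_mul_two_pi, Real.sin_add_int_mul_two_pi]
  have hmono : ∀ j k : ℕ, j ≤ k → k ≤ m → θ j ≤ θ k := by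
    intro j k hjk
    induction k, hjk using Nat.le_induction with
    | base => exact fun _ => le_rfl
    | succ k _ ih => exact fun hk => (ih (by omega)).trans (hinc k hk).le
  have key : ∀ k < m, (0 ≤ detR (v (k : ZMod m)).toPlane x ∧
      0 < detR x (v ((k : ZMod m) + 1)).toPlane) ↔ θ k ≤ φ ∧ φ < θ (k + 1) := by
    intro k hk
    obtain ⟨a, ha, h⟩ := hdir k hk.le
    obtain ⟨b, hb, h'⟩ := hdir (k + 1) hk
    rw [Nat.cast_add, Nat.cast_one] at h'
    rw [h, h', hxφ, detR_polar, detR_polar, mul_nonneg_iff_of_pos_left (by positivity),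
      mul_pos_iff_of_pos_left (by positivity)]
    constructor
    · rintro ⟨h1, h2⟩
      exact mem_Ico_of_sin (hmono 0 k (Nat.zero_le _) hk.le)
        (by rw [← hturn]; exact hmono _ _ hk le_rfl) (hinc k hk) hn0 hn1 h1 h2
    · rintro ⟨h1, h2⟩
      have := hgap k hk
      exact ⟨Real.sin_nonneg_of_nonneg_of_le_pi (by linarith) (by linarith),
        Real.sin_pos_of_pos_of_lt_pi (by linarith) (by linarith)⟩
  obtain ⟨k, hk, hk1, hk2⟩ := exists_between_of_le_of_lt θ m φ hn0 (by rw [hturn]; exact hn1)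
  refine ⟨(k : ZMod m), (key k hk).2 ⟨hk1, hk2⟩, fun i hi => ?_⟩
  have hi' := ZMod.val_lt i
  have := key i.val hi'
  rw [ZMod.natCast_zmod_val] at this
  obtain ⟨h1, h2⟩ := this.1 hi
  have : i.val = k := by
    rcases lt_trichotomy i.val k with h | h | h
    · have := hmono (i.val + 1) k h hk.le; linarith
    · exact h
    · have := hmono (k + 1) i.val h hi'.le; linarith
  rw [← this, ZMod.natCast_zmod_val]

theorem edgeLength_pos (hv : IsPolygonData v) (i : ZMod m) : 0 < edgeLength v i := by
  rw [edgeLength, ← det2_eq_gcd_of_no_interior (hv.primitive i) (hv.primitive _) (hv.det_pos i)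
    (hv.no_interior i)]
  exact hv.det_pos i

theorem det2_edgeDir (hv : IsPolygonData v) (i : ZMod m) :
    LatticeVec.det2 (v i) (edgeDir v i) = 1 := by
  have h1 := det2_eq_gcd_of_no_interior (hv.primitive i) (hv.primitive _) (hv.det_pos i)
    (hv.no_interior i)
  rw [← edgeLength] at h1
  have h2 := hv.edgeLength_pos i
  have h3 : LatticeVec.det2 (v i) (v (i + 1)) =
      edgeLength v i * LatticeVec.det2 (v i) (edgeDir v i) := by
    conv_lhs => rw [edge_eq v i]
    simp [LatticeVec.det2]; ring
  rw [h1] at h3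
  exact (mul_eq_left₀ h2.ne').1 h3.symm

/-- The fan of a reflexive polygon. -/
noncomputable def fan (hv : IsPolygonData v) : ReflexiveFan m where
  v := v
  u := edgeDir v
  -- the lengths are positive, so that `toNat` does not truncate
  l := fun i => (edgeLength v i).toNat
  c := cornerOrder v
  three_le := hv.three_le
  l_pos := fun i => by have := hv.edgeLength_pos i; omega
  det_eq := hv.det2_edgeDir
  v_succ := fun i => by
    conv_lhs => rw [edge_eq v i]
    rw [← natCast_zsmul, Int.toNat_of_nonneg (hv.edgeLength_pos i).le]
  u_eq := fun i => by
    have h1 := hv.det2_edgeDir i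
    have h2 := hv.det2_edgeDir (i + 1)
    have h3 : LatticeVec.det2 (v (i + 1)) (edgeDir v i) = 1 := by
      rw [edge_eq v i]; simp [LatticeVec.det2] at *; linarith
    rw [cornerOrder, add_sub_cancel_right]
    generalize edgeDir v i = p, edgeDir v (i + 1) = q, v (i + 1) = w at *
    simp only [LatticeVec.det2] at *
    ext k
    fin_cases k <;> simp
    · linear_combination -p 0 * h2 + q 0 * h3
    · linear_combination -p 1 * h2 + q 1 * h3
  sector := hv.sector

end IsPolygonData

/-! ### The gauge of the polygon and piecewise linear coordinates -/

namespace ReflexiveFan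

variable {m : ℕ} [NeZero m] (F : ReflexiveFan m)

/-- The point with coordinates `(a, b)` in the lattice basis `(v i, u i)`. -/
def point (i : ZMod m) (a b : ℝ) : Plane := a • (F.v i).toPlane + b • (F.u i).toPlane

/-- The first coordinate in the lattice basis `(v i, u i)`. -/
def alpha (i : ZMod m) (x : Plane) : ℝ := detR x (F.u i).toPlane

/-- The second coordinate in the lattice basis `(v i, u i)`. -/
def beta (i : ZMod m) (x : Plane) : ℝ := detR (F.v i).toPlane x

theorem det_real (i : ZMod m) :
    (F.v i 0 : ℝ) * F.u i 1 - F.v i 1 * F.u i 0 = 1 := by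
  exact_mod_cast F.det_eq i

theorem alpha_point (i : ZMod m) (a b : ℝ) : F.alpha i (F.point i a b) = a := by
  simp only [alpha, point, detR, LatticeVec.toPlane, Pi.add_apply, Pi.smul_apply, smul_eq_mul]
  linear_combination a * F.det_real i

theorem beta_point (i : ZMod m) (a b : ℝ) : F.beta i (F.point i a b) = b := by
  simp only [beta, point, detR, LatticeVec.toPlane, Pi.add_apply, Pi.smul_apply, smul_eq_mul]
  linear_combination b * F.det_real i

theorem point_alpha_beta (i : ZMod m) (x : Plane) : F.point i (F.alpha i x) (F.beta i x) = x := by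
  ext k
  fin_cases k <;> simp only [alpha, beta, point, detR, LatticeVec.toPlane, Pi.add_apply,
    Pi.smul_apply, smul_eq_mul, Fin.zero_eta, Fin.mk_one]
  · linear_combination x 0 * F.det_real i
  · linear_combination x 1 * F.det_real i

theorem ext_alpha_beta (i : ZMod m) {x y : Plane} (h : F.alpha i x = F.alpha i y)
    (h' : F.beta i x = F.beta i y) : x = y := by
  rw [← F.point_alpha_beta i x, h, h', F.point_alpha_beta]

theorem beta_succ (i : ZMod m) (x : Plane) :
    F.beta (i + 1) x = F.beta i x - F.l i * F.alpha i x := by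
  rw [beta, F.v_succ]; simp [alpha, beta, detR, LatticeVec.toPlane]; ring

theorem alpha_succ (i : ZMod m) (x : Plane) :
    F.alpha (i + 1) x = F.alpha i x + F.c (i + 1) * F.beta (i + 1) x := by
  rw [alpha, alpha, F.u_eq i]; simp [beta, detR, LatticeVec.toPlane]; ring

theorem alpha_pred (i : ZMod m) (x : Plane) :
    F.alpha (i - 1) x = F.alpha i x - F.c i * F.beta i x := by
  have := F.alpha_succ (i - 1) x
  rw [sub_add_cancel] at this
  linarith

theorem beta_pred (i : ZMod m) (x : Plane) :
    F.beta (i - 1) x = F.beta i x + F.l (i - 1) * F.alpha (i - 1) x := by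
  have := F.beta_succ (i - 1) x
  rw [sub_add_cancel] at this
  linarith

theorem continuous_alpha (i : ZMod m) : Continuous (F.alpha i) := by
  unfold alpha detR; fun_prop

theorem continuous_beta (i : ZMod m) : Continuous (F.beta i) := by
  unfold beta detR; fun_prop

theorem alpha_smul (i : ZMod m) (t : ℝ) (x : Plane) : F.alpha i (t • x) = t * F.alpha i x := by
  simp [alpha, detR]; ring

theorem beta_smul (i : ZMod m) (t : ℝ) (x : Plane) : F.beta i (t • x) = t * F.beta i x := by
  simp [beta, detR]; ring

theorem alpha_zero (i : ZMod m) : F.alpha i 0 = 0 := by simp [alpha, detR]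

theorem beta_zero (i : ZMod m) : F.beta i 0 = 0 := by simp [beta, detR]

theorem l_real_pos (i : ZMod m) : (0 : ℝ) < F.l i := by exact_mod_cast F.l_pos i

theorem one_le_l (i : ZMod m) : (1 : ℝ) ≤ F.l i := by exact_mod_cast F.l_pos i

/-- The closed cone spanned by `v i` and `v (i + 1)`. -/
def cone (i : ZMod m) : Set Plane := {x | 0 ≤ F.beta i x ∧ F.beta (i + 1) x ≤ 0}

theorem isClosed_cone (i : ZMod m) : IsClosed (F.cone i) :=
  (isClosed_le continuous_const (F.continuous_beta i)).inter
    (isClosed_le (F.continuous_beta _) continuous_const)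

theorem zero_mem_cone (i : ZMod m) : 0 ∈ F.cone i := by
  constructor <;> rw [beta_zero]

theorem existsUnique_sector {x : Plane} (hx : x ≠ 0) :
    ∃! i, 0 ≤ F.beta i x ∧ F.beta (i + 1) x < 0 := by
  refine (existsUnique_congr fun i => and_congr Iff.rfl ?_).1 (F.sector x hx)
  rw [beta, detR, detR]
  constructor <;> intro h <;> linarith

theorem exists_mem_cone (x : Plane) : ∃ i, x ∈ F.cone i := by
  by_cases hx : x = 0
  · exact ⟨0, hx ▸ F.zero_mem_cone 0⟩
  · obtain ⟨i, ⟨h1, h2⟩, -⟩ := F.existsUnique_sector hx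
    exact ⟨i, h1, h2.le⟩

variable {F}

theorem alpha_pos_of_mem_cone {i : ZMod m} {x : Plane} (h : x ∈ F.cone i) (hx : x ≠ 0) :
    0 < F.alpha i x := by
  have h1 := F.beta_succ i x
  have hl := F.l_real_pos i
  by_contra hc
  push Not at hc
  have h2 : F.l i * F.alpha i x ≤ 0 := mul_nonpos_of_nonneg_of_nonpos hl.le hc
  have h3 : F.beta i x = 0 := by linarith [h.1, h.2]
  have h4 : F.l i * F.alpha i x = 0 := by linarith [h.1, h.2]
  have h5 : F.alpha i x = 0 := (mul_eq_zero.1 h4).resolve_left hl.ne'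
  exact hx (F.ext_alpha_beta i (by rw [h5, alpha_zero]) (by rw [h3, beta_zero]))

/-- A nonzero point of a closed cone lies in the half open cone, or on its far boundary ray and
then in the next half open cone. -/
theorem mem_cone_cases {i : ZMod m} {x : Plane} (h : x ∈ F.cone i) (hx : x ≠ 0) :
    (0 ≤ F.beta i x ∧ F.beta (i + 1) x < 0) ∨
      (F.beta (i + 1) x = 0 ∧ 0 ≤ F.beta (i + 1) x ∧ F.beta (i + 1 + 1) x < 0) := by
  rcases h.2.lt_or_eq with h2 | h2
  · exact Or.inl ⟨h.1, h2⟩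
  · refine Or.inr ⟨h2, h2.ge, ?_⟩
    have := alpha_pos_of_mem_cone h hx
    rw [F.beta_succ (i + 1), F.alpha_succ i, h2]
    have := mul_pos (F.l_real_pos (i + 1)) this
    linarith

theorem eq_of_mem_sector {x : Plane} (hx : x ≠ 0) {i j : ZMod m}
    (hi : 0 ≤ F.beta i x ∧ F.beta (i + 1) x < 0) (hj : 0 ≤ F.beta j x ∧ F.beta (j + 1) x < 0) :
    i = j := (F.existsUnique_sector hx).unique hi hj

/-- Distinct cones meet only in a common ray. -/
theorem mem_cone_inter {i j : ZMod m} {x : Plane} (hx : x ≠ 0) (hi : x ∈ F.cone i)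
    (hj : x ∈ F.cone j) :
    i = j ∨ (j = i + 1 ∧ F.beta j x = 0) ∨ (i = j + 1 ∧ F.beta i x = 0) := by
  rcases mem_cone_cases hi hx with h | ⟨h0, h⟩ <;> rcases mem_cone_cases hj hx with h' | ⟨h0', h'⟩
  · exact Or.inl (eq_of_mem_sector hx h h')
  · have := eq_of_mem_sector hx h h'
    exact Or.inr (Or.inr ⟨this, by rw [this, h0']⟩)
  · have := eq_of_mem_sector hx h' h
    exact Or.inr (Or.inl ⟨this, by rw [this, h0]⟩)
  · exact Or.inl (add_right_cancel (eq_of_mem_sector hx h h'))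

variable (F)

/-- The gauge of the polygon: the function that is linear on the cones and equal to `1` on the
edges. -/
noncomputable def gauge (x : Plane) : ℝ := F.alpha (F.exists_mem_cone x).choose x

variable {F}

theorem gauge_eq {i : ZMod m} {x : Plane} (h : x ∈ F.cone i) : F.gauge x = F.alpha i x := by
  rw [gauge]
  have h' := (F.exists_mem_cone x).choose_spec
  generalize (F.exists_mem_cone x).choose = j at *
  by_cases hx : x = 0
  · rw [hx, alpha_zero, alpha_zero]
  rcases mem_cone_inter hx h h' with rfl | ⟨rfl, h0⟩ | ⟨rfl, h0⟩
  · rfl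
  · rw [F.alpha_succ, h0]; ring
  · rw [F.alpha_succ, h0]; ring

theorem gauge_eq_pred {i : ZMod m} {x : Plane} (h : x ∈ F.cone (i - 1)) :
    F.gauge x = F.alpha i x - F.c i * F.beta i x := by
  rw [gauge_eq h, alpha_pred]

variable (F)

theorem continuous_gauge : Continuous F.gauge := by
  refine (locallyFinite_of_finite F.cone).continuous ?_ F.isClosed_cone fun i => ?_
  · exact eq_univ_of_forall fun x => mem_iUnion.2 (F.exists_mem_cone x)
  · exact (F.continuous_alpha i).continuousOn.congr fun x hx => gauge_eq hx

theorem gauge_zero : F.gauge 0 = 0 := F.alpha_zero _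

theorem gauge_pos {x : Plane} (hx : x ≠ 0) : 0 < F.gauge x := by
  obtain ⟨i, hi⟩ := F.exists_mem_cone x
  rw [gauge_eq hi]
  exact alpha_pos_of_mem_cone hi hx

theorem gauge_nonneg (x : Plane) : 0 ≤ F.gauge x := by
  by_cases hx : x = 0
  · rw [hx, gauge_zero]
  · exact (F.gauge_pos hx).le

theorem ne_zero_of_gauge_pos {x : Plane} (h : 0 < F.gauge x) : x ≠ 0 := by
  rintro rfl; rw [gauge_zero] at h; exact lt_irrefl _ h

theorem smul_mem_cone {i : ZMod m} {x : Plane} (h : x ∈ F.cone i) {t : ℝ} (ht : 0 ≤ t) :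
    t • x ∈ F.cone i := by
  constructor
  · rw [beta_smul]; exact mul_nonneg ht h.1
  · rw [beta_smul]; exact mul_nonpos_of_nonneg_of_nonpos ht h.2

theorem gauge_smul (x : Plane) {t : ℝ} (ht : 0 ≤ t) : F.gauge (t • x) = t * F.gauge x := by
  obtain ⟨i, hi⟩ := F.exists_mem_cone x
  rw [gauge_eq hi, gauge_eq (F.smul_mem_cone hi ht), alpha_smul]

theorem point_mem_cone {i : ZMod m} {a b : ℝ} (hb : 0 ≤ b) (hab : b ≤ F.l i * a) :
    F.point i a b ∈ F.cone i := by
  constructor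
  · rwa [beta_point]
  · rw [beta_succ, beta_point, alpha_point]; linarith

theorem gauge_point {i : ZMod m} {a b : ℝ} (hb : 0 ≤ b) (hab : b ≤ F.l i * a) :
    F.gauge (F.point i a b) = a := by
  rw [gauge_eq (F.point_mem_cone hb hab), alpha_point]

theorem beta_le_of_mem_cone {i : ZMod m} {x : Plane} (h : x ∈ F.cone i) :
    F.beta i x ≤ F.l i * F.gauge x := by
  have := F.beta_succ i x
  rw [gauge_eq h]
  linarith [h.2]

/-! ### The index set -/

theorem index_one_ne_zero (F : ReflexiveFan m) : (1 : ZMod m) ≠ 0 := by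
  have := F.three_le
  have : Fact (1 < m) := ⟨by omega⟩
  exact one_ne_zero

theorem index_two_ne_zero (F : ReflexiveFan m) : (1 + 1 : ZMod m) ≠ 0 := by
  have := F.three_le
  intro h
  have h2 : ((2 : ℕ) : ZMod m) = 0 := by push_cast; rw [← h]; norm_num
  rw [ZMod.natCast_eq_zero_iff] at h2
  have := Nat.le_of_dvd (by norm_num) h2
  omega

theorem add_one_ne (F : ReflexiveFan m) (i : ZMod m) : i + 1 ≠ i := fun h =>
  F.index_one_ne_zero (by simpa using h)

theorem add_one_ne_sub_one (F : ReflexiveFan m) (i : ZMod m) : i + 1 ≠ i - 1 := fun h =>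
  F.index_two_ne_zero (by linear_combination h)

theorem sub_one_ne (F : ReflexiveFan m) (i : ZMod m) : i - 1 ≠ i := fun h =>
  F.index_one_ne_zero (by simpa using h)

/-! ### Stars of rays -/

/-- The open star of the ray through `v i`: the interior of the union of the two adjacent
cones. -/
def star (i : ZMod m) : Set Plane := {x | ∀ j, x ∈ F.cone j → j = i - 1 ∨ j = i}

theorem isOpen_star (i : ZMod m) : IsOpen (F.star i) := by
  have : F.star i = (⋃ j : {j : ZMod m // ¬ (j = i - 1 ∨ j = i)}, F.cone j)ᶜ := by
    ext x
    simp only [star, mem_compl_iff, mem_iUnion, not_exists, Subtype.forall]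
    exact forall_congr' fun j => by tauto
  rw [this]
  exact (isClosed_iUnion_of_finite fun j => F.isClosed_cone _).isOpen_compl

variable {F}

theorem ne_zero_of_mem_star {i : ZMod m} {x : Plane} (h : x ∈ F.star i) : x ≠ 0 := by
  rintro rfl
  rcases h _ (F.zero_mem_cone (i + 1)) with h | h
  · exact F.add_one_ne_sub_one i h
  · exact F.add_one_ne i h

theorem star_right {i : ZMod m} {x : Plane} (h : x ∈ F.star i) (hb : 0 ≤ F.beta i x) :
    x ∈ F.cone i ∧ F.beta (i + 1) x < 0 := by
  have hx := ne_zero_of_mem_star h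
  obtain ⟨j, hj⟩ := F.exists_mem_cone x
  have hc : x ∈ F.cone i := by
    rcases h j hj with rfl | rfl
    · rcases mem_cone_cases hj hx with h' | ⟨-, h'⟩
      · rw [sub_add_cancel] at h'; linarith [h'.2]
      · rw [sub_add_cancel] at h'; exact ⟨h'.1, h'.2.le⟩
    · exact hj
  refine ⟨hc, lt_of_le_of_ne hc.2 fun h0 => ?_⟩
  rcases mem_cone_cases hc hx with h' | ⟨-, h'⟩
  · exact h'.2.ne h0
  · rcases h _ ⟨h'.1, h'.2.le⟩ with h | h
    · exact F.add_one_ne_sub_one i h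
    · exact F.add_one_ne i h

theorem star_left {i : ZMod m} {x : Plane} (h : x ∈ F.star i) (hb : F.beta i x ≤ 0) :
    x ∈ F.cone (i - 1) ∧ 0 < F.beta (i - 1) x := by
  have hx := ne_zero_of_mem_star h
  have back : ∀ j, x ∈ F.cone j → F.beta j x = 0 → x ∈ F.cone (j - 1) ∧ 0 < F.beta (j - 1) x := by
    intro j hj h0
    have h1 := alpha_pos_of_mem_cone hj hx
    have h2 : 0 < F.beta (j - 1) x := by
      rw [beta_pred, alpha_pred, h0]
      have := mul_pos (F.l_real_pos (j - 1)) h1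
      linarith
    exact ⟨⟨h2.le, by rw [sub_add_cancel, h0]⟩, h2⟩
  obtain ⟨j, hj⟩ := F.exists_mem_cone x
  rcases h j hj with rfl | rfl
  · refine ⟨hj, lt_of_le_of_ne hj.1 fun h0 => ?_⟩
    rcases h _ (back _ hj h0.symm).1 with h | h
    · exact F.sub_one_ne _ h
    · exact F.add_one_ne_sub_one (i - 1) (by rw [h]; ring)
  · exact back _ hj (le_antisymm hb hj.1)

theorem mem_star_of_right {i : ZMod m} {x : Plane} (hb : 0 ≤ F.beta i x)
    (hb' : F.beta (i + 1) x < 0) : x ∈ F.star i := by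
  have hx : x ≠ 0 := by rintro rfl; rw [beta_zero] at hb'; exact lt_irrefl _ hb'
  intro j hj
  rcases mem_cone_cases hj hx with h | ⟨-, h⟩
  · exact Or.inr (eq_of_mem_sector hx h ⟨hb, hb'⟩)
  · exact Or.inl (eq_sub_of_add_eq (eq_of_mem_sector hx h ⟨hb, hb'⟩))

theorem mem_star_of_left {i : ZMod m} {x : Plane} (hb : F.beta i x ≤ 0)
    (hb' : 0 < F.beta (i - 1) x) : x ∈ F.star i := by
  have hx : x ≠ 0 := by rintro rfl; rw [beta_zero] at hb'; exact lt_irrefl _ hb'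
  have hc : x ∈ F.cone (i - 1) := ⟨hb'.le, by rwa [sub_add_cancel]⟩
  intro j hj
  rcases mem_cone_inter hx hj hc with h | ⟨h, h0⟩ | ⟨h, -⟩
  · exact Or.inl h
  · exact absurd h0 hb'.ne'
  · exact Or.inr (by rw [h, sub_add_cancel])

/-- Stars of distinct rays meet only if the rays are consecutive, in the open cone between them. -/
theorem mem_star_inter {i j : ZMod m} {x : Plane} (hi : x ∈ F.star i) (hj : x ∈ F.star j) :
    i = j ∨ (j = i + 1 ∧ 0 < F.beta i x ∧ F.beta (i + 1) x < 0) ∨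
      (i = j + 1 ∧ 0 < F.beta j x ∧ F.beta (j + 1) x < 0) := by
  have hx := ne_zero_of_mem_star hi
  by_cases hij : i = j
  · exact Or.inl hij
  have key : ∀ {i j : ZMod m}, i ≠ j → x ∈ F.star i → x ∈ F.star j → 0 ≤ F.beta i x →
      (j = i + 1 ∧ 0 < F.beta i x ∧ F.beta (i + 1) x < 0) := by
    intro i j hij hi hj hb
    have h1 := star_right hi hb
    have hji : j = i + 1 := by
      rcases hj _ h1.1 with h | h
      · rw [h, sub_add_cancel]
      · exact absurd h hij
    refine ⟨hji, lt_of_le_of_ne hb fun h0 => ?_, h1.2⟩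
    rcases hj _ (star_left hi h0.ge).1 with h | h
    · exact hij (sub_left_injective h)
    · rw [hji] at h; exact F.add_one_ne_sub_one i h.symm
  rcases le_or_gt 0 (F.beta i x) with hb | hb
  · exact Or.inr (Or.inl (key hij hi hj hb))
  · rcases le_or_gt 0 (F.beta j x) with hb' | hb'
    · exact Or.inr (Or.inr (key (Ne.symm hij) hj hi hb'))
    · exfalso
      have h1 := star_left hi hb.le
      rcases hj _ h1.1 with h | h
      · exact hij (sub_left_injective h)
      · rw [← h] at hb'; linarith [h1.2]

variable (F)

/-! ### Piecewise linear coordinates on stars -/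

/-- The affine length, measured from the ray through `v i`, along the level curves of the gauge.
Outside of the polygon the level curves are all given the length of the boundary of the
polygon. -/
noncomputable def tau (i : ZMod m) (x : Plane) : ℝ := F.beta i x / max (F.gauge x) 1

theorem continuous_tau (i : ZMod m) : Continuous (F.tau i) :=
  (F.continuous_beta i).div (F.continuous_gauge.max continuous_const) fun _ =>
    (lt_of_lt_of_le one_pos (le_max_right _ _)).ne'

theorem max_gauge_pos (x : Plane) : 0 < max (F.gauge x) 1 :=
  lt_of_lt_of_le one_pos (le_max_right _ _)

theorem max_mul_tau (i : ZMod m) (x : Plane) : max (F.gauge x) 1 * F.tau i x = F.beta i x :=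
  mul_div_cancel₀ _ (F.max_gauge_pos x).ne'

theorem tau_nonneg_iff {i : ZMod m} {x : Plane} : 0 ≤ F.tau i x ↔ 0 ≤ F.beta i x := by
  rw [← F.max_mul_tau, mul_nonneg_iff_of_pos_left (F.max_gauge_pos x)]

theorem tau_pos_iff {i : ZMod m} {x : Plane} : 0 < F.tau i x ↔ 0 < F.beta i x := by
  rw [← F.max_mul_tau, mul_pos_iff_of_pos_left (F.max_gauge_pos x)]

theorem tau_neg_iff {i : ZMod m} {x : Plane} : F.tau i x < 0 ↔ F.beta i x < 0 := by
  rw [← not_le, ← not_le, tau_nonneg_iff]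

theorem tau_nonpos_iff {i : ZMod m} {x : Plane} : F.tau i x ≤ 0 ↔ F.beta i x ≤ 0 := by
  rw [← not_lt, ← not_lt, tau_pos_iff]

theorem tau_eq_zero_iff {i : ZMod m} {x : Plane} : F.tau i x = 0 ↔ F.beta i x = 0 := by
  rw [le_antisymm_iff, le_antisymm_iff, tau_nonneg_iff, tau_nonpos_iff]

theorem tau_succ {i : ZMod m} {x : Plane} (h : x ∈ F.cone i) :
    F.tau (i + 1) x = F.tau i x - F.l i * min (F.gauge x) 1 := by
  have h1 : min (F.gauge x) 1 * max (F.gauge x) 1 = F.gauge x := by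
    rw [min_mul_max, mul_one]
  have h2 := F.max_gauge_pos x
  rw [tau, tau, beta_succ, ← gauge_eq h]
  rw [div_eq_iff h2.ne', sub_mul, div_mul_cancel₀ _ h2.ne', mul_assoc, h1]

/-- The point near the ray through `v i` with `tau i = X` and `gauge = Y`. -/
noncomputable def ofTauGauge (i : ZMod m) (X Y : ℝ) : Plane :=
  F.point i (Y + F.c i * (max Y 1 * min X 0)) (max Y 1 * X)

theorem ofTauGauge_right {i : ZMod m} {X Y : ℝ} (h : 0 ≤ X) :
    F.ofTauGauge i X Y = F.point i Y (max Y 1 * X) := by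
  rw [ofTauGauge, min_eq_right h]; simp

theorem tau_mem {i : ZMod m} {x : Plane} (h : x ∈ F.star i) :
    -(F.l (i - 1) * min (F.gauge x) 1) < F.tau i x ∧ F.tau i x < F.l i * min (F.gauge x) 1 := by
  have hN := F.gauge_pos (ne_zero_of_mem_star h)
  have hmin : 0 < min (F.gauge x) 1 := lt_min hN one_pos
  rcases le_total 0 (F.beta i x) with hb | hb
  · obtain ⟨hc, h2⟩ := star_right h hb
    have h3 := F.tau_succ hc
    have h4 := F.tau_neg_iff.2 h2
    have h5 := F.tau_nonneg_iff.2 hb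
    have := mul_pos (F.l_real_pos (i - 1)) hmin
    constructor <;> linarith
  · obtain ⟨hc, h2⟩ := star_left h hb
    have h3 := F.tau_succ hc
    rw [sub_add_cancel] at h3
    have h4 := F.tau_pos_iff.2 h2
    have h5 := F.tau_nonpos_iff.2 hb
    have := mul_pos (F.l_real_pos i) hmin
    constructor <;> linarith

theorem ofTauGauge_tau_gauge {i : ZMod m} {x : Plane} (h : x ∈ F.star i) :
    F.ofTauGauge i (F.tau i x) (F.gauge x) = x := by
  rw [ofTauGauge, F.max_mul_tau]
  refine F.ext_alpha_beta i ?_ ?_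
  · rw [alpha_point]
    rcases le_total 0 (F.beta i x) with hb | hb
    · rw [min_eq_right (F.tau_nonneg_iff.2 hb), gauge_eq (star_right h hb).1]; ring
    · rw [min_eq_left (F.tau_nonpos_iff.2 hb), F.max_mul_tau, gauge_eq_pred (star_left h hb).1]
      ring
  · rw [beta_point]

theorem ofTauGauge_spec {i : ZMod m} {X Y : ℝ} (hY : 0 < Y) (h1 : -(F.l (i - 1) * min Y 1) < X)
    (h2 : X < F.l i * min Y 1) :
    F.ofTauGauge i X Y ∈ F.star i ∧ F.tau i (F.ofTauGauge i X Y) = X ∧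
      F.gauge (F.ofTauGauge i X Y) = Y := by
  have hmm : min Y 1 * max Y 1 = Y := by rw [min_mul_max, mul_one]
  have hmax : 0 < max Y 1 := lt_of_lt_of_le one_pos (le_max_right _ _)
  have hb : F.beta i (F.ofTauGauge i X Y) = max Y 1 * X := F.beta_point _ _ _
  have ha : F.alpha i (F.ofTauGauge i X Y) = Y + F.c i * (max Y 1 * min X 0) :=
    F.alpha_point _ _ _
  suffices h : F.ofTauGauge i X Y ∈ F.star i ∧ F.gauge (F.ofTauGauge i X Y) = Y by
    refine ⟨h.1, ?_, h.2⟩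
    rw [tau, h.2, hb, mul_div_cancel_left₀ _ hmax.ne']
  rcases le_total 0 X with hX | hX
  · have hb0 : 0 ≤ F.beta i (F.ofTauGauge i X Y) := by rw [hb]; positivity
    have ha0 : F.alpha i (F.ofTauGauge i X Y) = Y := by rw [ha, min_eq_right hX]; ring
    have hb1 : F.beta (i + 1) (F.ofTauGauge i X Y) < 0 := by
      rw [beta_succ, hb, ha0]
      have := mul_lt_mul_of_pos_left h2 hmax
      have e : max Y 1 * (F.l i * min Y 1) = F.l i * Y := by
        linear_combination (F.l i : ℝ) * hmm
      linarith
    exact ⟨mem_star_of_right hb0 hb1, by rw [gauge_eq ⟨hb0, hb1.le⟩, ha0]⟩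
  · have hb0 : F.beta i (F.ofTauGauge i X Y) ≤ 0 := by
      rw [hb]; exact mul_nonpos_of_nonneg_of_nonpos hmax.le hX
    have ha0 : F.alpha (i - 1) (F.ofTauGauge i X Y) = Y := by
      rw [alpha_pred, ha, hb, min_eq_left hX]; ring
    have hb1 : 0 < F.beta (i - 1) (F.ofTauGauge i X Y) := by
      rw [beta_pred, hb, ha0]
      have := mul_lt_mul_of_pos_left h1 hmax
      have e : max Y 1 * (F.l (i - 1) * min Y 1) = F.l (i - 1) * Y := by
        linear_combination (F.l (i - 1) : ℝ) * hmm
      linarith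
    exact ⟨mem_star_of_left hb0 hb1,
      by rw [gauge_eq ⟨hb1.le, by rwa [sub_add_cancel]⟩, ha0]⟩

/-- The coordinates `(tau i, gauge)` on the star of the ray through `v i`. -/
noncomputable def tauGauge (i : ZMod m) : OpenPartialHomeomorph Plane Plane where
  toFun := fun x => ![F.tau i x, F.gauge x]
  invFun := fun p => F.ofTauGauge i (p 0) (p 1)
  source := F.star i
  target := {p | 0 < p 1 ∧ -(F.l (i - 1) * min (p 1) 1) < p 0 ∧ p 0 < F.l i * min (p 1) 1}
  map_source' := fun x hx => ⟨F.gauge_pos (ne_zero_of_mem_star hx), F.tau_mem hx⟩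
  map_target' := fun p hp => (F.ofTauGauge_spec hp.1 hp.2.1 hp.2.2).1
  left_inv' := fun x hx => F.ofTauGauge_tau_gauge hx
  right_inv' := fun p hp => by
    obtain ⟨-, h1, h2⟩ := F.ofTauGauge_spec hp.1 hp.2.1 hp.2.2
    ext k; fin_cases k
    · exact h1
    · exact h2
  open_source := F.isOpen_star i
  open_target := by
    have h0 : Continuous fun p : Plane => p 0 := continuous_apply 0
    have h1 : Continuous fun p : Plane => p 1 := continuous_apply 1
    exact (isOpen_lt continuous_const h1).inter
      ((isOpen_lt (continuous_const.mul (h1.min continuous_const)).neg h0).inter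
        (isOpen_lt h0 (continuous_const.mul (h1.min continuous_const))))
  continuousOn_toFun := by
    refine (continuous_pi fun k => ?_).continuousOn
    fin_cases k
    · exact F.continuous_tau i
    · exact F.continuous_gauge
  continuousOn_invFun := by
    refine Continuous.continuousOn ?_
    unfold ofTauGauge point
    fun_prop

end ReflexiveFan

/-! ### The integral affine atlas -/

namespace ReflexiveFan

variable {m : ℕ} [NeZero m] (F : ReflexiveFan m)

/-- The underlying disc of both surfaces. -/
abbrev Disc : Type := {x : Plane // F.gauge x ≤ 2}

/-- The homeomorphism `(X, Y) ↦ (X, K - Y - k * min X 0)` of the plane, which reverses the second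
coordinate and folds the plane along the second axis. -/
noncomputable def fold (K k : ℝ) : Plane ≃ₜ Plane where
  toFun := fun p => ![p 0, K - p 1 - k * min (p 0) 0]
  invFun := fun p => ![p 0, K - p 1 - k * min (p 0) 0]
  left_inv := fun p => by ext j; fin_cases j <;> simp; ring
  right_inv := fun p => by ext j; fin_cases j <;> simp; ring
  continuous_toFun := by
    refine continuous_pi fun j => ?_
    fin_cases j
    · exact continuous_apply 0
    · change Continuous fun p : Plane => K - p 1 - k * min (p 0) 0
      fun_prop
  continuous_invFun := by
    refine continuous_pi fun j => ?_
    fin_cases j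
    · exact continuous_apply 0
    · change Continuous fun p : Plane => K - p 1 - k * min (p 0) 0
      fun_prop

/-- An integer by which the inner chart at the `i`-th ray is shifted into the upper half plane. -/
def shift (i : ZMod m) : ℤ := 2 + |F.c i| * F.l (i - 1)

/-- An integer by which the polygon is shifted into the upper half plane. -/
def centralShift : ℤ := 1 + ∑ i, (|F.v i 1| + F.l i * |F.u i 1|)

/-- The coordinate functions of the atlas: `none` is the chart at the origin; at the `i`-th ray,
`some (i, true)` is the coordinate that extends across the ray outside of the singular point, and
`some (i, false)` the one that extends inside of it. -/
noncomputable def chartFun : Option (ZMod m × Bool) → Plane → Plane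
  | none => fun x => ![x 0, x 1 + F.centralShift]
  | some (i, true) => fun x => ![F.tau i x, 2 - F.gauge x]
  | some (i, false) => fun x => ![F.tau i x, F.shift i - F.gauge x - F.c i * min (F.tau i x) 0]

/-- The points at which the two halves of the edges next to `v i` are not beyond their
midpoints. -/
def nearCorner (i : ZMod m) : Set Plane :=
  {x | F.gauge x ≠ 1 ∨ (-(F.l (i - 1) / 2 : ℝ) < F.tau i x ∧ F.tau i x < F.l i / 2)}

theorem isOpen_nearCorner (i : ZMod m) : IsOpen (F.nearCorner i) :=
  (isOpen_ne_fun F.continuous_gauge continuous_const).union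
    ((isOpen_lt continuous_const (F.continuous_tau i)).inter
      (isOpen_lt (F.continuous_tau i) continuous_const))

/-- The domains of the charts, for singular points at gauge `r` on the rays. -/
def chartDom (r : ℝ) : Option (ZMod m × Bool) → Set Plane
  | none => {x | F.gauge x < min r 1}
  | some (i, true) => F.star i ∩ (F.nearCorner i ∩ {x | r < F.gauge x ∨ F.tau i x ≠ 0})
  | some (i, false) =>
    F.star i ∩ (F.nearCorner i ∩ ({x | F.gauge x < r ∨ F.tau i x ≠ 0} ∩ {x | F.gauge x < 2}))

theorem isOpen_chartDom (r : ℝ) (a : Option (ZMod m × Bool)) : IsOpen (F.chartDom r a) := by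
  rcases a with _ | ⟨i, _ | _⟩
  · exact isOpen_lt F.continuous_gauge continuous_const
  · exact (F.isOpen_star i).inter ((F.isOpen_nearCorner i).inter
      (((isOpen_lt F.continuous_gauge continuous_const).union
        (isOpen_ne_fun (F.continuous_tau i) continuous_const)).inter
        (isOpen_lt F.continuous_gauge continuous_const)))
  · exact (F.isOpen_star i).inter ((F.isOpen_nearCorner i).inter
      ((isOpen_lt continuous_const F.continuous_gauge).union
        (isOpen_ne_fun (F.continuous_tau i) continuous_const)))

/-- The charts of the plane that induce the atlas. -/
noncomputable def planeChart (r : ℝ) : Option (ZMod m × Bool) → OpenPartialHomeomorph Plane Plane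
  | none => (Homeomorph.addRight (![0, F.centralShift] : Plane)).toOpenPartialHomeomorph.restrOpen
      (F.chartDom r none) (F.isOpen_chartDom r _)
  | some (i, true) => ((F.tauGauge i).transHomeomorph (fold 2 0)).restrOpen
      (F.chartDom r (some (i, true))) (F.isOpen_chartDom r _)
  | some (i, false) => ((F.tauGauge i).transHomeomorph (fold (F.shift i) (F.c i))).restrOpen
      (F.chartDom r (some (i, false))) (F.isOpen_chartDom r _)

theorem planeChart_source (r : ℝ) (a : Option (ZMod m × Bool)) :
    (F.planeChart r a).source = F.chartDom r a := by
  rcases a with _ | ⟨i, _ | _⟩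
  · exact univ_inter _
  · exact inter_eq_right.2 inter_subset_left
  · exact inter_eq_right.2 inter_subset_left

theorem planeChart_apply (r : ℝ) (a : Option (ZMod m × Bool)) (x : Plane) :
    F.planeChart r a x = F.chartFun a x := by
  rcases a with _ | ⟨i, _ | _⟩
  · change x + ![0, (F.centralShift : ℝ)] = ![x 0, x 1 + F.centralShift]
    ext k; fin_cases k <;> simp
  · rfl
  · change ![F.tau i x, 2 - F.gauge x - 0 * min (F.tau i x) 0] = ![F.tau i x, 2 - F.gauge x]
    simp

/-! ### Values of the charts in the half plane -/

variable {F}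

theorem tau_bounds_of_mem_star {i : ZMod m} {x : Plane} (h : x ∈ F.star i) :
    -(F.l (i - 1) : ℝ) < F.tau i x ∧ F.tau i x < F.l i := by
  obtain ⟨h1, h2⟩ := F.tau_mem h
  have h3 := mul_le_of_le_one_right (F.l_real_pos i).le (min_le_right (F.gauge x) 1)
  have h4 := mul_le_of_le_one_right (F.l_real_pos (i - 1)).le (min_le_right (F.gauge x) 1)
  constructor <;> linarith

theorem chartFun_inner_pos {i : ZMod m} {x : Plane} (h : x ∈ F.star i) (h2 : F.gauge x < 2) :
    0 < F.chartFun (some (i, false)) x 1 := by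
  obtain ⟨h3, -⟩ := tau_bounds_of_mem_star h
  have hl := F.l_real_pos (i - 1)
  change 0 < (F.shift i : ℝ) - F.gauge x - F.c i * min (F.tau i x) 0
  have h4 : |min (F.tau i x) 0| ≤ F.l (i - 1) := by
    rw [abs_le]
    exact ⟨le_min h3.le (by linarith), (min_le_right _ _).trans hl.le⟩
  have h5 : (F.c i : ℝ) * min (F.tau i x) 0 ≤ |(F.c i : ℝ)| * F.l (i - 1) :=
    (le_abs_self _).trans (by rw [abs_mul]; gcongr)
  have : (F.shift i : ℝ) = 2 + |(F.c i : ℝ)| * F.l (i - 1) := by unfold shift; push_cast; ring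
  linarith

theorem abs_coord_le (F : ReflexiveFan m) (x : Plane) (k : Fin 2) :
    |x k| ≤ F.gauge x * ∑ j, (|(F.v j k : ℝ)| + F.l j * |(F.u j k : ℝ)|) := by
  obtain ⟨i, hi⟩ := F.exists_mem_cone x
  have h0 := F.gauge_nonneg x
  have e : x k = F.gauge x * F.v i k + F.beta i x * F.u i k := by
    conv_lhs => rw [← F.point_alpha_beta i x]
    rw [gauge_eq hi]; rfl
  have h1 : |x k| ≤ F.gauge x * (|(F.v i k : ℝ)| + F.l i * |(F.u i k : ℝ)|) := by
    rw [e]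
    refine (abs_add_le _ _).trans ?_
    rw [abs_mul, abs_mul, abs_of_nonneg h0, abs_of_nonneg hi.1]
    have := mul_le_mul_of_nonneg_right (F.beta_le_of_mem_cone hi) (abs_nonneg (F.u i k : ℝ))
    linarith
  refine h1.trans (mul_le_mul_of_nonneg_left ?_ h0)
  exact Finset.single_le_sum (f := fun j => |(F.v j k : ℝ)| + F.l j * |(F.u j k : ℝ)|)
    (fun j _ => by positivity) (Finset.mem_univ i)

theorem chartFun_central_pos {x : Plane} (h : F.gauge x ≤ 1) :
    0 < F.chartFun none x 1 := by
  change 0 < x 1 + (F.centralShift : ℝ)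
  have h1 := F.abs_coord_le x 1
  have h2 : 0 ≤ ∑ j, (|(F.v j 1 : ℝ)| + F.l j * |(F.u j 1 : ℝ)|) :=
    Finset.sum_nonneg fun j _ => by positivity
  have h3 : (F.centralShift : ℝ) = 1 + ∑ j, (|(F.v j 1 : ℝ)| + F.l j * |(F.u j 1 : ℝ)|) := by
    unfold centralShift; push_cast; rfl
  have h4 := mul_le_of_le_one_left h2 h
  have := neg_abs_le (x 1)
  linarith

theorem gauge_le_two_iff (r : ℝ) (a : Option (ZMod m × Bool)) {x : Plane}
    (hx : x ∈ F.chartDom r a) : F.gauge x ≤ 2 ↔ 0 ≤ F.chartFun a x 1 := by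
  rcases a with _ | ⟨i, _ | _⟩
  · have h1 : F.gauge x ≤ 1 := (lt_of_lt_of_le hx (min_le_right _ _)).le
    exact iff_of_true (by linarith) (chartFun_central_pos h1).le
  · exact iff_of_true hx.2.2.2.le (chartFun_inner_pos hx.1 hx.2.2.2).le
  · change _ ↔ 0 ≤ 2 - F.gauge x
    rw [sub_nonneg]

variable (F)

/-- The charts of the atlas. -/
noncomputable def chart (r : ℝ) (a : Option (ZMod m × Bool)) :
    OpenPartialHomeomorph F.Disc HalfPlane :=
  (F.planeChart r a).restrictSubtype (fun x => F.gauge x ≤ 2) (fun y => 0 ≤ y 1)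
    (fun x hx => by
      rw [planeChart_source] at hx
      rw [planeChart_apply]; exact gauge_le_two_iff r a hx)
    ⟨0, by rw [gauge_zero]; norm_num⟩ ⟨0, le_rfl⟩

theorem mem_chart_source {r : ℝ} {a : Option (ZMod m × Bool)} {x : F.Disc} :
    x ∈ (F.chart r a).source ↔ (x : Plane) ∈ F.chartDom r a := by
  rw [← planeChart_source]; rfl

theorem chart_apply {r : ℝ} {a : Option (ZMod m × Bool)} {x : F.Disc}
    (hx : (x : Plane) ∈ F.chartDom r a) : (F.chart r a x : Plane) = F.chartFun a x := by
  rw [chart, OpenPartialHomeomorph.restrictSubtype_apply, planeChart_apply]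
  rwa [planeChart_source]

theorem eventually_chart {r : ℝ} {a : Option (ZMod m × Bool)} {x : F.Disc}
    (hx : (x : Plane) ∈ F.chartDom r a) :
    ∀ᶠ y : F.Disc in 𝓝 x, (F.chart r a y : Plane) = F.chartFun a y := by
  have := ((F.isOpen_chartDom r a).preimage continuous_subtype_val).mem_nhds
    (show x ∈ Subtype.val ⁻¹' F.chartDom r a from hx)
  filter_upwards [this] with y hy
  exact F.chart_apply hy

/-! ### Compatibility of the charts -/

variable {F}

/-- The inner and the outer chart at a ray agree up to translation on one side of the ray and
differ by a shear by `c i` on the other. -/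
theorem affRel_fold {i : ZMod m} {x : Plane} (h : F.tau i x ≠ 0) :
    AffRel (𝓝 x) (F.chartFun (some (i, true))) (F.chartFun (some (i, false))) := by
  rcases lt_or_gt_of_ne h with h | h
  · refine AffRel.of_coeff 1 0 (-F.c i) 1 0 (F.shift i - 2) (by ring) ?_
    filter_upwards [(F.continuous_tau i).tendsto x |>.eventually_lt_const h] with y hy
    simp [chartFun, min_eq_left hy.le]; ring
  · refine AffRel.of_coeff 1 0 0 1 0 (F.shift i - 2) (by ring) ?_
    filter_upwards [(F.continuous_tau i).tendsto x |>.eventually_const_lt h] with y hy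
    simp [chartFun, min_eq_right hy.le]

/-- The outer charts at consecutive rays differ by a translation outside of the polygon and by a
shear by `l i` inside of it. The discrepancy is the monodromy at the midpoint of the edge. -/
theorem affRel_outer_of_mem_cone {i : ZMod m} {l : Filter Plane} (h : ∀ᶠ y in l, y ∈ F.cone i)
    (h1 : (∀ᶠ y in l, F.gauge y ≤ 1) ∨ ∀ᶠ y in l, 1 ≤ F.gauge y) :
    AffRel l (F.chartFun (some (i, true))) (F.chartFun (some (i + 1, true))) := by
  rcases h1 with h1 | h1
  · refine AffRel.of_coeff 1 (F.l i) 0 1 (-2 * F.l i) 0 (by ring) ?_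
    filter_upwards [h, h1] with y hy hy1
    simp [chartFun, F.tau_succ hy, min_eq_left hy1]; ring
  · refine AffRel.of_coeff 1 0 0 1 (-F.l i) 0 (by ring) ?_
    filter_upwards [h, h1] with y hy hy1
    simp [chartFun, F.tau_succ hy, min_eq_right hy1]; ring

/-- Inside of the polygon the inner charts are affine for the structure of the plane. -/
theorem affRel_inner_none {i : ZMod m} {l : Filter Plane} (h : ∀ᶠ y in l, y ∈ F.star i)
    (h1 : ∀ᶠ y in l, F.gauge y ≤ 1) :
    AffRel l (F.chartFun none) (F.chartFun (some (i, false))) := by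
  refine AffRel.of_coeff (-F.v i 1) (F.v i 0) (-F.u i 1) (F.u i 0)
    (-F.v i 0 * F.centralShift) (F.shift i - F.u i 0 * F.centralShift)
    (by have := F.det_eq i; unfold LatticeVec.det2 at this; linarith) ?_
  filter_upwards [h, h1] with y hy hy1
  have ht : F.tau i y = F.beta i y := by rw [tau, max_eq_right hy1, div_one]
  have hg : F.gauge y + F.c i * min (F.tau i y) 0 = F.alpha i y := by
    rw [ht]
    rcases le_total 0 (F.beta i y) with hb | hb
    · rw [gauge_eq (star_right hy hb).1, min_eq_right hb]; ring
    · rw [gauge_eq_pred (star_left hy hb).1, min_eq_left hb]; ring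
  constructor
  · simp [chartFun, ht, beta, detR, LatticeVec.toPlane]; ring
  · have e : F.chartFun (some (i, false)) y 1 = F.shift i - F.alpha i y := by
      rw [← hg]; simp [chartFun]; ring
    rw [e]
    simp [chartFun, alpha, detR, LatticeVec.toPlane]; ring

theorem eventually_mem_cone {i : ZMod m} {x : Plane} (h : 0 < F.beta i x)
    (h' : F.beta (i + 1) x < 0) : ∀ᶠ y in 𝓝 x, y ∈ F.cone i := by
  filter_upwards [(F.continuous_beta i).tendsto x |>.eventually_const_lt h,
    (F.continuous_beta (i + 1)).tendsto x |>.eventually_lt_const h'] with y h1 h2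
  exact ⟨h1.le, h2.le⟩

theorem eventually_gauge_ne {x : Plane} (h : F.gauge x ≠ 1) :
    (∀ᶠ y in 𝓝 x, F.gauge y ≤ 1) ∨ ∀ᶠ y in 𝓝 x, 1 ≤ F.gauge y := by
  rcases lt_or_gt_of_ne h with h | h
  · exact Or.inl ((F.continuous_gauge.tendsto x |>.eventually_lt_const h).mono fun y hy => hy.le)
  · exact Or.inr ((F.continuous_gauge.tendsto x |>.eventually_const_lt h).mono fun y hy => hy.le)

/-- The charts are compatible: the overlap of the domains of two charts avoids the rays and edges
on the two sides of which their coordinates are related by different affine maps. -/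
theorem affRel_chartFun {r : ℝ} {a b : Option (ZMod m × Bool)} {x : Plane}
    (ha : x ∈ F.chartDom r a) (hb : x ∈ F.chartDom r b) :
    AffRel (𝓝 x) (F.chartFun a) (F.chartFun b) := by
  have fold' : ∀ i (s : Bool), F.tau i x ≠ 0 →
      AffRel (𝓝 x) (F.chartFun (some (i, true))) (F.chartFun (some (i, s))) := by
    rintro i (_ | _) h
    · exact affRel_fold h
    · exact AffRel.refl _ _
  have central : ∀ i (s : Bool), x ∈ F.chartDom r none → x ∈ F.chartDom r (some (i, s)) →
      AffRel (𝓝 x) (F.chartFun none) (F.chartFun (some (i, s))) := by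
    intro i s h h'
    have hN : F.gauge x < 1 := lt_of_lt_of_le h (min_le_right _ _)
    have hr : F.gauge x < r := lt_of_lt_of_le h (min_le_left _ _)
    have key : x ∈ F.star i → AffRel (𝓝 x) (F.chartFun none) (F.chartFun (some (i, false))) :=
      fun hs => affRel_inner_none ((F.isOpen_star i).mem_nhds hs)
        ((F.continuous_gauge.tendsto x |>.eventually_lt_const hN).mono fun y hy => hy.le)
    rcases s with _ | _
    · exact key h'.1
    · exact (key h'.1).trans (affRel_fold (h'.2.2.resolve_left hr.le.not_gt)).symm
  have mem_star : ∀ i (s : Bool), x ∈ F.chartDom r (some (i, s)) →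
      x ∈ F.star i ∧ x ∈ F.nearCorner i := by
    rintro i (_ | _) h <;> exact ⟨h.1, h.2.1⟩
  have next : ∀ i (s s' : Bool), x ∈ F.chartDom r (some (i, s)) →
      x ∈ F.chartDom r (some (i + 1, s')) → 0 < F.beta i x → F.beta (i + 1) x < 0 →
      AffRel (𝓝 x) (F.chartFun (some (i, s))) (F.chartFun (some (i + 1, s'))) := by
    intro i s s' h h' h1 h2
    have hN : F.gauge x ≠ 1 := by
      intro hN
      have h3 := ((mem_star _ _ h).2.resolve_left (not_not.2 hN)).2
      have h4 := ((mem_star _ _ h').2.resolve_left (not_not.2 hN)).1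
      rw [F.tau_succ ⟨h1.le, h2.le⟩, hN, add_sub_cancel_right] at h4
      norm_num at h4
      linarith
    exact ((fold' i s (F.tau_pos_iff.2 h1).ne').symm.trans
      (affRel_outer_of_mem_cone (eventually_mem_cone h1 h2) (eventually_gauge_ne hN))).trans
      (fold' _ s' (F.tau_neg_iff.2 h2).ne)
  rcases a with _ | ⟨i, s⟩ <;> rcases b with _ | ⟨j, s'⟩
  · exact AffRel.refl _ _
  · exact central j s' ha hb
  · exact (central i s hb ha).symm
  · rcases mem_star_inter (mem_star _ _ ha).1 (mem_star _ _ hb).1 with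
      rfl | ⟨rfl, h1, h2⟩ | ⟨rfl, h1, h2⟩
    · by_cases ht : F.tau i x = 0
      · rcases s with _ | _ <;> rcases s' with _ | _
        · exact AffRel.refl _ _
        · exact absurd (ha.2.2.1.resolve_right (not_not.2 ht))
            (hb.2.2.resolve_right (not_not.2 ht)).le.not_gt
        · exact absurd (hb.2.2.1.resolve_right (not_not.2 ht))
            (ha.2.2.resolve_right (not_not.2 ht)).le.not_gt
        · exact AffRel.refl _ _
      · exact (fold' _ _ ht).symm.trans (fold' _ _ ht)
    · exact next _ _ _ ha hb h1 h2
    · exact (next _ _ _ hb ha h1 h2).symm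

/-! ### The singular points -/

variable (F)

/-- The midpoint of the edge `[v i, v (i + 1)]`. -/
noncomputable def mid (i : ZMod m) : Plane := F.point i 1 (F.l i / 2)

/-- The point at gauge `r` on the ray through `v i`. -/
noncomputable def ray (r : ℝ) (i : ZMod m) : Plane := F.point i r 0

theorem mid_mem_cone (i : ZMod m) : F.mid i ∈ F.cone i := by
  have := F.l_real_pos i
  exact F.point_mem_cone (by positivity) (by linarith)

theorem gauge_mid (i : ZMod m) : F.gauge (F.mid i) = 1 := by
  have := F.l_real_pos i
  exact F.gauge_point (by positivity) (by linarith)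

theorem tau_mid (i : ZMod m) : F.tau i (F.mid i) = F.l i / 2 := by
  rw [tau, gauge_mid, mid, beta_point]; simp

theorem tau_succ_mid (i : ZMod m) : F.tau (i + 1) (F.mid i) = -(F.l i / 2) := by
  rw [F.tau_succ (F.mid_mem_cone i), tau_mid, gauge_mid]; simp; ring

theorem mid_mem_star (i : ZMod m) : F.mid i ∈ F.star i ∧ F.mid i ∈ F.star (i + 1) := by
  have hl := F.l_real_pos i
  have h1 : 0 < F.beta i (F.mid i) := F.tau_pos_iff.1 (by rw [tau_mid]; positivity)
  have h2 : F.beta (i + 1) (F.mid i) < 0 := F.tau_neg_iff.1 (by rw [tau_succ_mid]; linarith)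
  exact ⟨mem_star_of_right h1.le h2, mem_star_of_left h2.le (by rwa [add_sub_cancel_right])⟩

variable {r : ℝ}

theorem ray_mem_cone (hr : 0 < r) (i : ZMod m) : F.ray r i ∈ F.cone i :=
  F.point_mem_cone le_rfl (mul_nonneg (F.l_real_pos i).le hr.le)

theorem gauge_ray (hr : 0 < r) (i : ZMod m) : F.gauge (F.ray r i) = r :=
  F.gauge_point le_rfl (mul_nonneg (F.l_real_pos i).le hr.le)

theorem beta_ray (i : ZMod m) : F.beta i (F.ray r i) = 0 := F.beta_point _ _ _

theorem tau_ray (i : ZMod m) : F.tau i (F.ray r i) = 0 := F.tau_eq_zero_iff.2 (F.beta_ray i)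

theorem ray_mem_star (hr : 0 < r) (i : ZMod m) : F.ray r i ∈ F.star i := by
  refine mem_star_of_right (F.beta_ray i).ge ?_
  rw [beta_succ, beta_ray, ray, alpha_point]
  have := mul_pos (F.l_real_pos i) hr
  linarith

theorem eq_of_ray_mem_star (hr : 0 < r) {i j : ZMod m} (h : F.ray r j ∈ F.star i) : i = j := by
  have hb := F.beta_ray (r := r) j
  rcases mem_star_inter h (F.ray_mem_star hr j) with h | ⟨rfl, -, h⟩ | ⟨-, h, -⟩
  · exact h
  · linarith
  · linarith

theorem eq_or_eq_of_mid_mem_star {i j : ZMod m} (h : F.mid j ∈ F.star i) : i = j ∨ i = j + 1 := by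
  rcases h _ (F.mid_mem_cone j) with h | h
  · exact Or.inr (by rw [h, sub_add_cancel])
  · exact Or.inl h.symm

theorem mid_notMem_chartDom (i : ZMod m) (a : Option (ZMod m × Bool)) :
    F.mid i ∉ F.chartDom r a := by
  have key : ∀ j, F.mid i ∈ F.star j → F.mid i ∉ F.nearCorner j := by
    intro j hj hn
    have h1 := hn.resolve_left (not_not.2 (F.gauge_mid i))
    rcases F.eq_or_eq_of_mid_mem_star hj with rfl | rfl
    · rw [tau_mid] at h1; exact lt_irrefl _ h1.2
    · rw [tau_succ_mid, add_sub_cancel_right] at h1; exact lt_irrefl _ h1.1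
  rcases a with _ | ⟨j, _ | _⟩ <;> intro h
  · have h1 : F.gauge (F.mid i) < 1 := lt_of_lt_of_le h (min_le_right _ _)
    rw [gauge_mid] at h1; exact lt_irrefl _ h1
  · exact key j h.1 h.2.1
  · exact key j h.1 h.2.1

theorem ray_notMem_chartDom (hr : 0 < r) (i : ZMod m) (a : Option (ZMod m × Bool)) :
    F.ray r i ∉ F.chartDom r a := by
  have hg := F.gauge_ray hr i
  rcases a with _ | ⟨j, _ | _⟩ <;> intro h
  · have h1 : F.gauge (F.ray r i) < r := lt_of_lt_of_le h (min_le_left _ _)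
    rw [hg] at h1; exact lt_irrefl _ h1
  · obtain rfl := F.eq_of_ray_mem_star hr h.1
    rcases h.2.2.1 with h | h
    · exact absurd hg (ne_of_lt h)
    · exact h (F.tau_ray _)
  · obtain rfl := F.eq_of_ray_mem_star hr h.1
    rcases h.2.2 with h | h
    · exact absurd hg (ne_of_gt h)
    · exact h (F.tau_ray _)

theorem eq_of_tau_gauge {i : ZMod m} {x y : Plane} (hx : x ∈ F.star i) (hy : y ∈ F.star i)
    (h : F.tau i x = F.tau i y) (h' : F.gauge x = F.gauge y) : x = y := by
  rw [← F.ofTauGauge_tau_gauge hx, ← F.ofTauGauge_tau_gauge hy, h, h']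

theorem exists_mem_chartDom (hr : 0 < r) (hr2 : r < 2) {x : Plane} (h1 : ∀ i, x ≠ F.mid i)
    (h2 : ∀ i, x ≠ F.ray r i) : ∃ a, x ∈ F.chartDom r a := by
  by_cases hx : x = 0
  · exact ⟨none, show F.gauge x < min r 1 by rw [hx, gauge_zero]; exact lt_min hr one_pos⟩
  obtain ⟨i, ⟨hb, hb'⟩, -⟩ := F.existsUnique_sector hx
  have hs : x ∈ F.star i := mem_star_of_right hb hb'
  have ht := F.tau_nonneg_iff.2 hb
  have hl := F.l_real_pos i
  have hl' := F.l_real_pos (i - 1)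
  by_cases hfar : F.gauge x = 1 ∧ F.l i / 2 ≤ F.tau i x
  · obtain ⟨hg, hm⟩ := hfar
    have hm' : (F.l i / 2 : ℝ) < F.tau i x := by
      refine lt_of_le_of_ne hm fun h => h1 i ?_
      exact F.eq_of_tau_gauge hs (F.mid_mem_star i).1 (by rw [tau_mid, h]) (by rw [hg, gauge_mid])
    have hbp : 0 < F.beta i x := F.tau_pos_iff.1 (by linarith)
    have ht' := F.tau_succ ⟨hb, hb'.le⟩
    rw [hg, min_self, mul_one] at ht'
    have ht0 := F.tau_neg_iff.2 hb'
    refine ⟨some (i + 1, true), mem_star_of_left hb'.le (by rwa [add_sub_cancel_right]),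
      Or.inr ⟨?_, ?_⟩, Or.inr ht0.ne⟩
    · rw [add_sub_cancel_right]; linarith
    · have := F.l_real_pos (i + 1); linarith
  · have hn : x ∈ F.nearCorner i := by
      by_cases hg : F.gauge x = 1
      · exact Or.inr ⟨by linarith, not_le.1 fun h => hfar ⟨hg, h⟩⟩
      · exact Or.inl hg
    by_cases hc : r < F.gauge x ∨ F.tau i x ≠ 0
    · exact ⟨some (i, true), hs, hn, hc⟩
    · push Not at hc
      have hlt : F.gauge x < r := by
        refine lt_of_le_of_ne hc.1 fun h => h2 i ?_
        exact F.eq_of_tau_gauge hs (F.ray_mem_star hr i) (by rw [tau_ray, hc.2])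
          (by rw [h, gauge_ray F hr])
      exact ⟨some (i, false), hs, hn, Or.inl hlt, hlt.trans hr2⟩

end ReflexiveFan

/-! ### Multiplicities of singular points -/

namespace IntegralAffineSurface

theorem IsAffineAt.intAff {B : IntegralAffineSurface} {f : B.carrier → Plane} {x : B.carrier}
    (h : B.IsAffineAt f x) (M : Matrix.SpecialLinearGroup (Fin 2) ℤ) (b : LatticeVec) :
    B.IsAffineAt (fun y => _root_.intAff M b (f y)) x := by
  obtain ⟨e, he, hx, M', b', h⟩ := h
  obtain ⟨b'', hb⟩ := intAff_comp M M' b b'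
  exact ⟨e, he, hx, M * M', b'', h.mono fun y hy => by simp only [hy, hb]⟩

/-- Local normal form of a singular point of multiplicity `k`: an affine coordinate `G₁`
that extends over the complement of the negative first axis and an affine coordinate `G₂` that
extends over the complement of the positive first axis agree above the axis and differ by a shear
below the axis. -/
theorem hasMultiplicity_of_shear {B : IntegralAffineSurface} {p : B.carrier} (hp : p ∈ B.sing)
    {h : OpenPartialHomeomorph B.carrier Plane} {R : ℝ} (hR : 0 < R)
    (htarget : h.target = Metric.ball 0 R) (hps : p ∈ h.source) (hp0 : h p = 0)
    (honly : ∀ q ∈ h.source, q ∈ B.sing → q = p) {G₁ G₂ : B.carrier → Plane} {k : ℤ}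
    {b : LatticeVec} {q : Plane}
    (hG₁ : ∀ x ∈ h.source, (h x 1 ≠ 0 ∨ 0 < h x 0) → B.IsAffineAt G₁ x)
    (hG₂ : ∀ x ∈ h.source, (h x 1 ≠ 0 ∨ h x 0 < 0) → B.IsAffineAt G₂ x)
    (hup : ∀ x ∈ h.source, 0 < h x 1 → G₂ x = G₁ x)
    (hdown : ∀ x ∈ h.source, h x 1 < 0 → G₂ x = intAff (shear k) b (G₁ x))
    (horient : ∀ x ∈ h.source, 0 < h x 1 → G₁ x = h x + q) :
    B.HasMultiplicity p k := by
  have hpi := Real.pi_pos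
  set ρ := R / 2 with hρ
  have hρ0 : 0 < ρ := by positivity
  set w : ℝ → Plane := fun t =>
    ![ρ * Real.cos (2 * Real.pi * t), ρ * Real.sin (2 * Real.pi * t)] with hw
  have hball : ∀ t, w t ∈ h.target := by
    intro t
    rw [htarget, mem_ball_zero_iff, pi_norm_lt_iff hR]
    intro j
    have h1 := Real.abs_cos_le_one (2 * Real.pi * t)
    have h2 := Real.abs_sin_le_one (2 * Real.pi * t)
    fin_cases j <;> simp only [hw, Fin.zero_eta, Fin.mk_one, Matrix.cons_val_zero,
      Matrix.cons_val_one, Real.norm_eq_abs, abs_mul, abs_of_pos hρ0]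
    · have := mul_le_of_le_one_right hρ0.le h1
      linarith
    · have := mul_le_of_le_one_right hρ0.le h2
      linarith
  have hsrc : ∀ t, h.symm (w t) ∈ h.source := fun t => h.map_target (hball t)
  have hw' : ∀ t, h (h.symm (w t)) = w t := fun t => h.right_inv (hball t)
  have hwc : Continuous w := by
    refine continuous_pi fun j => ?_
    fin_cases j
    · change Continuous fun t => ρ * Real.cos (2 * Real.pi * t); fun_prop
    · change Continuous fun t => ρ * Real.sin (2 * Real.pi * t); fun_prop
  have hne : ∀ t, w t 0 = 0 → w t 1 ≠ 0 := by
    intro t h0 h1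
    have := Real.sin_sq_add_cos_sq (2 * Real.pi * t)
    simp only [hw, Matrix.cons_val_zero, Matrix.cons_val_one, mul_eq_zero, hρ0.ne',
      false_or] at h0 h1
    rw [h0, h1] at this
    norm_num at this
  have hnear : ∀ t, ∀ᶠ y in 𝓝 (h.symm (w t)), y ∈ h.source := fun t =>
    h.open_source.mem_nhds (hsrc t)
  have hcont1 : ∀ t, Tendsto (fun y => h y 1) (𝓝 (h.symm (w t))) (𝓝 (w t 1)) := by
    intro t
    have := h.continuousAt (hsrc t)
    rw [ContinuousAt, hw'] at this
    exact (continuous_apply 1).continuousAt.tendsto.comp this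
  refine ⟨hp, h, ρ, R, hρ0, by rw [hρ]; linarith, htarget, hps, hp0, honly, ?_, ?_⟩
  · -- above the axis the coordinate `G₁` is a translate of `h`
    have hz : (![0, ρ] : Plane) ∈ h.target := by
      have := hball (1 / 4)
      rw [hw] at this
      simp only [show 2 * Real.pi * (1 / 4) = Real.pi / 2 by ring, Real.cos_pi_div_two,
        Real.sin_pi_div_two, mul_zero, mul_one] at this
      exact this
    refine ⟨![0, ρ], hz, G₁, hG₁ _ (h.map_target hz) ?_, ContinuousLinearMap.id ℝ Plane, ?_, ?_⟩
    · rw [h.right_inv hz]; exact Or.inl hρ0.ne'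
    · have h1 : HasFDerivAt (fun y : Plane => y + q) (ContinuousLinearMap.id ℝ Plane) ![0, ρ] :=
        (hasFDerivAt_id _).add_const q
      refine h1.congr_of_eventuallyEq ?_
      have h2 : ∀ᶠ y : Plane in 𝓝 ![0, ρ], 0 < y 1 :=
        ((continuous_apply 1).tendsto (![0, ρ] : Plane)).eventually_const_lt hρ0
      filter_upwards [h.open_target.mem_nhds hz, h2] with y hy hy1
      rw [horient _ (h.map_target hy) (by rwa [h.right_inv hy]), h.right_inv hy]
    · simp
  · set F : ℝ → B.carrier → Plane := fun t =>
      if t ≤ 1 / 4 then G₁ else if t < 3 / 4 then G₂ else fun y => intAff (shear k) b (G₁ y)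
      with hF
    refine ⟨F, fun t ⟨ht0, ht1⟩ => ⟨?_, ?_⟩, b, Eventually.of_forall fun y => ?_⟩
    · change B.IsAffineAt (F t) (h.symm (w t))
      have key : 0 ≤ Real.cos (2 * Real.pi * t) → B.IsAffineAt G₁ (h.symm (w t)) := by
        intro hc
        refine hG₁ _ (hsrc t) ?_
        rw [hw']
        rcases hc.eq_or_lt with hc | hc
        · exact Or.inl (hne t (by simp [hw, ← hc]))
        · exact Or.inr (mul_pos hρ0 hc)
      simp only [hF]
      split_ifs with h1 h2
      · exact key (Real.cos_nonneg_of_mem_Icc ⟨by nlinarith, by nlinarith⟩)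
      · refine hG₂ _ (hsrc t) ?_
        rw [hw']
        have hc : Real.cos (2 * Real.pi * t) ≤ 0 :=
          Real.cos_nonpos_of_pi_div_two_le_of_le (by nlinarith) (by nlinarith)
        rcases hc.eq_or_lt with hc | hc
        · exact Or.inl (hne t (by simp [hw, hc]))
        · exact Or.inr (mul_neg_of_pos_of_neg hρ0 hc)
      · refine (key ?_).intAff _ _
        rw [← Real.cos_sub_two_pi]
        exact Real.cos_nonneg_of_mem_Icc ⟨by nlinarith, by nlinarith⟩
    · change ∀ᶠ s in _, ∀ᶠ y in 𝓝 (h.symm (w s)), F s y = F t y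
      refine Eventually.filter_mono nhdsWithin_le_nhds ?_
      have const : (∀ᶠ s in 𝓝 t, F s = F t) →
          ∀ᶠ s in 𝓝 t, ∀ᶠ y in 𝓝 (h.symm (w s)), F s y = F t y :=
        fun hs => hs.mono fun s hs => Eventually.of_forall fun y => by rw [hs]
      have hw1 : Continuous fun s => w s 1 := (continuous_apply 1).comp hwc
      rcases lt_trichotomy t (1 / 4) with h1 | rfl | h1
      · refine const ((eventually_lt_nhds h1).mono fun s hs => ?_)
        simp only [hF, if_pos hs.le, if_pos h1.le]
      · have hpos : 0 < w (1 / 4) 1 := by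
          simp [hw, show 2 * Real.pi * 4⁻¹ = Real.pi / 2 by ring, hρ0]
        filter_upwards [hw1.continuousAt.tendsto.eventually_const_lt hpos,
          eventually_lt_nhds (show (1 / 4 : ℝ) < 3 / 4 by norm_num)] with s hs hs'
        filter_upwards [hnear s, (hcont1 s).eventually_const_lt hs] with y hy hy'
        simp only [hF, le_refl, if_true, if_pos hs']
        split_ifs
        · rfl
        · exact hup y hy hy'
      rcases lt_trichotomy t (3 / 4) with h2 | rfl | h2
      · refine const ?_
        filter_upwards [eventually_gt_nhds h1, eventually_lt_nhds h2] with s hs hs'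
        simp only [hF, if_neg hs.not_ge, if_pos hs', if_neg h1.not_ge, if_pos h2]
      · have hneg : w (3 / 4) 1 < 0 := by
          have : 2 * Real.pi * (3 / 4) = Real.pi / 2 + Real.pi := by ring
          simp only [hw, Matrix.cons_val_one, this, Real.sin_add_pi, Real.sin_pi_div_two]
          simp [hρ0]
        filter_upwards [hw1.continuousAt.tendsto.eventually_lt_const hneg,
          eventually_gt_nhds (show (1 / 4 : ℝ) < 3 / 4 by norm_num)] with s hs hs'
        filter_upwards [hnear s, (hcont1 s).eventually_lt_const hs] with y hy hy'
        simp only [hF, if_neg hs'.not_ge, if_neg h1.not_ge, lt_irrefl, if_false]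
        split_ifs
        · exact hdown y hy hy'
        · rfl
      · refine const ((eventually_gt_nhds h2).mono fun s hs => ?_)
        have : ¬ s ≤ 1 / 4 := by linarith
        simp only [hF, if_neg this, if_neg hs.not_gt, if_neg h1.not_ge, if_neg h2.not_gt]
    · simp only [hF]
      norm_num

end IntegralAffineSurface

namespace ReflexiveFan

variable {m : ℕ} [NeZero m] (F : ReflexiveFan m)

/-- The midpoints of the edges, as points of the disc. -/
noncomputable def midPt (i : ZMod m) : F.Disc := ⟨F.mid i, by rw [gauge_mid]; norm_num⟩

/-- The points at gauge `r` on the rays, as points of the disc. -/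
noncomputable def rayPt {r : ℝ} (hr : r = 1 / 2 ∨ r = 3 / 2) (i : ZMod m) : F.Disc :=
  ⟨F.ray r i, by
    rw [gauge_ray F (by rcases hr with rfl | rfl <;> norm_num)]
    rcases hr with rfl | rfl <;> norm_num⟩

theorem midPt_injective : Function.Injective F.midPt := by
  intro i j h
  have h1 := (F.mid_mem_star i).1
  have h2 : F.mid i = F.mid j := congrArg Subtype.val h
  have hl := F.l_real_pos j
  rcases F.eq_or_eq_of_mid_mem_star (h2 ▸ h1) with h | h
  · exact h
  · have e1 := F.tau_mid i
    rw [h2, h, tau_succ_mid] at e1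
    have := F.l_real_pos (j + 1)
    linarith

variable {r : ℝ} (hr : r = 1 / 2 ∨ r = 3 / 2)

theorem rayPt_injective : Function.Injective (F.rayPt hr) := by
  intro i j h
  have h2 : F.ray r i = F.ray r j := congrArg Subtype.val h
  have hr0 : 0 < r := by rcases hr with rfl | rfl <;> norm_num
  exact F.eq_of_ray_mem_star hr0 (h2 ▸ F.ray_mem_star hr0 i)

theorem midPt_ne_rayPt (i j : ZMod m) : F.midPt i ≠ F.rayPt hr j := by
  intro h
  have h2 : F.mid i = F.ray r j := congrArg Subtype.val h
  have hr0 : 0 < r := by rcases hr with rfl | rfl <;> norm_num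
  have h3 := F.gauge_mid i
  rw [h2, gauge_ray F hr0] at h3
  rcases hr with rfl | rfl <;> norm_num at h3

open Classical in
/-- The singular points: the midpoints of the edges and the points at gauge `r` on the rays. -/
noncomputable def singular : Finset F.Disc :=
  Finset.univ.image F.midPt ∪ Finset.univ.image (F.rayPt hr)

theorem mem_singular {x : F.Disc} :
    x ∈ F.singular hr ↔ (∃ i, F.midPt i = x) ∨ ∃ i, F.rayPt hr i = x := by
  simp [singular]

theorem notMem_chartDom_of_mem_singular {x : F.Disc} (hx : x ∈ F.singular hr)
    (a : Option (ZMod m × Bool)) : (x : Plane) ∉ F.chartDom r a := by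
  have hr0 : 0 < r := by rcases hr with rfl | rfl <;> norm_num
  rcases (F.mem_singular hr).1 hx with ⟨i, rfl⟩ | ⟨i, rfl⟩
  · exact F.mid_notMem_chartDom i a
  · exact F.ray_notMem_chartDom hr0 i a

theorem exists_mem_chartDom_of_notMem_singular {x : F.Disc} (hx : x ∉ F.singular hr) :
    ∃ a, (x : Plane) ∈ F.chartDom r a := by
  have hr0 : 0 < r := by rcases hr with rfl | rfl <;> norm_num
  have hr2 : r < 2 := by rcases hr with rfl | rfl <;> norm_num
  rw [mem_singular] at hx
  push Not at hx
  exact F.exists_mem_chartDom hr0 hr2 (fun i h => hx.1 i (Subtype.ext h.symm))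
    fun i h => hx.2 i (Subtype.ext h.symm)

/-- The planar coordinate `(tau i - l i / 2, 1 - gauge)` around the midpoint of an edge. -/
noncomputable def midCoord (i : ZMod m) : OpenPartialHomeomorph Plane Plane :=
  (F.tauGauge i).transHomeomorph ((fold 1 0).trans (Homeomorph.addRight ![-(F.l i / 2), 0]))

/-- The exchange of the two coordinates of the plane. -/
def swapPlane : Plane ≃ₜ Plane where
  toFun := fun p => ![p 1, p 0]
  invFun := fun p => ![p 1, p 0]
  left_inv := fun p => by ext j; fin_cases j <;> rfl
  right_inv := fun p => by ext j; fin_cases j <;> rfl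
  continuous_toFun := by
    refine continuous_pi fun j => ?_
    fin_cases j
    · exact continuous_apply 1
    · exact continuous_apply 0
  continuous_invFun := by
    refine continuous_pi fun j => ?_
    fin_cases j
    · exact continuous_apply 1
    · exact continuous_apply 0

/-- The planar coordinate `(gauge - r, tau i)` around the point at gauge `r` on a ray. -/
noncomputable def rayCoord (r : ℝ) (i : ZMod m) : OpenPartialHomeomorph Plane Plane :=
  (F.tauGauge i).transHomeomorph (swapPlane.trans (Homeomorph.addRight ![-r, 0]))

theorem midCoord_apply (i : ZMod m) (x : Plane) :
    F.midCoord i x = ![F.tau i x - F.l i / 2, 1 - F.gauge x] := by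
  change ![F.tau i x, 1 - F.gauge x - 0 * min (F.tau i x) 0] + ![-(F.l i / 2 : ℝ), 0] = _
  ext k; fin_cases k <;> simp [sub_eq_add_neg]

theorem rayCoord_apply (i : ZMod m) (x : Plane) :
    F.rayCoord r i x = ![F.gauge x - r, F.tau i x] := by
  change ![F.gauge x, F.tau i x] + ![-r, 0] = _
  ext k; fin_cases k <;> simp [sub_eq_add_neg]

/-- A planar coordinate whose values cover a square, and whose domain over that square is
contained in the disc, induces a coordinate of the disc. -/
theorem exists_discCoord (e : OpenPartialHomeomorph Plane Plane) {R : ℝ}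
    (hball : Metric.ball 0 R ⊆ e.target)
    (hsrc : ∀ x ∈ e.source, e x ∈ Metric.ball 0 R → F.gauge x ≤ 2) :
    ∃ h : OpenPartialHomeomorph F.Disc Plane, h.target = Metric.ball 0 R ∧
      (∀ x : F.Disc, x ∈ h.source ↔ (x : Plane) ∈ e.source ∧ e x ∈ Metric.ball 0 R) ∧
      ∀ x ∈ h.source, h x = e x := by
  set e' := (e.symm.restrOpen (Metric.ball 0 R) Metric.isOpen_ball).symm with he'
  have hs : ∀ x, x ∈ e'.source ↔ x ∈ e.source ∧ e x ∈ Metric.ball 0 R := by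
    intro x
    rw [he', OpenPartialHomeomorph.symm_source]
    rfl
  have ht : e'.target = Metric.ball 0 R := inter_eq_right.2 hball
  have hsub : ∀ x ∈ e'.source, F.gauge x ≤ 2 ↔ (fun _ : Plane => True) (e' x) := fun x hx =>
    iff_of_true (hsrc x ((hs x).1 hx).1 ((hs x).1 hx).2) trivial
  let u : Subtype (fun _ : Plane => True) ≃ₜ Plane :=
    { toEquiv := Equiv.subtypeUnivEquiv fun _ => trivial
      continuous_toFun := continuous_subtype_val
      continuous_invFun := continuous_id.subtype_mk _ }
  refine ⟨(e'.restrictSubtype _ _ hsub ⟨0, by rw [gauge_zero]; norm_num⟩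
    ⟨0, trivial⟩).transHomeomorph u, ?_, fun x => hs x, fun x hx => ?_⟩
  · rw [← ht]; rfl
  · exact e'.restrictSubtype_apply _ (fun _ => True) hsub ⟨0, by rw [gauge_zero]; norm_num⟩
      ⟨0, trivial⟩ hx

theorem mem_ball_plane {z : Plane} {R : ℝ} (hR : 0 < R) :
    z ∈ Metric.ball 0 R ↔ (-R < z 0 ∧ z 0 < R) ∧ (-R < z 1 ∧ z 1 < R) := by
  rw [mem_ball_zero_iff, pi_norm_lt_iff hR]
  simp [Fin.forall_fin_two, abs_lt]

theorem exists_midCoord (i : ZMod m) :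
    ∃ h : OpenPartialHomeomorph F.Disc Plane, h.target = Metric.ball 0 (1 / 4) ∧
      (∀ x : F.Disc, x ∈ h.source ↔
        (x : Plane) ∈ F.star i ∧ F.midCoord i x ∈ Metric.ball 0 (1 / 4)) ∧
      ∀ x ∈ h.source, h x = F.midCoord i x := by
  refine F.exists_discCoord (F.midCoord i) ?_ fun x _ hx => ?_
  · intro z hz
    rw [mem_ball_plane (by norm_num)] at hz
    have hl := F.one_le_l i
    have hl' := F.l_real_pos (i - 1)
    change 0 < 1 - (z + -![-(F.l i / 2 : ℝ), 0]) 1 -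
      0 * min ((z + -![-(F.l i / 2 : ℝ), 0]) 0) 0 ∧ _ < (z + -![-(F.l i / 2 : ℝ), 0]) 0 ∧
      (z + -![-(F.l i / 2 : ℝ), 0]) 0 < F.l i * min (1 - (z + -![-(F.l i / 2 : ℝ), 0]) 1 -
      0 * min ((z + -![-(F.l i / 2 : ℝ), 0]) 0) 0) 1
    simp only [Pi.add_apply, Pi.neg_apply, Matrix.cons_val_zero, Matrix.cons_val_one, neg_neg,
      neg_zero, add_zero, zero_mul, sub_zero]
    have hmin : (3 / 4 : ℝ) ≤ min (1 - z 1) 1 := le_min (by linarith [hz.2.2]) (by norm_num)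
    have := mul_le_mul_of_nonneg_left hmin hl'.le
    have := mul_le_mul_of_nonneg_left hmin (F.l_real_pos i).le
    obtain ⟨⟨h1, h2⟩, h3, h4⟩ := hz
    refine ⟨by linarith, ?_, by linarith⟩
    change -((F.l (i - 1) : ℝ) * min (1 - (z + -![-(F.l i / 2 : ℝ), 0]) 1 -
      0 * min ((z + -![-(F.l i / 2 : ℝ), 0]) 0) 0) 1) < _
    simp only [Pi.add_apply, Pi.neg_apply, Matrix.cons_val_zero, Matrix.cons_val_one, neg_neg,
      neg_zero, add_zero, zero_mul, sub_zero]
    linarith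
  · rw [midCoord_apply, mem_ball_plane (by norm_num)] at hx
    simp only [Matrix.cons_val_zero, Matrix.cons_val_one] at hx
    linarith [hx.2.1]

theorem exists_rayCoord {r : ℝ} (hr : r = 1 / 2 ∨ r = 3 / 2) (i : ZMod m) :
    ∃ h : OpenPartialHomeomorph F.Disc Plane, h.target = Metric.ball 0 (1 / 4) ∧
      (∀ x : F.Disc, x ∈ h.source ↔
        (x : Plane) ∈ F.star i ∧ F.rayCoord r i x ∈ Metric.ball 0 (1 / 4)) ∧
      ∀ x ∈ h.source, h x = F.rayCoord r i x := by
  have hr0 : 1 / 2 ≤ r := by rcases hr with rfl | rfl <;> norm_num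
  have hr1 : r ≤ 3 / 2 := by rcases hr with rfl | rfl <;> norm_num
  refine F.exists_discCoord (F.rayCoord r i) ?_ fun x _ hx => ?_
  · intro z hz
    rw [mem_ball_plane (by norm_num)] at hz
    have hl := F.one_le_l i
    have hl' := F.one_le_l (i - 1)
    have e0 : (z + -![-r, 0]) 0 = z 0 + r := by simp
    have e1 : (z + -![-r, 0]) 1 = z 1 := by simp
    change 0 < (z + -![-r, 0]) 0 ∧ -((F.l (i - 1) : ℝ) * min ((z + -![-r, 0]) 0) 1) <
      (z + -![-r, 0]) 1 ∧ (z + -![-r, 0]) 1 < F.l i * min ((z + -![-r, 0]) 0) 1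
    rw [e0, e1]
    obtain ⟨⟨h1, h2⟩, h3, h4⟩ := hz
    have hmin : (1 / 4 : ℝ) ≤ min (z 0 + r) 1 := le_min (by linarith) (by norm_num)
    have := mul_le_mul hl' hmin (by norm_num) (by linarith)
    have := mul_le_mul hl hmin (by norm_num) (by linarith)
    refine ⟨by linarith, by linarith, by linarith⟩
  · rw [rayCoord_apply, mem_ball_plane (by norm_num)] at hx
    simp only [Matrix.cons_val_zero, Matrix.cons_val_one] at hx
    linarith [hx.1.2]

theorem midPt_mem_coord (i : ZMod m) :
    F.mid i ∈ F.star i ∧ F.midCoord i (F.mid i) = 0 := by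
  refine ⟨(F.mid_mem_star i).1, ?_⟩
  rw [midCoord_apply, tau_mid, gauge_mid]
  simp

theorem rayPt_mem_coord (hr0 : 0 < r) (i : ZMod m) :
    F.ray r i ∈ F.star i ∧ F.rayCoord r i (F.ray r i) = 0 := by
  refine ⟨F.ray_mem_star hr0 i, ?_⟩
  rw [rayCoord_apply, tau_ray, gauge_ray F hr0]
  simp

/-- The disc with its integral affine structure, singular at the midpoints of the edges and at
gauge `r` on the rays. -/
noncomputable abbrev surface : IntegralAffineSurface where
  carrier := F.Disc
  t2 := inferInstance
  second_countable := inferInstance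
  sing := F.singular hr
  chart_at_sing := by
    intro p hp
    rcases (F.mem_singular hr).1 hp with ⟨i, rfl⟩ | ⟨i, rfl⟩
    · obtain ⟨h, -, hs, -⟩ := F.exists_midCoord i
      refine ⟨h, (hs _).2 ⟨(F.midPt_mem_coord i).1, ?_⟩⟩
      rw [midPt, (F.midPt_mem_coord i).2]
      exact Metric.mem_ball_self (by norm_num)
    · have hr0 : 0 < r := by rcases hr with rfl | rfl <;> norm_num
      obtain ⟨h, -, hs, -⟩ := F.exists_rayCoord hr i
      refine ⟨h, (hs _).2 ⟨(F.rayPt_mem_coord hr0 i).1, ?_⟩⟩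
      rw [rayPt, (F.rayPt_mem_coord hr0 i).2]
      exact Metric.mem_ball_self (by norm_num)
  atlas := Set.range (F.chart r)
  atlas_avoids := by
    rintro _ ⟨a, rfl⟩ p hp hps
    exact F.notMem_chartDom_of_mem_singular hr hp a (F.mem_chart_source.1 hps)
  atlas_covers := by
    intro x hx
    obtain ⟨a, ha⟩ := F.exists_mem_chartDom_of_notMem_singular hr hx
    exact ⟨_, ⟨a, rfl⟩, F.mem_chart_source.2 ha⟩
  atlas_compatible := by
    rintro _ ⟨a, rfl⟩ _ ⟨b, rfl⟩ x hxa hxb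
    rw [mem_chart_source] at hxa hxb
    obtain ⟨M, c, h⟩ := affRel_chartFun hxa hxb
    refine ⟨M, c, ?_⟩
    filter_upwards [continuous_subtype_val.continuousAt.eventually h, F.eventually_chart hxa,
      F.eventually_chart hxb] with y h1 h2 h3
    rw [h3, h1, h2]

theorem isAffineAt_surface {x : F.Disc} {a : Option (ZMod m × Bool)}
    (hx : (x : Plane) ∈ F.chartDom r a) {f : Plane → Plane}
    (h : AffRel (𝓝 (x : Plane)) (F.chartFun a) f) :
    (F.surface hr).IsAffineAt (fun y : F.Disc => f y) x := by
  obtain ⟨M, b, h⟩ := h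
  refine ⟨F.chart r a, ⟨a, rfl⟩, F.mem_chart_source.2 hx, M, b, ?_⟩
  refine ((continuous_subtype_val.continuousAt.eventually h).and (F.eventually_chart hx)).mono ?_
  rintro y ⟨h1, h2⟩
  exact h1.trans (congrArg _ h2.symm)

/-- The normal form `IntegralAffineSurface.hasMultiplicity_of_shear` for functions on the plane. -/
theorem hasMultiplicity_surface {p : F.Disc} (hp : p ∈ F.singular hr)
    {h : OpenPartialHomeomorph F.Disc Plane} {R : ℝ} (hR : 0 < R)
    (htarget : h.target = Metric.ball 0 R) (hps : p ∈ h.source) (hp0 : h p = 0)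
    (honly : ∀ q ∈ h.source, q ∈ F.singular hr → q = p) {G₁ G₂ : Plane → Plane} {k : ℤ}
    (b : LatticeVec) (q : Plane)
    (hG₁ : ∀ x ∈ h.source, (h x 1 ≠ 0 ∨ 0 < h x 0) →
      ∃ a, (x : Plane) ∈ F.chartDom r a ∧ AffRel (𝓝 (x : Plane)) (F.chartFun a) G₁)
    (hG₂ : ∀ x ∈ h.source, (h x 1 ≠ 0 ∨ h x 0 < 0) →
      ∃ a, (x : Plane) ∈ F.chartDom r a ∧ AffRel (𝓝 (x : Plane)) (F.chartFun a) G₂)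
    (hup : ∀ x ∈ h.source, 0 < h x 1 → G₂ x = G₁ x)
    (hdown : ∀ x ∈ h.source, h x 1 < 0 →
      G₂ x = intAff (IntegralAffineSurface.shear k) b (G₁ x))
    (horient : ∀ x ∈ h.source, 0 < h x 1 → G₁ x = h x + q) :
    (F.surface hr).HasMultiplicity p k :=
  IntegralAffineSurface.hasMultiplicity_of_shear (B := F.surface hr) hp hR htarget hps hp0 honly
    (G₁ := fun y : F.Disc => G₁ y) (G₂ := fun y : F.Disc => G₂ y)
    (fun x hx hc => by
      obtain ⟨a, h1, h2⟩ := hG₁ x hx hc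
      exact F.isAffineAt_surface hr h1 h2)
    (fun x hx hc => by
      obtain ⟨a, h1, h2⟩ := hG₂ x hx hc
      exact F.isAffineAt_surface hr h1 h2)
    hup hdown horient

/-- The shear between the outer charts at `i` and `i + 1` inside of the polygon is the monodromy
at the midpoint of the edge; these charts extend over either half of the edge. -/
theorem hasMultiplicity_midPt (i : ZMod m) :
    (F.surface hr).HasMultiplicity (F.midPt i) (F.l i) := by
  obtain ⟨h, htarget, hsrc, hh⟩ := F.exists_midCoord i
  have hps : F.midPt i ∈ h.source := by
    refine (hsrc _).2 ⟨(F.midPt_mem_coord i).1, ?_⟩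
    rw [midPt, (F.midPt_mem_coord i).2]
    exact Metric.mem_ball_self (by norm_num)
  have hl := F.one_le_l i
  have hl' := F.l_real_pos (i - 1)
  have hl'' := F.l_real_pos (i + 1)
  have hval : ∀ x ∈ h.source, h x = ![F.tau i x - F.l i / 2, 1 - F.gauge x] := fun x hx => by
    rw [hh x hx, midCoord_apply]
  have hbd : ∀ x ∈ h.source, (x : Plane) ∈ F.star i ∧ 0 < F.tau i x := by
    intro x hx
    obtain ⟨h1, h2⟩ := (hsrc x).1 hx
    rw [midCoord_apply, mem_ball_plane (by norm_num)] at h2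
    simp only [Matrix.cons_val_zero, Matrix.cons_val_one] at h2
    exact ⟨h1, by linarith [h2.1.1]⟩
  refine F.hasMultiplicity_surface hr (h := h)
    (R := 1 / 4) ((F.mem_singular hr).2 (Or.inl ⟨i, rfl⟩)) (by norm_num) htarget hps ?_ ?_
    (G₁ := fun y => ![F.tau (i + 1) y + F.l i * F.gauge y, -F.gauge y])
    (G₂ := fun y => ![F.tau i y, -F.gauge y])
    ![F.l i, 0] ![F.l i / 2, -1] ?_ ?_ ?_ ?_ ?_
  · rw [hh _ hps]; exact (F.midPt_mem_coord i).2
  · intro q hq hqs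
    obtain ⟨hs, ht⟩ := hbd q hq
    rcases (F.mem_singular hr).1 hqs with ⟨j, rfl⟩ | ⟨j, rfl⟩
    · rcases F.eq_or_eq_of_mid_mem_star hs with rfl | rfl
      · rfl
      · exfalso
        change 0 < F.tau (j + 1) (F.mid j) at ht
        rw [tau_succ_mid] at ht
        have := F.l_real_pos j
        linarith
    · exfalso
      have hr0 : 0 < r := by rcases hr with rfl | rfl <;> norm_num
      obtain rfl := F.eq_of_ray_mem_star hr0 hs
      exact ht.ne' (F.tau_ray _)
  · intro x hx hc
    obtain ⟨hs, ht⟩ := hbd x hx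
    rw [hval x hx] at hc
    simp only [Matrix.cons_val_zero, Matrix.cons_val_one] at hc
    have hcone := star_right hs (F.tau_pos_iff.1 ht).le
    have hts := F.tau_neg_iff.2 hcone.2
    refine ⟨some (i + 1, true), ⟨mem_star_of_left hcone.2.le
        (by rw [add_sub_cancel_right]; exact F.tau_pos_iff.1 ht), ?_, Or.inr hts.ne⟩,
      AffRel.of_coeff 1 (-F.l i) 0 1 (2 * F.l i) (-2) (by ring)
        (Eventually.of_forall fun y => ?_)⟩
    · by_cases hg : F.gauge x = 1
      · have := hc.resolve_left (not_not.2 (by rw [hg, sub_self]))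
        have hsucc := F.tau_succ hcone.1
        rw [hg, min_self, mul_one] at hsucc
        exact Or.inr ⟨by rw [add_sub_cancel_right]; linarith, by linarith⟩
      · exact Or.inl hg
    · constructor <;> simp [chartFun] <;> ring
  · intro x hx hc
    obtain ⟨hs, ht⟩ := hbd x hx
    rw [hval x hx] at hc
    simp only [Matrix.cons_val_zero, Matrix.cons_val_one] at hc
    refine ⟨some (i, true), ⟨hs, ?_, Or.inr ht.ne'⟩,
      AffRel.of_coeff 1 0 0 1 0 (-2) (by ring) (Eventually.of_forall fun y => ?_)⟩
    · by_cases hg : F.gauge x = 1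
      · have := hc.resolve_left (not_not.2 (by rw [hg, sub_self]))
        exact Or.inr ⟨by linarith, by linarith⟩
      · exact Or.inl hg
    · simp [chartFun]; ring
  · intro x hx hpos
    obtain ⟨hs, ht⟩ := hbd x hx
    rw [hval x hx] at hpos
    have hpos' : 0 < 1 - F.gauge x := hpos
    have hsucc := F.tau_succ (star_right hs (F.tau_pos_iff.1 ht).le).1
    rw [min_eq_left (by linarith)] at hsucc
    simp [hsucc]
  · intro x hx hneg
    obtain ⟨hs, ht⟩ := hbd x hx
    rw [hval x hx] at hneg
    have hneg' : 1 - F.gauge x < 0 := hneg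
    have hsucc := F.tau_succ (star_right hs (F.tau_pos_iff.1 ht).le).1
    rw [min_eq_right (by linarith)] at hsucc
    rw [intAff_apply]
    ext k
    fin_cases k <;> simp [hsucc, IntegralAffineSurface.shear]
  · intro x hx hpos
    obtain ⟨hs, ht⟩ := hbd x hx
    rw [hval x hx] at hpos ⊢
    have hpos' : 0 < 1 - F.gauge x := hpos
    have hsucc := F.tau_succ (star_right hs (F.tau_pos_iff.1 ht).le).1
    rw [min_eq_left (by linarith)] at hsucc
    ext k
    fin_cases k <;> simp [hsucc]; ring

/-- The shear between the inner and the outer chart at the `i`-th ray is the monodromy at its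
singular point; these charts extend over the two parts of the ray. -/
theorem hasMultiplicity_rayPt (i : ZMod m) :
    (F.surface hr).HasMultiplicity (F.rayPt hr i) (F.c i) := by
  have hr0 : 0 < r := by rcases hr with rfl | rfl <;> norm_num
  obtain ⟨h, htarget, hsrc, hh⟩ := F.exists_rayCoord hr i
  have hps : F.rayPt hr i ∈ h.source := by
    refine (hsrc _).2 ⟨(F.rayPt_mem_coord hr0 i).1, ?_⟩
    rw [rayPt, (F.rayPt_mem_coord hr0 i).2]
    exact Metric.mem_ball_self (by norm_num)
  have hval : ∀ x ∈ h.source, h x = ![F.gauge x - r, F.tau i x] := fun x hx => by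
    rw [hh x hx, rayCoord_apply]
  have hbd : ∀ x ∈ h.source, (x : Plane) ∈ F.star i ∧ F.gauge x ≠ 1 ∧ F.gauge x < 2 := by
    intro x hx
    obtain ⟨h1, h2⟩ := (hsrc x).1 hx
    rw [rayCoord_apply, mem_ball_plane (by norm_num)] at h2
    simp only [Matrix.cons_val_zero, Matrix.cons_val_one] at h2
    refine ⟨h1, fun h => ?_, ?_⟩
    · rw [h] at h2
      rcases hr with rfl | rfl <;> norm_num at h2
    · rcases hr with rfl | rfl <;> linarith [h2.1.2]
  refine F.hasMultiplicity_surface hr (h := h)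
    (R := 1 / 4) ((F.mem_singular hr).2 (Or.inr ⟨i, rfl⟩)) (by norm_num) htarget hps ?_ ?_
    (G₁ := fun y => ![F.gauge y, F.tau i y])
    (G₂ := fun y => ![F.gauge y + F.c i * min (F.tau i y) 0, F.tau i y])
    0 ![r, 0] ?_ ?_ ?_ ?_ ?_
  · rw [hh _ hps]; exact (F.rayPt_mem_coord hr0 i).2
  · intro q hq hqs
    obtain ⟨hs, hg, -⟩ := hbd q hq
    rcases (F.mem_singular hr).1 hqs with ⟨j, rfl⟩ | ⟨j, rfl⟩
    · exact absurd (F.gauge_mid j) hg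
    · rw [F.eq_of_ray_mem_star hr0 hs]
  · intro x hx hc
    obtain ⟨hs, hg, hg2⟩ := hbd x hx
    rw [hval x hx] at hc
    simp only [Matrix.cons_val_zero, Matrix.cons_val_one, sub_pos] at hc
    refine ⟨some (i, true), ⟨hs, Or.inl hg, hc.symm⟩,
      AffRel.of_coeff 0 (-1) 1 0 2 0 (by ring) (Eventually.of_forall fun y => ?_)⟩
    simp [chartFun]
  · intro x hx hc
    obtain ⟨hs, hg, hg2⟩ := hbd x hx
    rw [hval x hx] at hc
    simp only [Matrix.cons_val_zero, Matrix.cons_val_one, sub_neg] at hc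
    refine ⟨some (i, false), ⟨hs, Or.inl hg, hc.symm, hg2⟩,
      AffRel.of_coeff 0 (-1) 1 0 (F.shift i) 0 (by ring) (Eventually.of_forall fun y => ?_)⟩
    simp [chartFun]; ring
  · intro x hx hpos
    rw [hval x hx] at hpos
    have hpos' : 0 < F.tau i x := hpos
    simp [min_eq_right hpos'.le]
  · intro x hx hneg
    rw [hval x hx] at hneg
    have hneg' : F.tau i x < 0 := hneg
    rw [intAff_apply]
    ext k
    fin_cases k <;> simp [min_eq_left hneg'.le, IntegralAffineSurface.shear]
  · intro x hx hpos
    rw [hval x hx]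
    ext k
    fin_cases k <;> simp

end ReflexiveFan

/-! ### The boundary and the disc -/

namespace ReflexiveFan

variable {m : ℕ} [NeZero m] (F : ReflexiveFan m)

section boundary

variable {r : ℝ} (hr : r = 1 / 2 ∨ r = 3 / 2)

theorem notMem_singular_of_gauge {x : F.Disc} (h1 : F.gauge x ≠ 1) (h2 : F.gauge x ≠ r) :
    x ∉ F.singular hr := by
  have hr0 : 0 < r := by rcases hr with rfl | rfl <;> norm_num
  intro h
  rcases (F.mem_singular hr).1 h with ⟨i, rfl⟩ | ⟨i, rfl⟩
  · exact h1 (F.gauge_mid i)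
  · exact h2 (F.gauge_ray hr0 i)

theorem mem_boundary_iff {x : F.Disc} : x ∈ (F.surface hr).boundary ↔ F.gauge x = 2 := by
  have hr2 : r < 2 := by rcases hr with rfl | rfl <;> norm_num
  constructor
  · rintro ⟨_, ⟨a, rfl⟩, hx, h0⟩
    have hx' := F.mem_chart_source.1 hx
    have h1 : F.chartFun a x 1 = 0 := by rw [← F.chart_apply hx']; exact h0
    rcases a with _ | ⟨i, _ | _⟩
    · exact absurd h1 (chartFun_central_pos (lt_of_lt_of_le hx' (min_le_right _ _)).le).ne'
    · exact absurd h1 (chartFun_inner_pos hx'.1 hx'.2.2.2).ne'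
    · have : 2 - F.gauge x = 0 := h1
      linarith
  · intro h
    have hns : x ∉ F.singular hr :=
      F.notMem_singular_of_gauge hr (by rw [h]; norm_num) (by rw [h]; exact hr2.ne')
    obtain ⟨a, ha⟩ := F.exists_mem_chartDom_of_notMem_singular hr hns
    refine ⟨_, ⟨a, rfl⟩, F.mem_chart_source.2 ha, ?_⟩
    have e := F.chart_apply ha
    refine (congrFun e 1).trans ?_
    rcases a with _ | ⟨i, _ | _⟩
    · have h1 : F.gauge x < 1 := lt_of_lt_of_le ha (min_le_right _ _)
      linarith
    · exact absurd h ha.2.2.2.ne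
    · change 2 - F.gauge x = 0
      linarith

end boundary

/-- A multiple of the gauge bounds the norm, so that the sublevel sets of the gauge are bounded. -/
theorem exists_norm_le_gauge : ∃ M : ℝ, 0 < M ∧ ∀ x : Plane, ‖x‖ ≤ M * F.gauge x := by
  have hnn : ∀ k, 0 ≤ ∑ j, (|(F.v j k : ℝ)| + F.l j * |(F.u j k : ℝ)|) := fun k =>
    Finset.sum_nonneg fun j _ => by positivity
  refine ⟨1 + ∑ k, ∑ j, (|(F.v j k : ℝ)| + F.l j * |(F.u j k : ℝ)|),
    add_pos_of_pos_of_nonneg one_pos (Finset.sum_nonneg fun k _ => hnn k), fun x => ?_⟩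
  have h0 := F.gauge_nonneg x
  refine (pi_norm_le_iff_of_nonneg (by
    have := Finset.sum_nonneg fun k (_ : k ∈ Finset.univ) => hnn k
    positivity)).2 fun k => ?_
  rw [Real.norm_eq_abs]
  have h1 := F.abs_coord_le x k
  have h2 := Finset.single_le_sum (f := fun k => ∑ j, (|(F.v j k : ℝ)| + F.l j * |(F.u j k : ℝ)|))
    (fun k _ => hnn k) (Finset.mem_univ k)
  have h3 := mul_le_mul_of_nonneg_left h2 h0
  linarith

/-- The radial homeomorphism from the Euclidean plane that takes the norm to the gauge. -/
noncomputable def radial : EuclideanSpace ℝ (Fin 2) ≃ₜ Plane where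
  toFun := fun y => (‖y‖ / F.gauge y.ofLp) • y.ofLp
  invFun := fun x => (F.gauge x / ‖WithLp.toLp 2 x‖) • WithLp.toLp 2 x
  left_inv := fun y => by
    by_cases hy : y = 0
    · subst hy; simp
    have hy' : y.ofLp ≠ 0 := fun h => hy (by ext k; exact congrFun h k)
    have hg := F.gauge_pos hy'
    have hn : 0 < ‖y‖ := norm_pos_iff.2 hy
    have e : WithLp.toLp 2 ((‖y‖ / F.gauge y.ofLp) • y.ofLp) = (‖y‖ / F.gauge y.ofLp) • y := rfl
    simp only [e]
    rw [F.gauge_smul _ (by positivity), norm_smul, smul_smul,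
      Real.norm_of_nonneg (by positivity : 0 ≤ ‖y‖ / F.gauge y.ofLp)]
    have : ‖y‖ / F.gauge y.ofLp * F.gauge y.ofLp / (‖y‖ / F.gauge y.ofLp * ‖y‖) *
        (‖y‖ / F.gauge y.ofLp) = 1 := by field_simp
    rw [this, one_smul]
  right_inv := fun x => by
    by_cases hx : x = 0
    · subst hx; simp
    have hx' : WithLp.toLp 2 x ≠ 0 := fun h => hx (by ext k; exact congrArg (fun z => z k) h)
    have hg := F.gauge_pos hx
    have hn : 0 < ‖WithLp.toLp 2 x‖ := norm_pos_iff.2 hx'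
    have e : ((F.gauge x / ‖WithLp.toLp 2 x‖) • WithLp.toLp 2 x).ofLp =
      (F.gauge x / ‖WithLp.toLp 2 x‖) • x := rfl
    simp only [e]
    rw [F.gauge_smul _ (by positivity), norm_smul, smul_smul,
      Real.norm_of_nonneg (by positivity : 0 ≤ F.gauge x / ‖WithLp.toLp 2 x‖)]
    have : F.gauge x / ‖WithLp.toLp 2 x‖ * ‖WithLp.toLp 2 x‖ /
        (F.gauge x / ‖WithLp.toLp 2 x‖ * F.gauge x) *
        (F.gauge x / ‖WithLp.toLp 2 x‖) = 1 := by field_simp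
    rw [this, one_smul]
  continuous_toFun := by
    have hc : Continuous fun y : EuclideanSpace ℝ (Fin 2) => y.ofLp := PiLp.continuous_ofLp 2 _
    refine continuous_iff_continuousAt.2 fun y => ?_
    by_cases hy : y = 0
    · subst hy
      obtain ⟨M, hM, hle⟩ := F.exists_norm_le_gauge
      have h0 : Tendsto (fun y : EuclideanSpace ℝ (Fin 2) => M * ‖y‖) (𝓝 0) (𝓝 0) := by
        have : Continuous fun y : EuclideanSpace ℝ (Fin 2) => M * ‖y‖ := by fun_prop
        simpa using this.tendsto 0
      have : ((‖(0 : EuclideanSpace ℝ (Fin 2))‖ / F.gauge (0 : EuclideanSpace ℝ (Fin 2)).ofLp) •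
        (0 : EuclideanSpace ℝ (Fin 2)).ofLp : Plane) = 0 := by simp
      rw [ContinuousAt, this]
      refine squeeze_zero_norm (fun y => ?_) h0
      refine (hle _).trans (mul_le_mul_of_nonneg_left ?_ hM.le)
      rw [F.gauge_smul _ (div_nonneg (norm_nonneg _) (F.gauge_nonneg _))]
      by_cases hg : F.gauge y.ofLp = 0
      · rw [hg]; simp
      · rw [div_mul_cancel₀ _ hg]
    · have hy' : y.ofLp ≠ 0 := fun h => hy (by ext k; exact congrFun h k)
      exact (continuous_norm.continuousAt.div (F.continuous_gauge.comp hc).continuousAt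
        (F.gauge_pos hy').ne').smul hc.continuousAt
  continuous_invFun := by
    have hc : Continuous fun x : Plane => WithLp.toLp 2 x := PiLp.continuous_toLp 2 _
    refine continuous_iff_continuousAt.2 fun x => ?_
    by_cases hx : x = 0
    · subst hx
      have h0 : Tendsto F.gauge (𝓝 0) (𝓝 0) := by
        simpa [F.gauge_zero] using F.continuous_gauge.tendsto 0
      have : ((F.gauge 0 / ‖WithLp.toLp 2 (0 : Plane)‖) • WithLp.toLp 2 (0 : Plane)) = 0 := by
        simp
      rw [ContinuousAt, this]
      refine squeeze_zero_norm (fun x => ?_) h0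
      have hg := F.gauge_nonneg x
      rw [norm_smul, Real.norm_of_nonneg (div_nonneg hg (norm_nonneg _))]
      by_cases h : ‖WithLp.toLp 2 x‖ = 0
      · rw [h]; simpa using hg
      · exact (div_mul_cancel₀ _ h).le
    · have hx' : WithLp.toLp 2 x ≠ 0 := fun h => hx (by ext k; exact congrArg (fun z => z k) h)
      exact (F.continuous_gauge.continuousAt.div (continuous_norm.comp hc).continuousAt
        (norm_pos_iff.2 hx').ne').smul hc.continuousAt

theorem gauge_radial (y : EuclideanSpace ℝ (Fin 2)) : F.gauge (F.radial y) = ‖y‖ := by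
  change F.gauge ((‖y‖ / F.gauge y.ofLp) • y.ofLp) = ‖y‖
  rw [F.gauge_smul _ (div_nonneg (norm_nonneg _) (F.gauge_nonneg _))]
  by_cases hy : y = 0
  · subst hy; simp
  have hy' : y.ofLp ≠ 0 := fun h => hy (by ext k; exact congrFun h k)
  rw [div_mul_cancel₀ _ (F.gauge_pos hy').ne']

theorem norm_radial_symm (x : Plane) : ‖F.radial.symm x‖ = F.gauge x := by
  rw [← F.gauge_radial, Homeomorph.apply_symm_apply]

section disc

variable {r : ℝ} (hr : r = 1 / 2 ∨ r = 3 / 2)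

theorem isDisc_surface : (F.surface hr).IsDisc := by
  have hnorm : ∀ x : Plane, ‖(1 / 2 : ℝ) • F.radial.symm x‖ = F.gauge x / 2 := by
    intro x
    rw [norm_smul, norm_radial_symm, Real.norm_of_nonneg (by norm_num)]; ring
  let h : Plane ≃ₜ EuclideanSpace ℝ (Fin 2) :=
    F.radial.symm.trans (Homeomorph.smulOfNeZero (1 / 2 : ℝ) (by norm_num))
  have hh : ∀ x, ‖h x‖ = F.gauge x / 2 := hnorm
  let h' : F.Disc ≃ₜ Metric.closedBall (0 : EuclideanSpace ℝ (Fin 2)) 1 :=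
    h.subtype (p := fun x => F.gauge x ≤ 2)
      (q := fun y => y ∈ Metric.closedBall (0 : EuclideanSpace ℝ (Fin 2)) 1) fun x => by
        rw [mem_closedBall_zero_iff, hh]
        constructor <;> intro h <;> linarith
  refine ⟨h', fun x => (F.mem_boundary_iff hr).trans ?_⟩
  change _ ↔ ‖h x.1‖ = 1
  rw [hh]
  constructor <;> intro h
  · rw [h]; norm_num
  · linarith

theorem isOpenDiscBoundedBy_gauge :
    (F.surface hr).IsOpenDiscBoundedBy {x : F.Disc | F.gauge x < 1}
      {x : F.Disc | F.gauge x = 1} := by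
  have hle : ∀ z : Metric.closedBall (0 : EuclideanSpace ℝ (Fin 2)) 1,
      F.gauge (F.radial z) ≤ 1 := fun z => by
    rw [gauge_radial]; exact mem_closedBall_zero_iff.1 z.2
  let f : Metric.closedBall (0 : EuclideanSpace ℝ (Fin 2)) 1 → F.Disc :=
    fun z => ⟨F.radial z, (hle z).trans (by norm_num)⟩
  have hf : ∀ p : ℝ → Prop, (∀ s, p s → s ≤ 1) →
      f '' {z | p ‖(z : EuclideanSpace ℝ (Fin 2))‖} = {x : F.Disc | p (F.gauge x)} := by
    intro p hp
    ext x
    constructor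
    · rintro ⟨z, hz, rfl⟩
      change p (F.gauge (F.radial z))
      rwa [gauge_radial]
    · intro hx
      have hx' : p (F.gauge x) := hx
      refine ⟨⟨F.radial.symm x, ?_⟩, ?_, Subtype.ext ?_⟩
      · rw [mem_closedBall_zero_iff, norm_radial_symm]; exact hp _ hx'
      · change p ‖F.radial.symm x‖
        rwa [norm_radial_symm]
      · exact F.radial.apply_symm_apply _
  refine ⟨isOpen_lt (F.continuous_gauge.comp continuous_subtype_val) continuous_const, ?_, f, ?_,
    hf (· < 1) fun s hs => hs.le, hf (· = 1) fun s hs => hs.le⟩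
  · refine Set.disjoint_left.2 fun x hx hb => ?_
    have h1 := (F.mem_boundary_iff hr).1 hb
    have h2 : F.gauge x < 1 := hx
    rw [h1] at h2
    norm_num at h2
  · have h1 : IsEmbedding (Subtype.val ∘ f) :=
      F.radial.isEmbedding.comp IsEmbedding.subtypeVal
    exact IsEmbedding.of_comp ((F.radial.continuous.comp continuous_subtype_val).subtype_mk _)
      continuous_subtype_val h1

end disc

/-! ### Level circles of the gauge -/

/-- The affine length of the boundary of the polygon from `v 0` to the corner with index `n`,
where the indices continue around the polygon. -/
noncomputable def arc (n : ℤ) : ℤ :=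
  ∑ j ∈ Finset.Ico 0 n, (F.l (j : ZMod m) : ℤ) - ∑ j ∈ Finset.Ico n 0, (F.l (j : ZMod m) : ℤ)

theorem arc_zero : F.arc 0 = 0 := by simp [arc]

theorem arc_succ (n : ℤ) : F.arc (n + 1) = F.arc n + F.l (n : ZMod m) := by
  unfold arc
  rcases le_or_gt 0 n with h | h
  · rw [Finset.Ico_eq_empty_of_le h, Finset.Ico_eq_empty_of_le (show (0 : ℤ) ≤ n + 1 by omega),
      ← Finset.insert_Ico_right_eq_Ico_add_one h,
      Finset.sum_insert (by simp)]
    simp; ring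
  · rw [Finset.Ico_eq_empty_of_le h.le, Finset.Ico_eq_empty_of_le (show n + 1 ≤ (0 : ℤ) by omega),
      ← Finset.insert_Ico_add_one_left_eq_Ico h,
      Finset.sum_insert (by simp)]
    simp

theorem arc_strictMono : StrictMono F.arc :=
  strictMono_int_of_lt_succ fun n => by
    rw [arc_succ]
    have := F.l_pos (n : ZMod m)
    omega

theorem arc_add_period (n : ℤ) : F.arc (n + m) = F.arc n + ∑ i, (F.l i : ℤ) := by
  have h0 : F.arc m = ∑ i, (F.l i : ℤ) := by
    unfold arc
    rw [Finset.Ico_eq_empty_of_le (show (0 : ℤ) ≤ m by omega), Finset.sum_empty, sub_zero]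
    refine Finset.sum_bij (fun j _ => (j : ZMod m)) (fun _ _ => Finset.mem_univ _) ?_ ?_
      (fun _ _ => rfl)
    · intro a ha b hb h
      rw [Finset.mem_Ico] at ha hb
      have := (ZMod.intCast_eq_intCast_iff' a b m).1 h
      rwa [Int.emod_eq_of_lt ha.1 ha.2, Int.emod_eq_of_lt hb.1 hb.2] at this
    · intro i _
      refine ⟨i.val, Finset.mem_Ico.2 ⟨by positivity, by exact_mod_cast ZMod.val_lt i⟩, ?_⟩
      simp
  induction n using Int.induction_on with
  | zero => rw [zero_add, h0, arc_zero, zero_add]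
  | succ n ih =>
    rw [show (n : ℤ) + 1 + m = n + m + 1 by ring, arc_succ, ih, arc_succ]
    simp; ring
  | pred n ih =>
    have h1 := F.arc_succ (-n - 1 + m)
    have h2 := F.arc_succ (-n - 1)
    rw [show -(n : ℤ) - 1 + m + 1 = -n + m by ring, ih] at h1
    rw [sub_add_cancel] at h2
    have e : (((-n - 1 + m : ℤ) : ZMod m)) = ((-n - 1 : ℤ) : ZMod m) := by simp
    rw [e] at h1
    linarith

theorem le_arc {n : ℤ} (hn : 0 ≤ n) : n ≤ F.arc n := by
  induction n, hn using Int.leInduction with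
  | base => rw [arc_zero]
  | succ k _ ih => rw [arc_succ]; have := F.l_pos (k : ZMod m); omega

theorem arc_le {n : ℤ} (hn : n ≤ 0) : F.arc n ≤ n := by
  induction n, hn using Int.leInductionDown with
  | base => rw [arc_zero]
  | pred k _ ih =>
    have := F.arc_succ (k - 1)
    rw [sub_add_cancel] at this
    have := F.l_pos ((k - 1 : ℤ) : ZMod m)
    omega

theorem exists_arc (a : ℝ) : ∃ n : ℤ, (F.arc n : ℝ) ≤ a ∧ a < F.arc (n + 1) := by
  have hbdd : ∃ b : ℤ, ∀ n : ℤ, (F.arc n : ℝ) ≤ a → n ≤ b := by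
    refine ⟨max 0 ⌈a⌉, fun n hn => ?_⟩
    rcases le_total n 0 with h | h
    · exact h.trans (le_max_left _ _)
    · refine le_trans ?_ (le_max_right _ _)
      have : (n : ℝ) ≤ a := le_trans (by exact_mod_cast F.le_arc h) hn
      exact_mod_cast this.trans (Int.le_ceil a)
  have hne : ∃ n : ℤ, (F.arc n : ℝ) ≤ a := by
    refine ⟨min 0 ⌊a⌋, ?_⟩
    have h1 := F.arc_le (min_le_left 0 ⌊a⌋)
    have h2 : F.arc (min 0 ⌊a⌋) ≤ ⌊a⌋ := h1.trans (min_le_right _ _)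
    exact le_trans (by exact_mod_cast h2) (Int.floor_le a)
  obtain ⟨n, hn, hmax⟩ := Int.exists_greatest_of_bdd hbdd hne
  refine ⟨n, hn, not_le.1 fun h => ?_⟩
  have := hmax _ h
  omega

/-- The index of the corner that precedes the boundary point at affine length `a`. -/
noncomputable def arcIndex (a : ℝ) : ℤ := (F.exists_arc a).choose

theorem arcIndex_spec (a : ℝ) :
    (F.arc (F.arcIndex a) : ℝ) ≤ a ∧ a < F.arc (F.arcIndex a + 1) := (F.exists_arc a).choose_spec

theorem arcIndex_eq {a : ℝ} {n : ℤ} (h : (F.arc n : ℝ) ≤ a) (h' : a < F.arc (n + 1)) :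
    F.arcIndex a = n := by
  obtain ⟨h1, h2⟩ := F.arcIndex_spec a
  have h3 : F.arc n < F.arc (F.arcIndex a + 1) := by exact_mod_cast h.trans_lt h2
  have h4 : F.arc (F.arcIndex a) < F.arc (n + 1) := by exact_mod_cast h1.trans_lt h'
  have := F.arc_strictMono.lt_iff_lt.1 h3
  have := F.arc_strictMono.lt_iff_lt.1 h4
  omega

/-- The parametrization of the level curve `gauge = ρ` by affine length, for `1 ≤ ρ`. -/
noncomputable def levelCurve (ρ a : ℝ) : Plane :=
  F.ofTauGauge (F.arcIndex a : ZMod m) (a - F.arc (F.arcIndex a)) ρ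

variable {ρ : ℝ}

theorem ofTauGauge_level (hρ : 1 ≤ ρ) (i : ZMod m) {X : ℝ}
    (h : -(F.l (i - 1) : ℝ) < X) (h' : X < F.l i) :
    F.ofTauGauge i X ρ ∈ F.star i ∧ F.tau i (F.ofTauGauge i X ρ) = X ∧
      F.gauge (F.ofTauGauge i X ρ) = ρ := by
  refine F.ofTauGauge_spec (by linarith) ?_ ?_ <;> rw [min_eq_right hρ, mul_one]
  · exact h
  · exact h'

/-- The parametrization has the same form before and after the corner with index `n`. -/
theorem levelCurve_eq (hρ : 1 ≤ ρ) {a : ℝ} {n : ℤ}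
    (h : (F.arc (n - 1) : ℝ) < a) (h' : a < F.arc (n + 1)) :
    F.levelCurve ρ a = F.ofTauGauge (n : ZMod m) (a - F.arc n) ρ := by
  rcases le_or_gt (F.arc n : ℝ) a with h1 | h1
  · rw [levelCurve, F.arcIndex_eq h1 h']
  · have hidx : F.arcIndex a = n - 1 := F.arcIndex_eq h.le (by rwa [sub_add_cancel])
    have hl := F.l_real_pos ((n - 1 : ℤ) : ZMod m)
    have hl' := F.l_real_pos (((n - 1 : ℤ) : ZMod m) - 1)
    have hs := F.arc_succ (n - 1)
    rw [sub_add_cancel] at hs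
    have hs' : (F.arc n : ℝ) = F.arc (n - 1) + F.l ((n - 1 : ℤ) : ZMod m) := by exact_mod_cast hs
    have hn : ((n - 1 : ℤ) : ZMod m) + 1 = n := by push_cast; ring
    rw [levelCurve, hidx]
    obtain ⟨hst, ht, hg⟩ := F.ofTauGauge_level hρ ((n - 1 : ℤ) : ZMod m)
      (X := a - F.arc (n - 1)) (by linarith) (by linarith)
    generalize F.ofTauGauge ((n - 1 : ℤ) : ZMod m) (a - F.arc (n - 1)) ρ = x at *
    have hb : 0 < F.beta ((n - 1 : ℤ) : ZMod m) x := F.tau_pos_iff.1 (by rw [ht]; linarith)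
    obtain ⟨hc, hb'⟩ := star_right hst hb.le
    have hsucc := F.tau_succ hc
    rw [hg, min_eq_right hρ, mul_one, ht, hn] at hsucc
    rw [hn] at hb'
    have hst' : x ∈ F.star (n : ZMod m) := by
      refine mem_star_of_left hb'.le ?_
      rwa [← hn, add_sub_cancel_right]
    rw [← F.ofTauGauge_tau_gauge hst', hg, hsucc]
    congr 1
    linarith

theorem levelCurve_spec (hρ : 1 ≤ ρ) {a : ℝ} {n : ℤ}
    (h : (F.arc (n - 1) : ℝ) < a) (h' : a < F.arc (n + 1)) :
    F.levelCurve ρ a ∈ F.star (n : ZMod m) ∧ F.tau (n : ZMod m) (F.levelCurve ρ a) = a - F.arc n ∧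
      F.gauge (F.levelCurve ρ a) = ρ := by
  rw [F.levelCurve_eq hρ h h']
  have hs := F.arc_succ (n - 1)
  rw [sub_add_cancel] at hs
  have hs' : (F.arc n : ℝ) = F.arc (n - 1) + F.l ((n - 1 : ℤ) : ZMod m) := by exact_mod_cast hs
  have hs2 : (F.arc (n + 1) : ℝ) = F.arc n + F.l (n : ZMod m) := by exact_mod_cast F.arc_succ n
  rw [Int.cast_sub, Int.cast_one] at hs'
  exact F.ofTauGauge_level hρ _ (by linarith) (by linarith)

theorem levelCurve_range_index (a : ℝ) :
    (F.arc (F.arcIndex a - 1) : ℝ) < a ∧ a < F.arc (F.arcIndex a + 1) := by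
  obtain ⟨h1, h2⟩ := F.arcIndex_spec a
  refine ⟨lt_of_lt_of_le ?_ h1, h2⟩
  exact_mod_cast F.arc_strictMono (by omega)

theorem gauge_levelCurve (hρ : 1 ≤ ρ) (a : ℝ) : F.gauge (F.levelCurve ρ a) = ρ := by
  obtain ⟨h1, h2⟩ := F.levelCurve_range_index a
  exact (F.levelCurve_spec hρ h1 h2).2.2

theorem continuous_levelCurve (hρ : 1 ≤ ρ) : Continuous (F.levelCurve ρ) := by
  refine continuous_iff_continuousAt.2 fun a => ?_
  obtain ⟨h1, h2⟩ := F.levelCurve_range_index a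
  have hc : Continuous fun b : ℝ => F.ofTauGauge (F.arcIndex a : ZMod m)
      (b - F.arc (F.arcIndex a)) ρ := by
    unfold ofTauGauge point; fun_prop
  refine hc.continuousAt.congr ?_
  filter_upwards [eventually_gt_nhds h1, eventually_lt_nhds h2] with b hb hb'
  exact (F.levelCurve_eq hρ hb hb').symm

theorem periodic_levelCurve (ρ : ℝ) :
    Function.Periodic (F.levelCurve ρ) ((∑ i, (F.l i : ℤ) : ℤ) : ℝ) := by
  intro a
  obtain ⟨h1, h2⟩ := F.arcIndex_spec a
  have e1 := F.arc_add_period (F.arcIndex a)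
  have e2 := F.arc_add_period (F.arcIndex a + 1)
  have hidx : F.arcIndex (a + ((∑ i, (F.l i : ℤ) : ℤ) : ℝ)) = F.arcIndex a + m := by
    refine F.arcIndex_eq ?_ ?_
    · rw [e1]; push_cast; linarith
    · rw [show F.arcIndex a + m + 1 = F.arcIndex a + 1 + m by ring, e2]
      push_cast; linarith
  rw [levelCurve, hidx, e1, levelCurve]
  push_cast
  rw [ZMod.natCast_self, add_zero]
  congr 1
  ring

theorem levelCurve_sector (hρ : 1 ≤ ρ) (a : ℝ) :
    0 ≤ F.beta (F.arcIndex a : ZMod m) (F.levelCurve ρ a) ∧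
      F.beta ((F.arcIndex a : ZMod m) + 1) (F.levelCurve ρ a) < 0 := by
  obtain ⟨h1, h2⟩ := F.levelCurve_range_index a
  obtain ⟨h3, h4, -⟩ := F.levelCurve_spec hρ h1 h2
  have : 0 ≤ F.beta (F.arcIndex a : ZMod m) (F.levelCurve ρ a) :=
    F.tau_nonneg_iff.1 (by rw [h4]; linarith [(F.arcIndex_spec a).1])
  exact ⟨this, (star_right h3 this).2⟩

theorem injOn_levelCurve (hρ : 1 ≤ ρ) :
    Set.InjOn (F.levelCurve ρ) (Set.Ico 0 ((∑ i, (F.l i : ℤ) : ℤ) : ℝ)) := by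
  have bound : ∀ a ∈ Set.Ico (0 : ℝ) ((∑ i, (F.l i : ℤ) : ℤ) : ℝ),
      0 ≤ F.arcIndex a ∧ F.arcIndex a < m := by
    rintro a ⟨h0, h1⟩
    obtain ⟨h2, h3⟩ := F.arcIndex_spec a
    have e := F.arc_add_period 0
    rw [arc_zero, zero_add, zero_add] at e
    constructor
    · have : F.arc 0 < F.arc (F.arcIndex a + 1) := by
        rw [arc_zero]; exact_mod_cast h0.trans_lt h3
      have := F.arc_strictMono.lt_iff_lt.1 this
      omega
    · refine F.arc_strictMono.lt_iff_lt.1 ?_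
      rw [e]
      exact_mod_cast h2.trans_lt h1
  intro a ha b hb hab
  have hx : F.levelCurve ρ a ≠ 0 := F.ne_zero_of_gauge_pos (by rw [F.gauge_levelCurve hρ]; linarith)
  have h1 := F.levelCurve_sector hρ a
  have h2 := F.levelCurve_sector hρ b
  rw [← hab] at h2
  have h3 := eq_of_mem_sector hx h1 h2
  have h4 := (ZMod.intCast_eq_intCast_iff' _ _ m).1 h3
  have ba := bound a ha
  have bb := bound b hb
  rw [Int.emod_eq_of_lt ba.1 ba.2, Int.emod_eq_of_lt bb.1 bb.2] at h4
  obtain ⟨c1, c2⟩ := F.levelCurve_range_index a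
  obtain ⟨d1, d2⟩ := F.levelCurve_range_index b
  have e1 := (F.levelCurve_spec hρ c1 c2).2.1
  have e2 := (F.levelCurve_spec hρ d1 d2).2.1
  rw [← h4, ← hab, e1] at e2
  linarith

theorem exists_levelCurve_eq (hρ : 1 ≤ ρ) {x : Plane} (hx : F.gauge x = ρ) :
    ∃ n : ℤ, 0 ≤ n ∧ n < m ∧ 0 ≤ F.tau (n : ZMod m) x ∧ F.tau (n : ZMod m) x < F.l (n : ZMod m) ∧
      F.levelCurve ρ (F.arc n + F.tau (n : ZMod m) x) = x := by
  have hx0 : x ≠ 0 := F.ne_zero_of_gauge_pos (by rw [hx]; linarith)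
  obtain ⟨i, ⟨h1, h2⟩, -⟩ := F.existsUnique_sector hx0
  have hi : (((i.val : ℕ) : ℤ) : ZMod m) = i := by simp
  have hs : x ∈ F.star i := mem_star_of_right h1 h2
  have ht := F.tau_nonneg_iff.2 h1
  have ht' := (tau_bounds_of_mem_star hs).2
  refine ⟨(i.val : ℕ), by positivity, by exact_mod_cast ZMod.val_lt i, ?_⟩
  rw [hi]
  refine ⟨ht, ht', ?_⟩
  have hsucc : (F.arc ((i.val : ℕ) + 1) : ℝ) = F.arc (i.val : ℕ) + F.l i := by
    have := F.arc_succ (i.val : ℕ)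
    rw [hi] at this
    exact_mod_cast this
  rw [levelCurve, F.arcIndex_eq (n := (i.val : ℕ)) (by linarith) (by linarith), hi,
    add_sub_cancel_left, ← hx, F.ofTauGauge_tau_gauge hs]

/-- The level curves of the gauge on and outside of the boundary of the polygon are horizontal
lines in the outer charts, so they are affine circles as soon as they avoid the inner part of the
rays. -/
theorem isAffineCircle_gauge (hρ : 1 ≤ ρ) {r : ℝ} (hr : r = 1 / 2 ∨ r = 3 / 2) (hrρ : r < ρ)
    (hρ2 : ρ ≤ 2) :
    (F.surface hr).IsAffineCircle {x : F.Disc | F.gauge x = ρ} ((∑ i, (F.l i : ℤ) : ℤ) : ℝ) := by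
  have hLpos : (0 : ℝ) < ((∑ i, (F.l i : ℤ) : ℤ) : ℝ) := by
    have : (0 : ℤ) < ∑ i, (F.l i : ℤ) :=
      Finset.sum_pos (fun i _ => by exact_mod_cast F.l_pos i) Finset.univ_nonempty
    exact_mod_cast this
  let γ : ℝ → F.Disc := fun a => ⟨F.levelCurve ρ a, by rw [F.gauge_levelCurve hρ]; exact hρ2⟩
  have hγc : Continuous γ := (F.continuous_levelCurve hρ).subtype_mk _
  refine ⟨hLpos, γ, hγc, fun a => Subtype.ext (F.periodic_levelCurve ρ a),
    fun a ha b hb hab => F.injOn_levelCurve hρ ha hb (congrArg Subtype.val hab), ?_, ?_⟩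
  · ext x
    constructor
    · rintro ⟨a, rfl⟩; exact F.gauge_levelCurve hρ a
    · intro hx
      obtain ⟨n, -, -, -, -, h⟩ := F.exists_levelCurve_eq hρ hx
      exact ⟨_, Subtype.ext h⟩
  · rintro t _ ⟨c, rfl⟩ ht
    have hct : F.levelCurve ρ t ∈ F.chartDom r c := F.mem_chart_source.1 ht
    -- an outer chart at a corner next to the point
    obtain ⟨n, hn1, hn2, hdom⟩ : ∃ n : ℤ, (F.arc (n - 1) : ℝ) < t ∧ t < F.arc (n + 1) ∧
        F.levelCurve ρ t ∈ F.chartDom r (some ((n : ZMod m), true)) := by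
      obtain ⟨h1, h2⟩ := F.levelCurve_range_index t
      obtain ⟨hst, htau, hg⟩ := F.levelCurve_spec hρ h1 h2
      have h3 := (F.arcIndex_spec t).1
      set n := F.arcIndex t
      have hl := F.l_real_pos (n : ZMod m)
      have hl' := F.l_real_pos ((n : ZMod m) - 1)
      by_cases hfar : ρ = 1 ∧ (F.l (n : ZMod m) / 2 : ℝ) ≤ t - F.arc n
      · obtain ⟨h4, h5⟩ := hfar
        have h6 : (F.l (n : ZMod m) / 2 : ℝ) < t - F.arc n := by
          refine lt_of_le_of_ne h5 fun h => F.mid_notMem_chartDom (r := r) (n : ZMod m) c ?_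
          have : F.levelCurve ρ t = F.mid (n : ZMod m) :=
            F.eq_of_tau_gauge hst (F.mid_mem_star _).1 (by rw [htau, tau_mid, h])
              (by rw [hg, h4, gauge_mid])
          rwa [← this]
        have h7 : t < F.arc (n + 1 + 1) :=
          h2.trans (by exact_mod_cast F.arc_strictMono (by omega : n + 1 < n + 1 + 1))
        have h8 : (F.arc (n + 1 - 1) : ℝ) < t := by
          rw [add_sub_cancel_right]; linarith
        obtain ⟨hst', htau', -⟩ := F.levelCurve_spec hρ h8 h7
        refine ⟨n + 1, h8, h7, hst', Or.inr ?_, Or.inl (by rw [hg]; exact hrρ)⟩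
        rw [htau']
        have h9 : (F.arc (n + 1) : ℝ) = F.arc n + F.l (n : ZMod m) := by
          exact_mod_cast F.arc_succ n
        have h10 : (((n + 1 : ℤ) : ZMod m) - 1) = n := by push_cast; ring
        rw [h10]
        have := F.l_real_pos ((n + 1 : ℤ) : ZMod m)
        constructor <;> linarith
      · refine ⟨n, h1, h2, hst, ?_, Or.inl (by rw [hg]; exact hrρ)⟩
        by_cases h4 : ρ = 1
        · refine Or.inr ⟨?_, ?_⟩
          · rw [htau]; linarith
          · rw [htau]; exact not_le.1 fun h => hfar ⟨h4, h⟩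
        · exact Or.inl (by rwa [hg])
    obtain ⟨M, b, hM⟩ := affRel_chartFun hdom hct
    have hval : ∀ᶠ s in 𝓝 (0 : ℝ), F.chartFun (some ((n : ZMod m), true)) (F.levelCurve ρ (t + s)) =
        ![t + s - F.arc n, 2 - ρ] := by
      have hc : Tendsto (fun s : ℝ => t + s) (𝓝 0) (𝓝 t) := by
        have : Continuous fun s : ℝ => t + s := by fun_prop
        simpa using this.tendsto 0
      filter_upwards [hc.eventually_const_lt hn1, hc.eventually_lt_const hn2] with s hs hs'
      obtain ⟨-, h1, h2⟩ := F.levelCurve_spec hρ hs hs'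
      change ![_, 2 - F.gauge _] = _
      rw [h1, h2]
    have hγt : Tendsto (fun s : ℝ => γ (t + s)) (𝓝 0) (𝓝 (γ t)) := by
      have : Continuous fun s : ℝ => γ (t + s) := by fun_prop
      simpa using this.tendsto 0
    have hchart := hγt.eventually (F.eventually_chart (x := γ t) hct)
    have hMs := (continuous_subtype_val.continuousAt.tendsto.comp hγt).eventually hM
    have h0 := hval.self_of_nhds
    have hM0 := hMs.self_of_nhds
    have hchart0 := hchart.self_of_nhds
    rw [add_zero] at h0
    simp only [Function.comp, add_zero] at hM0 hchart0
    refine ⟨![M.1 0 0, M.1 1 0], ?_, ?_⟩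
    · have hd : M.1 0 0 * M.1 1 1 - M.1 0 1 * M.1 1 0 = 1 := by rw [← Matrix.det_fin_two, M.2]
      exact Int.isCoprime_iff_gcd_eq_one.1 ⟨M.1 1 1, -M.1 0 1, by
        simp only [Matrix.cons_val_zero, Matrix.cons_val_one]; linarith⟩
    · filter_upwards [hval, hMs, hchart] with s h1 h2 h3
      refine h3.trans ?_
      refine Eq.trans ?_ (congrArg (· + s • LatticeVec.toPlane ![M.1 0 0, M.1 1 0]) hchart0.symm)
      have h2' : F.chartFun c (F.levelCurve ρ (t + s)) = _ := h2
      have h1' : F.chartFun (some ((n : ZMod m), true)) (γ (t + s)) = _ := h1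
      have h0' : F.chartFun (some ((n : ZMod m), true)) (γ t) = _ := h0
      simp only [Function.comp, h1'] at h2'
      change F.chartFun c (F.levelCurve ρ (t + s)) = F.chartFun c (γ t) + _
      rw [h2', hM0, h0', intAff_apply, intAff_apply]
      ext k
      fin_cases k <;> simp [LatticeVec.toPlane] <;> ring

end ReflexiveFan

/-! ### Convex lattice polygons -/

theorem detR_sub_add_smul (u x p y : Plane) (ε : ℝ) :
    detR u (x + ε • (x - y) - p) = (1 + ε) * detR u (x - p) - ε * detR u (y - p) := by
  simp only [detR, Pi.sub_apply, Pi.add_apply, Pi.smul_apply, smul_eq_mul]; ring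

theorem LatticeVec.toPlane_injective : Function.Injective LatticeVec.toPlane := by
  intro a b h
  ext k
  have : (a k : ℝ) = b k := congrFun h k
  exact_mod_cast this

namespace LatticePolygon

section side

variable {n : ℕ} (c : ZMod n → LatticeVec)

/-- The affine function that vanishes on the line through the corners `c i` and `c (i + 1)`
and is positive to the left of it. -/
def side (i : ZMod n) (x : Plane) : ℝ :=
  detR ((c (i + 1)).toPlane - (c i).toPlane) (x - (c i).toPlane)

/-- The intersection of the half planes to the left of all edges. -/
def leftRegion : Set Plane := {x | ∀ i, 0 ≤ side c i x}

variable {c}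

theorem continuous_side (i : ZMod n) : Continuous (side c i) := by
  unfold side detR; fun_prop

theorem side_combo (i : ZMod n) (x y : Plane) {s t : ℝ} (h : s + t = 1) :
    side c i (s • x + t • y) = s * side c i x + t * side c i y := by
  obtain rfl : s = 1 - t := by linarith
  simp only [side, detR, Pi.sub_apply, Pi.add_apply, Pi.smul_apply, smul_eq_mul]; ring

theorem side_self (i : ZMod n) : side c i (c i).toPlane = 0 := by
  simp [side, detR]

theorem side_succ (i : ZMod n) : side c i (c (i + 1)).toPlane = 0 := by
  simp [side, detR]; ring

theorem side_pred (i : ZMod n) : side c (i - 1) (c i).toPlane = 0 := by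
  have := side_succ (c := c) (i - 1)
  rwa [sub_add_cancel] at this

theorem side_push (i : ZMod n) (x y : Plane) (ε : ℝ) :
    side c i (x + ε • (x - y)) = (1 + ε) * side c i x - ε * side c i y :=
  detR_sub_add_smul _ _ _ _ _

theorem isClosed_leftRegion : IsClosed (leftRegion c) := by
  have : leftRegion c = ⋂ i, {x | 0 ≤ side c i x} := by ext; simp [leftRegion]
  rw [this]
  exact isClosed_iInter fun i => isClosed_le continuous_const (continuous_side i)

theorem convex_leftRegion : Convex ℝ (leftRegion c) := by
  intro x hx y hy s t hs ht hst i
  rw [side_combo i x y hst]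
  exact add_nonneg (mul_nonneg hs (hx i)) (mul_nonneg ht (hy i))

theorem add_one_ne_self (hn : 3 ≤ n) (i : ZMod n) : i + 1 ≠ i := by
  have : Fact (1 < n) := ⟨by omega⟩
  simp

theorem add_two_ne_self (hn : 3 ≤ n) (i : ZMod n) : i + 1 + 1 ≠ i := by
  intro h
  have h2 : ((2 : ℕ) : ZMod n) = 0 := by push_cast; linear_combination h
  rw [ZMod.natCast_eq_zero_iff] at h2
  have := Nat.le_of_dvd (by norm_num) h2
  omega

/-- Convexity of the closed polygonal curve with corners `c`: all other corners lie to the left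
of each edge. -/
def IsLeft (c : ZMod n → LatticeVec) : Prop :=
  ∀ i j, j ≠ i → j ≠ i + 1 → 0 < side c i (c j).toPlane



theorem IsLeft.injective (hn : 3 ≤ n) (hc : IsLeft c) : Function.Injective c := by
  have key : ∀ i j, j ≠ i + 1 → c i = c j → i = j := by
    intro i j hj h
    by_contra hij
    have := hc i j (Ne.symm hij) hj
    rw [← h, side_self] at this
    exact lt_irrefl _ this
  intro i j h
  by_cases hj : j = i + 1
  · exact (key j i (fun h' => add_two_ne_self hn i (by rw [← hj, ← h'])) h.symm).symm
  · exact key i j hj h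

theorem IsLeft.nonneg (hc : IsLeft c) (i j : ZMod n) : 0 ≤ side c i (c j).toPlane := by
  by_cases h : j = i
  · rw [h, side_self]
  by_cases h' : j = i + 1
  · rw [h', side_succ]
  exact (hc i j h h').le

theorem IsLeft.eq_or_eq (hc : IsLeft c) {i j : ZMod n} (h : side c i (c j).toPlane = 0) :
    j = i ∨ j = i + 1 := by
  by_contra h'
  push Not at h'
  exact (hc i j h'.1 h'.2).ne' h

/-- The edges of a convex polygon are the parts of its boundary lines in the polygon. -/
theorem IsLeft.segment_eq (hn : 3 ≤ n) (hc : IsLeft c) (i : ZMod n) :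
    segment ℝ (c i).toPlane (c (i + 1)).toPlane = {x ∈ leftRegion c | side c i x = 0} := by
  ext x
  constructor
  · rintro ⟨s, t, hs, ht, hst, rfl⟩
    refine ⟨fun j => ?_, ?_⟩
    · rw [side_combo j _ _ hst]
      exact add_nonneg (mul_nonneg hs (hc.nonneg _ _)) (mul_nonneg ht (hc.nonneg _ _))
    · rw [side_combo i _ _ hst, side_self, side_succ]; ring
  · rintro ⟨hx, h0⟩
    -- a point of the line through the edge is a real affine combination of the two corners
    obtain ⟨t, rfl⟩ : ∃ t : ℝ, x = (1 - t) • (c i).toPlane + t • (c (i + 1)).toPlane := by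
      have hne : (c (i + 1)).toPlane 0 - (c i).toPlane 0 ≠ 0 ∨
          (c (i + 1)).toPlane 1 - (c i).toPlane 1 ≠ 0 := by
        by_contra h
        push Not at h
        refine add_one_ne_self hn i (hc.injective hn ?_)
        refine LatticeVec.toPlane_injective ?_
        ext k
        fin_cases k
        · exact sub_eq_zero.1 h.1
        · exact sub_eq_zero.1 h.2
      simp only [side, detR, Pi.sub_apply] at h0
      rcases hne with h | h
      · refine ⟨(x 0 - (c i).toPlane 0) / ((c (i + 1)).toPlane 0 - (c i).toPlane 0), ?_⟩
        ext k
        fin_cases k <;>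
          simp only [Pi.add_apply, Pi.smul_apply, smul_eq_mul, Fin.zero_eta, Fin.mk_one] <;>
          field_simp
        · ring
        · linear_combination h0
      · refine ⟨(x 1 - (c i).toPlane 1) / ((c (i + 1)).toPlane 1 - (c i).toPlane 1), ?_⟩
        ext k
        fin_cases k <;>
          simp only [Pi.add_apply, Pi.smul_apply, smul_eq_mul, Fin.zero_eta, Fin.mk_one] <;>
          field_simp
        · linear_combination -h0
        · ring
    have h1 := hx (i + 1)
    have h2 := hx (i - 1)
    rw [side_combo _ _ _ (by ring), side_self, mul_zero, add_zero] at h1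
    rw [side_combo _ _ _ (by ring), side_pred, mul_zero, zero_add] at h2
    have h4 : 0 < side c (i + 1) (c i).toPlane :=
      hc _ _ (add_one_ne_self hn i).symm (add_two_ne_self hn i).symm
    have h5 : 0 < side c (i - 1) (c (i + 1)).toPlane :=
      hc _ _ (fun h => add_two_ne_self hn (i - 1) (by rw [sub_add_cancel, h])) (by
        rw [sub_add_cancel]; exact add_one_ne_self hn i)
    exact ⟨1 - t, t, nonneg_of_mul_nonneg_left h1 h4, nonneg_of_mul_nonneg_left h2 h5, by ring, rfl⟩

theorem IsLeft.simple (hn : 3 ≤ n) (hc : IsLeft c) {i j : ZMod n} (hij : i ≠ j) :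
    segment ℝ (c i).toPlane (c (i + 1)).toPlane ∩ segment ℝ (c j).toPlane (c (j + 1)).toPlane ⊆
      {(c i).toPlane, (c (i + 1)).toPlane} ∩ {(c j).toPlane, (c (j + 1)).toPlane} := by
  have key : ∀ {i j : ZMod n} {x : Plane}, i ≠ j → side c i x = 0 →
      x ∈ segment ℝ (c j).toPlane (c (j + 1)).toPlane →
      x = (c j).toPlane ∨ x = (c (j + 1)).toPlane := by
    rintro i j x hij h0 ⟨s, t, hs, ht, hst, rfl⟩
    rw [side_combo i _ _ hst, add_eq_zero_iff_of_nonneg (mul_nonneg hs (hc.nonneg _ _))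
      (mul_nonneg ht (hc.nonneg _ _)), mul_eq_zero, mul_eq_zero] at h0
    obtain ⟨h1 | h1, h2 | h2⟩ := h0
    · linarith
    · right; rw [h1, show t = 1 by linarith]; simp
    · left; rw [h2, show s = 1 by linarith]; simp
    · exfalso
      rcases hc.eq_or_eq h1 with h1 | h1
      · exact hij h1.symm
      rcases hc.eq_or_eq h2 with h2 | h2
      · rw [h1] at h2; exact add_two_ne_self hn i h2
      · exact hij (add_right_cancel h2).symm
  rintro x ⟨h1, h2⟩
  have h1' := h1
  have h2' := h2
  rw [hc.segment_eq hn] at h1' h2'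
  exact ⟨key hij.symm h2'.2 h1, key hij h1'.2 h2⟩

theorem IsLeft.extreme (hn : 3 ≤ n) (hc : IsLeft c) (i : ZMod n) :
    (c i).toPlane ∈ Set.extremePoints ℝ (leftRegion c) := by
  rw [mem_extremePoints]
  refine ⟨fun j => hc.nonneg j i, fun x hx y hy hxy => ?_⟩
  -- both edges at the corner contain a segment around it
  have key : ∀ k, side c k (c i).toPlane = 0 → side c k x = 0 ∧ side c k y = 0 := by
    intro k hk
    obtain ⟨s, t, hs, ht, hst, h⟩ := hxy
    rw [← h, side_combo k _ _ hst, add_eq_zero_iff_of_nonneg (mul_nonneg hs.le (hx k))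
      (mul_nonneg ht.le (hy k))] at hk
    exact ⟨(mul_eq_zero.1 hk.1).resolve_left hs.ne', (mul_eq_zero.1 hk.2).resolve_left ht.ne'⟩
  have fin : ∀ z ∈ leftRegion c, side c (i - 1) z = 0 → side c i z = 0 → z = (c i).toPlane := by
    intro z hz h1 h2
    have hne : i - 1 ≠ i := fun h => add_one_ne_self hn (i - 1) (by rw [sub_add_cancel, h])
    have h3 : z ∈ segment ℝ (c (i - 1)).toPlane (c (i - 1 + 1)).toPlane := by
      rw [hc.segment_eq hn]; exact ⟨hz, h1⟩
    have h4 : z ∈ segment ℝ (c i).toPlane (c (i + 1)).toPlane := by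
      rw [hc.segment_eq hn]; exact ⟨hz, h2⟩
    rcases hc.simple hn hne ⟨h3, h4⟩ with ⟨h3 | h3, h4 | h4⟩
    · exact h4
    · rw [h3] at h4
      have h5 : c (i - 1) = c (i + 1) := LatticeVec.toPlane_injective h4
      exact absurd (hc.injective hn h5) fun h =>
        add_two_ne_self hn (i - 1) (by rw [sub_add_cancel, h])
    · exact h4
    · rw [sub_add_cancel] at h3; exact h3
  obtain ⟨h1, h2⟩ := key _ (side_pred i)
  obtain ⟨h3, h4⟩ := key _ (side_self i)
  exact ⟨fin x hx h1 h3, fin y hy h2 h4⟩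

variable [NeZero n]

theorem frontier_leftRegion (hn : 3 ≤ n) (hc : IsLeft c) (hp : ∃ p, ∀ i, 0 < side c i p) :
    frontier (leftRegion c) = (⋃ i, segment ℝ (c i).toPlane (c (i + 1)).toPlane) ∧
      interior (leftRegion c) = {x | ∀ i, 0 < side c i x} := by
  have hd : leftRegion c \ (⋃ i, segment ℝ (c i).toPlane (c (i + 1)).toPlane) =
      {x | ∀ i, 0 < side c i x} := by
    ext x
    simp only [Set.mem_sdiff, mem_iUnion, not_exists, hc.segment_eq hn, mem_ofPred_eq]
    constructor
    · rintro ⟨hx, h⟩ i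
      exact lt_of_le_of_ne (hx i) fun h0 => h i ⟨hx, h0.symm⟩
    · intro h
      exact ⟨fun i => (h i).le, fun i hi => (h i).ne' hi.2⟩
  have ho : IsOpen {x | ∀ i, 0 < side c i x} := by
    have : {x | ∀ i, 0 < side c i x} = ⋂ i, {x | 0 < side c i x} := by ext; simp
    rw [this]
    exact isOpen_iInter_of_finite fun i => isOpen_lt continuous_const (continuous_side i)
  obtain ⟨p, hp⟩ := hp
  obtain ⟨h1, h2⟩ := frontier_eq_of_push (isClosed_leftRegion (c := c))
    (iUnion_subset fun i => by rw [hc.segment_eq hn]; exact sep_subset _ _) (hd ▸ ho) p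
    (fun x hx ε hε hmem => by
      obtain ⟨i, hi⟩ := mem_iUnion.1 hx
      rw [hc.segment_eq hn] at hi
      have h3 := hmem i
      rw [side_push, hi.2] at h3
      have := mul_pos hε (hp i)
      linarith)
  exact ⟨h1, h2.trans hd⟩

/-- The lattice polygon with corners `c`, in counterclockwise order and in convex position. -/
def ofIsLeft (hn : 3 ≤ n) (hc : IsLeft c) (hb : Bornology.IsBounded (leftRegion c))
    (hp : ∃ p, ∀ i, 0 < side c i p) : LatticePolygon where
  n := n
  three_le := hn
  corner := c
  region := leftRegion c
  corner_injective := hc.injective hn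
  simple := fun _ _ hij => hc.simple hn hij
  compact := Metric.isCompact_of_isClosed_isBounded isClosed_leftRegion hb
  interior_nonempty := by rw [(frontier_leftRegion hn hc hp).2]; exact hp
  frontier_eq := (frontier_leftRegion hn hc hp).1

theorem isConvex_ofIsLeft (hn : 3 ≤ n) (hc : IsLeft c) (hb : Bornology.IsBounded (leftRegion c))
    (hp : ∃ p, ∀ i, 0 < side c i p) : (ofIsLeft hn hc hb hp).IsConvex :=
  ⟨convex_leftRegion, fun i => hc.extreme hn i⟩

end side

/-! ### The triangles and rectangles of the decompositions -/

/-- The corners of the standard triangle with height one over an edge of length `l`. -/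
def triangleCorner (l : ℕ) : ZMod 3 → LatticeVec :=
  fun i => (![![0, 0], ![1, 0], ![1, l]] : Fin 3 → LatticeVec) i

/-- The corners of the standard rectangle of height one and width `l`. -/
def rectangleCorner (l : ℕ) : ZMod 4 → LatticeVec :=
  fun i => (![![0, 0], ![l, 0], ![l, 1], ![0, 1]] : Fin 4 → LatticeVec) i

theorem forall_zmod_three {p : ZMod 3 → Prop} : (∀ i, p i) ↔ p 0 ∧ p 1 ∧ p 2 :=
  Fin.forall_fin_succ.trans (and_congr Iff.rfl Fin.forall_fin_two)

theorem forall_zmod_four {p : ZMod 4 → Prop} : (∀ i, p i) ↔ p 0 ∧ p 1 ∧ p 2 ∧ p 3 :=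
  Fin.forall_fin_succ.trans (and_congr Iff.rfl
    (Fin.forall_fin_succ.trans (and_congr Iff.rfl Fin.forall_fin_two)))

section triangle

variable (l : ℕ) (x : Plane)

theorem side_triangle_zero : side (triangleCorner l) 0 x = x 1 := by
  change (((1 : ℤ) : ℝ) - (0 : ℤ)) * (x 1 - (0 : ℤ)) - (((0 : ℤ) : ℝ) - (0 : ℤ)) *
    (x 0 - (0 : ℤ)) = _
  push_cast; ring

theorem side_triangle_one : side (triangleCorner l) 1 x = l * (1 - x 0) := by
  change (((1 : ℤ) : ℝ) - (1 : ℤ)) * (x 1 - (0 : ℤ)) - (((l : ℤ) : ℝ) - (0 : ℤ)) *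
    (x 0 - (1 : ℤ)) = _
  push_cast; ring

theorem side_triangle_two : side (triangleCorner l) 2 x = l * x 0 - x 1 := by
  change (((0 : ℤ) : ℝ) - (1 : ℤ)) * (x 1 - (l : ℤ)) - (((0 : ℤ) : ℝ) - (l : ℤ)) *
    (x 0 - (1 : ℤ)) = _
  push_cast; ring

theorem side_rectangle_zero : side (rectangleCorner l) 0 x = l * x 1 := by
  change (((l : ℤ) : ℝ) - (0 : ℤ)) * (x 1 - (0 : ℤ)) - (((0 : ℤ) : ℝ) - (0 : ℤ)) *
    (x 0 - (0 : ℤ)) = _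
  push_cast; ring

theorem side_rectangle_one : side (rectangleCorner l) 1 x = l - x 0 := by
  change (((l : ℤ) : ℝ) - (l : ℤ)) * (x 1 - (0 : ℤ)) - (((1 : ℤ) : ℝ) - (0 : ℤ)) *
    (x 0 - (l : ℤ)) = _
  push_cast; ring

theorem side_rectangle_two : side (rectangleCorner l) 2 x = l * (1 - x 1) := by
  change (((0 : ℤ) : ℝ) - (l : ℤ)) * (x 1 - (1 : ℤ)) - (((1 : ℤ) : ℝ) - (1 : ℤ)) *
    (x 0 - (l : ℤ)) = _
  push_cast; ring

theorem side_rectangle_three : side (rectangleCorner l) 3 x = x 0 := by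
  change (((0 : ℤ) : ℝ) - (0 : ℤ)) * (x 1 - (1 : ℤ)) - (((0 : ℤ) : ℝ) - (1 : ℤ)) *
    (x 0 - (0 : ℤ)) = _
  push_cast; ring

variable {l x}

theorem mem_leftRegion_triangle (hl : 0 < l) :
    x ∈ leftRegion (triangleCorner l) ↔ 0 ≤ x 1 ∧ x 0 ≤ 1 ∧ x 1 ≤ l * x 0 := by
  have hl' : (0 : ℝ) < l := by exact_mod_cast hl
  refine forall_zmod_three.trans ?_
  rw [side_triangle_zero, side_triangle_one, side_triangle_two, mul_nonneg_iff_of_pos_left hl',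
    sub_nonneg, sub_nonneg]

theorem mem_leftRegion_rectangle (hl : 0 < l) :
    x ∈ leftRegion (rectangleCorner l) ↔ 0 ≤ x 1 ∧ x 0 ≤ l ∧ x 1 ≤ 1 ∧ 0 ≤ x 0 := by
  have hl' : (0 : ℝ) < l := by exact_mod_cast hl
  refine forall_zmod_four.trans ?_
  rw [side_rectangle_zero, side_rectangle_one, side_rectangle_two, side_rectangle_three,
    mul_nonneg_iff_of_pos_left hl', mul_nonneg_iff_of_pos_left hl', sub_nonneg, sub_nonneg]

theorem isLeft_triangle (hl : 0 < l) : IsLeft (triangleCorner l) := by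
  have hl' : (0 : ℝ) < l := by exact_mod_cast hl
  refine forall_zmod_three.2 ⟨?_, ?_, ?_⟩ <;> refine forall_zmod_three.2 ⟨?_, ?_, ?_⟩ <;>
    intro h h' <;> first | exact absurd rfl h | exact absurd rfl h' | skip
  · rw [side_triangle_zero]; change (0 : ℝ) < ((l : ℤ) : ℝ); exact_mod_cast hl
  · rw [side_triangle_one]; change (0 : ℝ) < l * (1 - ((0 : ℤ) : ℝ)); simpa using hl
  · rw [side_triangle_two]; change (0 : ℝ) < l * ((1 : ℤ) : ℝ) - ((0 : ℤ) : ℝ); simpa using hl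

theorem isLeft_rectangle (hl : 0 < l) : IsLeft (rectangleCorner l) := by
  have hl' : (0 : ℝ) < l := by exact_mod_cast hl
  refine forall_zmod_four.2 ⟨?_, ?_, ?_, ?_⟩ <;> refine forall_zmod_four.2 ⟨?_, ?_, ?_, ?_⟩ <;>
    intro h h' <;> first | exact absurd rfl h | exact absurd rfl h' | skip
  · rw [side_rectangle_zero]; change (0 : ℝ) < l * ((1 : ℤ) : ℝ); simpa using hl
  · rw [side_rectangle_zero]; change (0 : ℝ) < l * ((1 : ℤ) : ℝ); simpa using hl
  · rw [side_rectangle_one]; change (0 : ℝ) < l - ((0 : ℤ) : ℝ); simpa using hl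
  · rw [side_rectangle_one]; change (0 : ℝ) < l - ((0 : ℤ) : ℝ); simpa using hl
  · rw [side_rectangle_two]; change (0 : ℝ) < l * (1 - ((0 : ℤ) : ℝ)); simpa using hl
  · rw [side_rectangle_two]; change (0 : ℝ) < l * (1 - ((0 : ℤ) : ℝ)); simpa using hl
  · rw [side_rectangle_three]; change (0 : ℝ) < ((l : ℤ) : ℝ); exact_mod_cast hl
  · rw [side_rectangle_three]; change (0 : ℝ) < ((l : ℤ) : ℝ); exact_mod_cast hl

theorem isBounded_of_abs_le {R : Set Plane} (M : ℝ) (h : ∀ x ∈ R, |x 0| ≤ M ∧ |x 1| ≤ M) :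
    Bornology.IsBounded R := by
  refine (Metric.isBounded_closedBall (x := (0 : Plane)) (r := max M 0)).subset fun x hx => ?_
  rw [mem_closedBall_zero_iff, pi_norm_le_iff_of_nonneg (le_max_right _ _)]
  intro k
  refine le_trans ?_ (le_max_left _ _)
  fin_cases k
  · exact (h x hx).1
  · exact (h x hx).2

theorem exists_side_triangle_pos (hl : 0 < l) : ∃ p, ∀ i, 0 < side (triangleCorner l) i p := by
  have hl' : (0 : ℝ) < l := by exact_mod_cast hl
  refine ⟨![1 / 2, l / 4], forall_zmod_three.2 ⟨?_, ?_, ?_⟩⟩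
  · rw [side_triangle_zero]; simpa using hl
  · rw [side_triangle_one]; simp; norm_num [hl]
  · rw [side_triangle_two]; simp; linarith

theorem exists_side_rectangle_pos (hl : 0 < l) : ∃ p, ∀ i, 0 < side (rectangleCorner l) i p := by
  have hl' : (0 : ℝ) < l := by exact_mod_cast hl
  refine ⟨![l / 2, 1 / 2], forall_zmod_four.2 ⟨?_, ?_, ?_, ?_⟩⟩
  · rw [side_rectangle_zero]; simpa using hl
  · rw [side_rectangle_one]; simp; linarith
  · rw [side_rectangle_two]; simp; norm_num [hl]
  · rw [side_rectangle_three]; simpa using hl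

/-- The triangle with corners `(0, 0)`, `(1, 0)` and `(1, l)`. -/
def triangle (hl : 0 < l) : LatticePolygon :=
  ofIsLeft le_rfl (isLeft_triangle hl)
    (isBounded_of_abs_le (max 1 l) fun x hx => by
      obtain ⟨h1, h2, h3⟩ := (mem_leftRegion_triangle hl).1 hx
      have hl' : (0 : ℝ) < l := by exact_mod_cast hl
      have h4 : 0 ≤ x 0 := nonneg_of_mul_nonneg_right (h1.trans h3) hl'
      rw [abs_of_nonneg h4, abs_of_nonneg h1]
      exact ⟨h2.trans (le_max_left _ _),
        (h3.trans (mul_le_of_le_one_right hl'.le h2)).trans (le_max_right _ _)⟩)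
    (exists_side_triangle_pos hl)

/-- The rectangle with corners `(0, 0)`, `(l, 0)`, `(l, 1)` and `(0, 1)`. -/
def rectangle (hl : 0 < l) : LatticePolygon :=
  ofIsLeft (by norm_num) (isLeft_rectangle hl)
    (isBounded_of_abs_le (max 1 l) fun x hx => by
      obtain ⟨h1, h2, h3, h4⟩ := (mem_leftRegion_rectangle hl).1 hx
      rw [abs_of_nonneg h4, abs_of_nonneg h1]
      exact ⟨h2.trans (le_max_right _ _), h3.trans (le_max_left _ _)⟩)
    (exists_side_rectangle_pos hl)

theorem isConvex_triangle (hl : 0 < l) : (triangle hl).IsConvex := isConvex_ofIsLeft _ _ _ _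

theorem isConvex_rectangle (hl : 0 < l) : (rectangle hl).IsConvex := isConvex_ofIsLeft _ _ _ _

theorem mem_triangle (hl : 0 < l) :
    x ∈ (triangle hl).region ↔ 0 ≤ x 1 ∧ x 0 ≤ 1 ∧ x 1 ≤ l * x 0 := mem_leftRegion_triangle hl

theorem mem_rectangle (hl : 0 < l) :
    x ∈ (rectangle hl).region ↔ 0 ≤ x 1 ∧ x 0 ≤ l ∧ x 1 ≤ 1 ∧ 0 ≤ x 0 :=
  mem_leftRegion_rectangle hl

theorem mem_interior_triangle (hl : 0 < l) (h : x ∈ interior (triangle hl).region) :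
    0 < x 1 ∧ x 0 < 1 ∧ x 1 < l * x 0 := by
  have hl' : (0 : ℝ) < l := by exact_mod_cast hl
  have h1 : x ∈ interior (leftRegion (triangleCorner l)) := h
  rw [(frontier_leftRegion le_rfl (isLeft_triangle hl)
    (exists_side_triangle_pos hl)).2] at h1
  obtain ⟨h2, h3, h4⟩ := forall_zmod_three.1 h1
  rw [side_triangle_zero] at h2
  rw [side_triangle_one, mul_pos_iff_of_pos_left hl', sub_pos] at h3
  rw [side_triangle_two, sub_pos] at h4
  exact ⟨h2, h3, h4⟩

theorem mem_interior_rectangle (hl : 0 < l) (h : x ∈ interior (rectangle hl).region) :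
    0 < x 1 ∧ x 0 < l ∧ x 1 < 1 ∧ 0 < x 0 := by
  have hl' : (0 : ℝ) < l := by exact_mod_cast hl
  have h1 : x ∈ interior (leftRegion (rectangleCorner l)) := h
  rw [(frontier_leftRegion (by norm_num) (isLeft_rectangle hl)
    (exists_side_rectangle_pos hl)).2] at h1
  obtain ⟨h2, h3, h4, h5⟩ := forall_zmod_four.1 h1
  rw [side_rectangle_zero, mul_pos_iff_of_pos_left hl'] at h2
  rw [side_rectangle_one, sub_pos] at h3
  rw [side_rectangle_two, mul_pos_iff_of_pos_left hl', sub_pos] at h4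
  rw [side_rectangle_three] at h5
  exact ⟨h2, h3, h4, h5⟩

/-- The edges of the standard triangle. -/
theorem triangle_edges (hl : 0 < l) :
    {y ∈ (triangle hl).region | y 1 = 0} ∈ (triangle hl).edges ∧
    {y ∈ (triangle hl).region | y 0 = 1} ∈ (triangle hl).edges ∧
    {y ∈ (triangle hl).region | y 1 = l * y 0} ∈ (triangle hl).edges := by
  have hl' : (0 : ℝ) < l := by exact_mod_cast hl
  have h := fun i => (isLeft_triangle hl).segment_eq le_rfl i
  refine ⟨⟨(0 : ZMod 3), (h 0).trans ?_⟩, ⟨(1 : ZMod 3), (h 1).trans ?_⟩,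
    ⟨(2 : ZMod 3), (h 2).trans ?_⟩⟩
  · ext y; exact and_congr Iff.rfl (by rw [side_triangle_zero])
  · ext y; refine and_congr Iff.rfl ?_
    rw [side_triangle_one, mul_eq_zero, or_iff_right hl'.ne', sub_eq_zero, eq_comm]
  · ext y; refine and_congr Iff.rfl ?_
    rw [side_triangle_two, sub_eq_zero, eq_comm]

/-- The edges of the standard rectangle except for the bottom. -/
theorem rectangle_edges (hl : 0 < l) :
    {y ∈ (rectangle hl).region | y 0 = l} ∈ (rectangle hl).edges ∧
    {y ∈ (rectangle hl).region | y 1 = 1} ∈ (rectangle hl).edges ∧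
    {y ∈ (rectangle hl).region | y 0 = 0} ∈ (rectangle hl).edges := by
  have hl' : (0 : ℝ) < l := by exact_mod_cast hl
  have h := fun i => (isLeft_rectangle hl).segment_eq (by norm_num) i
  refine ⟨⟨(1 : ZMod 4), (h 1).trans ?_⟩, ⟨(2 : ZMod 4), (h 2).trans ?_⟩,
    ⟨(3 : ZMod 4), (h 3).trans ?_⟩⟩
  · ext y; refine and_congr Iff.rfl ?_
    rw [side_rectangle_one, sub_eq_zero, eq_comm]
  · ext y; refine and_congr Iff.rfl ?_
    rw [side_rectangle_two, mul_eq_zero, or_iff_right hl'.ne', sub_eq_zero, eq_comm]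
  · ext y; exact and_congr Iff.rfl (by rw [side_rectangle_three])

end triangle

end LatticePolygon

/-! ### The polygon as a lattice polygon -/

namespace ReflexiveFan

variable {m : ℕ} [NeZero m] (F : ReflexiveFan m)

theorem toPlane_v (i : ZMod m) : (F.v i).toPlane = F.point i 1 0 := by simp [point]

theorem toPlane_v_succ (i : ZMod m) : (F.v (i + 1)).toPlane = F.point i 1 (F.l i) := by
  rw [F.v_succ]; ext k; simp [point, LatticeVec.toPlane]

theorem mem_simplex {i : ZMod m} {x : Plane} :
    x ∈ simplex (F.v i) (F.v (i + 1)) ↔ x ∈ F.cone i ∧ F.gauge x ≤ 1 := by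
  have hl := F.l_real_pos i
  rw [mem_simplex_iff (by rw [F.det_succ]; exact_mod_cast F.l_pos i), detR_toPlane, F.det_succ]
  have e : detR x (F.v (i + 1)).toPlane = -F.beta (i + 1) x := by
    simp only [beta, detR]; ring
  change 0 ≤ F.beta i x ∧ _ ∧ F.beta i x + _ ≤ _ ↔ _
  have hb := F.beta_succ i x
  rw [e, neg_nonneg, ← and_assoc]
  refine and_congr_right fun hc => ?_
  rw [gauge_eq (i := i) hc, hb, Int.cast_natCast]
  constructor
  · intro h
    exact le_of_mul_le_mul_left (by linarith) hl
  · intro h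
    have := mul_le_mul_of_nonneg_left h hl.le
    linarith

theorem mem_polygon {x : Plane} : x ∈ polygon F.v ↔ F.gauge x ≤ 1 := by
  rw [polygon, mem_iUnion]
  simp only [mem_simplex]
  constructor
  · rintro ⟨i, -, h⟩; exact h
  · intro h
    obtain ⟨i, hi⟩ := F.exists_mem_cone x
    exact ⟨i, hi, h⟩

theorem polygon_eq : polygon F.v = {x | F.gauge x ≤ 1} := Set.ext fun _ => F.mem_polygon

theorem mem_polygonEdge {i : ZMod m} {x : Plane} :
    x ∈ polygonEdge F.v i ↔ x ∈ F.cone i ∧ F.gauge x = 1 := by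
  have hl := F.l_real_pos i
  rw [polygonEdge, segment_eq_image', toPlane_v, toPlane_v_succ]
  have e : ∀ t : ℝ, F.point i 1 0 + t • (F.point i 1 (F.l i) - F.point i 1 0) =
      F.point i 1 (t * F.l i) := by
    intro t; ext k; simp [point]; ring
  constructor
  · rintro ⟨t, ⟨h0, h1⟩, rfl⟩
    have h2 : t * F.l i ≤ F.l i * 1 := by
      rw [mul_one]; exact mul_le_of_le_one_left hl.le h1
    have h3 := mul_nonneg h0 hl.le
    simp only [e]
    exact ⟨F.point_mem_cone h3 h2, F.gauge_point h3 h2⟩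
  · rintro ⟨hc, hg⟩
    refine ⟨F.beta i x / F.l i, ⟨div_nonneg hc.1 hl.le, ?_⟩, ?_⟩
    · rw [div_le_one hl]; have := F.beta_le_of_mem_cone hc; rwa [hg, mul_one] at this
    · simp only [e]
      rw [div_mul_cancel₀ _ hl.ne', ← hg, gauge_eq hc, point_alpha_beta]

theorem frontier_polygon :
    frontier (polygon F.v) = {x | F.gauge x = 1} ∧ interior (polygon F.v) = {x | F.gauge x < 1} := by
  rw [polygon_eq]
  have hd : {x | F.gauge x ≤ 1} \ {x | F.gauge x = 1} = {x | F.gauge x < 1} := by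
    ext x; exact (lt_iff_le_and_ne (a := F.gauge x) (b := 1)).symm
  obtain ⟨h1, h2⟩ := frontier_eq_of_push (R := {x | F.gauge x ≤ 1}) (F := {x | F.gauge x = 1})
    (isClosed_le F.continuous_gauge continuous_const) (fun x hx => le_of_eq hx)
    (hd ▸ isOpen_lt F.continuous_gauge continuous_const) 0 (fun x hx ε hε h => by
      have e : x + ε • (x - 0) = (1 + ε) • x := by rw [sub_zero, add_smul, one_smul]
      rw [e] at h
      have h3 : F.gauge ((1 + ε) • x) ≤ 1 := h
      have h4 : F.gauge x = 1 := hx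
      rw [F.gauge_smul _ (by linarith), h4] at h3
      linarith)
  exact ⟨h1, h2.trans hd⟩

theorem isCompact_gauge_le (ρ : ℝ) : IsCompact {x | F.gauge x ≤ ρ} := by
  obtain ⟨M, hM, hle⟩ := F.exists_norm_le_gauge
  refine Metric.isCompact_of_isClosed_isBounded (isClosed_le F.continuous_gauge continuous_const)
    ((Metric.isBounded_closedBall (x := (0 : Plane)) (r := M * ρ)).subset fun x hx => ?_)
  rw [mem_closedBall_zero_iff]
  exact (hle x).trans (mul_le_mul_of_nonneg_left hx hM.le)

theorem v_injective : Function.Injective F.v := by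
  intro i j h
  have h1 : F.ray 1 i = F.ray 1 j := by
    change F.point i 1 0 = F.point j 1 0
    rw [← toPlane_v, ← toPlane_v, h]
  exact F.eq_of_ray_mem_star one_pos (h1 ▸ F.ray_mem_star one_pos i)

/-- Two edges can only meet in a common corner. -/
theorem polygonEdge_inter {i j : ZMod m} (hij : i ≠ j) :
    polygonEdge F.v i ∩ polygonEdge F.v j ⊆
      {(F.v i).toPlane, (F.v (i + 1)).toPlane} ∩ {(F.v j).toPlane, (F.v (j + 1)).toPlane} := by
  rintro x ⟨hi, hj⟩
  rw [mem_polygonEdge] at hi hj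
  have key : ∀ {k : ZMod m}, x ∈ F.cone k → F.beta k x = 0 → x = (F.v k).toPlane := by
    intro k hk h0
    refine F.ext_alpha_beta k ?_ ?_
    · rw [← gauge_eq hk, hi.2, toPlane_v, alpha_point]
    · rw [h0, toPlane_v, beta_point]
  rcases mem_cone_inter (F.ne_zero_of_gauge_pos (by rw [hi.2]; exact one_pos)) hi.1 hj.1 with
    h | ⟨rfl, h⟩ | ⟨rfl, h⟩
  · exact absurd h hij
  · exact ⟨Or.inr (key hj.1 h), Or.inl (key hj.1 h)⟩
  · exact ⟨Or.inl (key hi.1 h), Or.inr (key hi.1 h)⟩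

/-- The polygon, with all its edges. -/
def latticePolygon : LatticePolygon where
  n := m
  three_le := F.three_le
  corner := F.v
  region := polygon F.v
  corner_injective := F.v_injective
  simple := fun _ _ hij => F.polygonEdge_inter hij
  compact := by rw [polygon_eq]; exact F.isCompact_gauge_le 1
  interior_nonempty := ⟨0, by
    rw [F.frontier_polygon.2]; change F.gauge 0 < 1; rw [gauge_zero]; exact one_pos⟩
  frontier_eq := by
    rw [F.frontier_polygon.1]
    ext x
    rw [mem_iUnion]
    constructor
    · intro hx
      obtain ⟨i, hi⟩ := F.exists_mem_cone x
      exact ⟨i, F.mem_polygonEdge.2 ⟨hi, hx⟩⟩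
    · rintro ⟨i, hi⟩
      exact (F.mem_polygonEdge.1 hi).2

/-- The lattice points in the boundary are exactly the points at integral affine length. -/
theorem boundaryLatticePoints_eq : (boundaryLatticePoints F.v : ℤ) = ∑ i, (F.l i : ℤ) := by
  let L : ℤ := ∑ i, (F.l i : ℤ)
  let g : ℤ → LatticeVec := fun a =>
    F.v (F.arcIndex a : ZMod m) + (a - F.arc (F.arcIndex a)) • F.u (F.arcIndex a : ZMod m)
  have hg : ∀ a : ℤ, (g a).toPlane = F.levelCurve 1 a := by
    intro a
    rw [levelCurve, ofTauGauge_right]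
    · ext k; simp [g, point, LatticeVec.toPlane]
    · rw [sub_nonneg]; exact (F.arcIndex_spec a).1
  have hset : {w : LatticeVec | w.toPlane ∈ frontier (polygon F.v)} = g '' Set.Ico 0 L := by
    rw [F.frontier_polygon.1]
    ext w
    constructor
    · intro hw
      have hw' : F.gauge w.toPlane = 1 := hw
      obtain ⟨n, hn0, hnm, ht, ht', hx⟩ := F.exists_levelCurve_eq le_rfl hw'
      obtain ⟨t, hb⟩ : ∃ t : ℤ, F.tau (n : ZMod m) w.toPlane = t := by
        refine ⟨LatticeVec.det2 (F.v (n : ZMod m)) w, ?_⟩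
        rw [tau, hw', max_self, div_one, beta, detR_toPlane]
      rw [hb] at ht ht' hx
      have h0 : 0 ≤ t := by exact_mod_cast ht
      have h1 : t < F.l (n : ZMod m) := by exact_mod_cast ht'
      refine ⟨F.arc n + t, ⟨?_, ?_⟩, LatticeVec.toPlane_injective ?_⟩
      · have := F.le_arc hn0; omega
      · have h2 := F.arc_succ n
        have h3 : F.arc (n + 1) ≤ F.arc m := F.arc_strictMono.monotone (by omega)
        have h4 := F.arc_add_period 0
        rw [arc_zero, zero_add, zero_add] at h4
        change _ < ∑ i, (F.l i : ℤ)
        omega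
      · rw [hg, ← hx]; push_cast; rfl
    · rintro ⟨a, -, rfl⟩
      change F.gauge (g a).toPlane = 1
      rw [hg, F.gauge_levelCurve le_rfl]
  have hinj : Set.InjOn g (Set.Ico 0 L) := by
    intro a ha b hb hab
    have h1 := F.injOn_levelCurve le_rfl (x₁ := (a : ℝ)) (x₂ := (b : ℝ))
      ⟨by exact_mod_cast ha.1, Int.cast_lt.2 ha.2⟩
      ⟨by exact_mod_cast hb.1, Int.cast_lt.2 hb.2⟩ (by rw [← hg, ← hg, hab])
    exact_mod_cast h1
  have hL : 0 ≤ L := Finset.sum_nonneg fun i _ => by positivity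
  rw [boundaryLatticePoints, hset, Set.InjOn.ncard_image hinj, ← Finset.coe_Ico,
    Set.ncard_coe_finset, Int.card_Ico, sub_zero, Int.toNat_of_nonneg hL]

end ReflexiveFan

/-! ### Polyhedral decompositions of the disc -/

namespace ReflexiveFan

variable {m : ℕ} [NeZero m] (F : ReflexiveFan m)

open Classical in
/-- The retraction of the plane to the disc that is only used for points of the disc. -/
noncomputable def toDisc (x : Plane) : F.Disc :=
  if h : F.gauge x ≤ 2 then ⟨x, h⟩ else ⟨0, by rw [gauge_zero]; norm_num⟩

theorem toDisc_of_le {x : Plane} (h : F.gauge x ≤ 2) : (F.toDisc x : Plane) = x := by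
  rw [toDisc, dif_pos h]

theorem toDisc_coe (x : F.Disc) : F.toDisc x = x := Subtype.ext (F.toDisc_of_le x.2)

variable {r : ℝ} (hr : r = 1 / 2 ∨ r = 3 / 2)

/-- The map `e` embeds the polygon `σ` as a cell of a polyhedral decomposition of the disc. -/
structure IsCell (σ : LatticePolygon) (e : Plane → Plane) : Prop where
  continuousOn : ContinuousOn e σ.region
  injOn : Set.InjOn e σ.region
  gauge_le : ∀ y ∈ σ.region, F.gauge (e y) ≤ 2
  corner : ∀ i, F.toDisc (e (σ.corner i).toPlane) ∉ F.singular hr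
  interior : ∀ x ∈ interior σ.region, F.toDisc (e x) ∉ F.singular hr
  affine : ∀ x ∈ σ.region, ∀ a, e x ∈ F.chartDom r a →
    AffRel (𝓝[σ.region] x) id fun y => F.chartFun a (e y)

/-- The set `S` is the image under `e` of a proper face of `σ`. -/
def IsFaceImage (σ : LatticePolygon) (e : Plane → Plane) (S : Set F.Disc) : Prop :=
  ∃ f ∈ σ.properFaces, S = (fun p => F.toDisc (e p)) '' f

variable {F}

theorem isFaceImage_empty {σ : LatticePolygon} {e : Plane → Plane} {S : Set F.Disc}
    (h : S = ∅) : F.IsFaceImage σ e S :=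
  ⟨∅, Or.inl (Or.inl rfl), by rw [h, image_empty]⟩

theorem isFaceImage_corner {σ : LatticePolygon} {e : Plane → Plane} {S : Set F.Disc} (i : ZMod σ.n)
    (h : S = {F.toDisc (e (σ.corner i).toPlane)}) : F.IsFaceImage σ e S :=
  ⟨_, Or.inl (Or.inr ⟨i, rfl⟩), by rw [h, image_singleton]⟩

theorem isFaceImage_edge {σ : LatticePolygon} {e : Plane → Plane} {S : Set F.Disc} {f : Set Plane}
    (hf : f ∈ σ.edges) (h : S = (fun p => F.toDisc (e p)) '' f) : F.IsFaceImage σ e S :=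
  ⟨f, Or.inr hf, h⟩

/-- Cells that cover the disc and meet in common faces form a tropical surface. -/
noncomputable abbrev tropicalSurface {ι : Type} [Finite ι] (σ : ι → LatticePolygon)
    (e : ι → Plane → Plane) (h : ∀ j, F.IsCell hr (σ j) (e j))
    (hcov : ∀ x : F.Disc, ∃ j, x ∈ (fun p => F.toDisc (e j p)) '' (σ j).region)
    (hface : ∀ j k, j ≠ k → F.IsFaceImage (σ j) (e j)
      ((fun p => F.toDisc (e j p)) '' (σ j).region ∩ (fun p => F.toDisc (e k p)) '' (σ k).region)) :
    TropicalSurface where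
  toIntegralAffineSurface := F.surface hr
  Cell := ι
  finite_cell := inferInstance
  cell := σ
  emb := fun j p => F.toDisc (e j p)
  emb_continuous := fun j => by
    rw [Topology.IsInducing.continuousOn_iff ⟨rfl⟩ (g := Subtype.val)]
    exact (h j).continuousOn.congr fun y hy => F.toDisc_of_le ((h j).gauge_le y hy)
  emb_injective := fun j x hx y hy hxy => by
    refine (h j).injOn hx hy ?_
    rw [← F.toDisc_of_le ((h j).gauge_le x hx), ← F.toDisc_of_le ((h j).gauge_le y hy)]
    exact congrArg Subtype.val hxy
  covers := hcov
  corner_nonsing := fun j => (h j).corner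
  interior_nonsing := fun j => (h j).interior
  emb_affine := by
    rintro j x hx _ ⟨a, rfl⟩ hxa
    have hle := (h j).gauge_le
    have hc : ContinuousOn (fun p => F.toDisc (e j p)) (σ j).region := by
      rw [Topology.IsInducing.continuousOn_iff ⟨rfl⟩ (g := Subtype.val)]
      exact (h j).continuousOn.congr fun y hy => F.toDisc_of_le (hle y hy)
    have hxa' : (F.toDisc (e j x) : Plane) ∈ F.chartDom r a := F.mem_chart_source.1 hxa
    have hd : e j x ∈ F.chartDom r a := by rwa [F.toDisc_of_le (hle x hx)] at hxa'
    obtain ⟨M, b, hM⟩ := (h j).affine x hx a hd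
    refine ⟨M, b, ?_⟩
    filter_upwards [hM, self_mem_nhdsWithin, (hc x hx).eventually (F.eventually_chart hxa')]
      with y h1 h2 h3
    rw [h3, F.toDisc_of_le (hle y h2), h1]; rfl
  face_to_face := by
    intro j k hjk
    obtain ⟨f, hf, h1⟩ := hface j k hjk
    obtain ⟨g, hg, h2⟩ := hface k j hjk.symm
    exact ⟨f, hf, g, hg, h1, by rw [← h1, ← h2, inter_comm]⟩

variable (F)

/-! ### Singular points and cells -/

theorem notMem_singular_of_sector {x : F.Disc} {i : ZMod m} (h : 0 < F.beta i x)
    (h' : F.beta (i + 1) x < 0) (h1 : F.gauge x ≠ 1) : x ∉ F.singular hr := by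
  have hr0 : 0 < r := by rcases hr with rfl | rfl <;> norm_num
  have hs : (x : Plane) ∈ F.star i := mem_star_of_right h.le h'
  have hs' : (x : Plane) ∈ F.star (i + 1) := mem_star_of_left h'.le (by rwa [add_sub_cancel_right])
  intro hx
  rcases (F.mem_singular hr).1 hx with ⟨j, rfl⟩ | ⟨j, rfl⟩
  · exact h1 (F.gauge_mid j)
  · exact F.add_one_ne i ((F.eq_of_ray_mem_star hr0 hs').trans (F.eq_of_ray_mem_star hr0 hs).symm)

theorem gauge_v (i : ZMod m) : F.gauge (F.v i).toPlane = 1 := by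
  rw [toPlane_v]; exact F.gauge_ray one_pos i

theorem v_mem_cone (i : ZMod m) : (F.v i).toPlane ∈ F.cone i := by
  rw [toPlane_v]; exact F.ray_mem_cone one_pos i

theorem beta_v (i : ZMod m) : F.beta i (F.v i).toPlane = 0 := by
  rw [toPlane_v]; exact F.beta_point _ _ _

theorem eq_v {i : ZMod m} {x : Plane} (hx : x ∈ F.cone i) (h0 : F.beta i x = 0)
    (h1 : F.gauge x = 1) : x = (F.v i).toPlane := by
  refine F.ext_alpha_beta i ?_ ?_
  · rw [← gauge_eq hx, h1, toPlane_v, alpha_point]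
  · rw [h0, toPlane_v, beta_point]

theorem toDisc_v_notMem_singular (i : ZMod m) : F.toDisc (F.v i).toPlane ∉ F.singular hr := by
  have hval : (F.toDisc (F.v i).toPlane : Plane) = (F.v i).toPlane :=
    F.toDisc_of_le (by rw [gauge_v]; norm_num)
  intro hx
  rcases (F.mem_singular hr).1 hx with ⟨j, hj⟩ | ⟨j, hj⟩
  · have hj' : F.mid j = F.ray 1 i := by
      have := congrArg Subtype.val hj
      rw [hval, toPlane_v] at this
      exact this
    have h1 := F.mid_mem_star j
    rw [hj'] at h1
    exact F.add_one_ne j ((F.eq_of_ray_mem_star one_pos h1.2).trans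
      (F.eq_of_ray_mem_star one_pos h1.1).symm)
  · have h1 : F.gauge (F.ray r j) = 1 := by
      have := congrArg Subtype.val hj
      rw [hval] at this
      rw [show F.ray r j = _ from this, gauge_v]
    rw [F.gauge_ray (by rcases hr with rfl | rfl <;> norm_num)] at h1
    rcases hr with rfl | rfl <;> norm_num at h1

variable {F}

theorem eq_or_eq_of_mem_star_of_mem_cone {i j : ZMod m} {x : Plane} (h : x ∈ F.star j)
    (hc : x ∈ F.cone i) : j = i ∨ j = i + 1 := by
  rcases h i hc with h | h
  · exact Or.inr (by rw [h, sub_add_cancel])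
  · exact Or.inl h.symm

theorem mem_cone_of_succ {i : ZMod m} {x : Plane} (h : x ∈ F.cone (i + 1))
    (h0 : F.beta (i + 1) x = 0) : x ∈ F.cone i := by
  by_cases hx : x = 0
  · rw [hx]; exact F.zero_mem_cone i
  have hα := alpha_pos_of_mem_cone h hx
  have hb : F.beta (i + 1 + 1) x < 0 := by
    rw [beta_succ, h0]
    have := mul_pos (F.l_real_pos (i + 1)) hα
    linarith
  have := (star_left (mem_star_of_right h0.ge hb) h0.le).1
  rwa [add_sub_cancel_right] at this

theorem mem_cone_succ_of {i : ZMod m} {x : Plane} (h : x ∈ F.cone i)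
    (h0 : F.beta (i + 1) x = 0) : x ∈ F.cone (i + 1) := by
  by_cases hx : x = 0
  · rw [hx]; exact F.zero_mem_cone _
  rcases mem_cone_cases h hx with h' | ⟨-, h'⟩
  · exact absurd h0 h'.2.ne
  · exact ⟨h'.1, h'.2.le⟩

theorem eq_zero_of_mem_cones {i j : ZMod m} {x : Plane} (hi : x ∈ F.cone i) (hj : x ∈ F.cone j)
    (h1 : i ≠ j) (h2 : j ≠ i + 1) (h3 : i ≠ j + 1) : x = 0 := by
  by_contra hx
  rcases mem_cone_inter hx hi hj with h | h | h
  · exact h1 h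
  · exact h2 h.1
  · exact h3 h.1

variable (F)

/-! ### The triangles -/

/-- The lattice embedding of the standard triangle onto the simplex `{0, v i, v (i + 1)}`. -/
def triangleMap (i : ZMod m) (p : Plane) : Plane := F.point i (p 0) (p 1)

section triangle

variable {F} {i : ZMod m} {p : Plane}

theorem triangleMap_spec (hp : p ∈ (LatticePolygon.triangle (F.l_pos i)).region) :
    F.triangleMap i p ∈ F.cone i ∧ F.gauge (F.triangleMap i p) = p 0 ∧
      F.beta i (F.triangleMap i p) = p 1 := by
  obtain ⟨h1, -, h3⟩ := (LatticePolygon.mem_triangle _).1 hp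
  exact ⟨F.point_mem_cone h1 h3, F.gauge_point h1 h3, F.beta_point _ _ _⟩

theorem triangleMap_gauge_beta {x : Plane} (h : x ∈ F.cone i) :
    F.triangleMap i ![F.gauge x, F.beta i x] = x := by
  change F.point i (F.gauge x) (F.beta i x) = x
  rw [gauge_eq h, point_alpha_beta]

theorem image_triangle (Q : Plane → Prop) :
    (fun p => F.toDisc (F.triangleMap i p)) ''
      {p ∈ (LatticePolygon.triangle (F.l_pos i)).region | Q p} =
      {x : F.Disc | (x : Plane) ∈ F.cone i ∧ F.gauge x ≤ 1 ∧ Q ![F.gauge x, F.beta i x]} := by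
  ext x
  constructor
  · rintro ⟨p, ⟨hp, hQ⟩, rfl⟩
    obtain ⟨h1, h2, h3⟩ := triangleMap_spec hp
    have hle := ((LatticePolygon.mem_triangle _).1 hp).2.1
    change (F.toDisc _ : Plane) ∈ _ ∧ F.gauge (F.toDisc _ : Plane) ≤ 1 ∧
      Q ![F.gauge (F.toDisc _ : Plane), F.beta i (F.toDisc _ : Plane)]
    rw [F.toDisc_of_le (by linarith), h2, h3]
    refine ⟨h1, hle, ?_⟩
    convert hQ using 1
    ext k; fin_cases k <;> rfl
  · rintro ⟨hc, hg, hQ⟩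
    refine ⟨_, ⟨(LatticePolygon.mem_triangle _).2 ⟨hc.1, hg, F.beta_le_of_mem_cone hc⟩, hQ⟩, ?_⟩
    change F.toDisc (F.triangleMap i ![F.gauge x, F.beta i x]) = x
    rw [triangleMap_gauge_beta hc, toDisc_coe]

theorem image_triangle_region :
    (fun p => F.toDisc (F.triangleMap i p)) '' (LatticePolygon.triangle (F.l_pos i)).region =
      {x : F.Disc | (x : Plane) ∈ F.cone i ∧ F.gauge x ≤ 1} := by
  have := image_triangle (F := F) (i := i) fun _ => True
  simpa using this

variable (F) in
theorem triangleMap_corner (i : ZMod m) :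
    F.triangleMap i (LatticePolygon.triangleCorner (F.l i) 0).toPlane = 0 ∧
    F.triangleMap i (LatticePolygon.triangleCorner (F.l i) 1).toPlane = (F.v i).toPlane ∧
    F.triangleMap i (LatticePolygon.triangleCorner (F.l i) 2).toPlane = (F.v (i + 1)).toPlane := by
  refine ⟨?_, ?_, ?_⟩
  · change F.point i ((0 : ℤ) : ℝ) ((0 : ℤ) : ℝ) = 0
    simp [point]
  · change F.point i ((1 : ℤ) : ℝ) ((0 : ℤ) : ℝ) = _
    rw [toPlane_v]; simp
  · change F.point i ((1 : ℤ) : ℝ) ((F.l i : ℤ) : ℝ) = _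
    rw [toPlane_v_succ]; simp

end triangle

theorem isCell_triangle (i : ZMod m) :
    F.IsCell hr (LatticePolygon.triangle (F.l_pos i)) (F.triangleMap i) where
  continuousOn := by
    refine Continuous.continuousOn ?_
    unfold triangleMap point; fun_prop
  injOn := fun p hp q hq h => by
    obtain ⟨-, h2, h3⟩ := triangleMap_spec hp
    obtain ⟨-, h4, h5⟩ := triangleMap_spec hq
    ext k; fin_cases k
    · exact h2.symm.trans ((congrArg _ h).trans h4)
    · exact h3.symm.trans ((congrArg _ h).trans h5)
  gauge_le := fun p hp => by
    have := ((LatticePolygon.mem_triangle _).1 hp).2.1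
    rw [(triangleMap_spec hp).2.1]; linarith
  corner := by
    obtain ⟨h0, h1, h2⟩ := F.triangleMap_corner i
    refine LatticePolygon.forall_zmod_three.2 ⟨?_, ?_, ?_⟩
    · change F.toDisc (F.triangleMap i (LatticePolygon.triangleCorner (F.l i) 0).toPlane) ∉ _
      have hr0 : 0 < r := by rcases hr with rfl | rfl <;> norm_num
      rw [h0]
      refine F.notMem_singular_of_gauge hr ?_ ?_ <;>
        rw [F.toDisc_of_le (by rw [gauge_zero]; norm_num), gauge_zero]
      · norm_num
      · exact hr0.ne
    · change F.toDisc (F.triangleMap i (LatticePolygon.triangleCorner (F.l i) 1).toPlane) ∉ _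
      rw [h1]; exact F.toDisc_v_notMem_singular hr i
    · change F.toDisc (F.triangleMap i (LatticePolygon.triangleCorner (F.l i) 2).toPlane) ∉ _
      rw [h2]; exact F.toDisc_v_notMem_singular hr (i + 1)
  interior := fun p hp => by
    obtain ⟨h1, h2, h3⟩ := LatticePolygon.mem_interior_triangle _ hp
    obtain ⟨-, h4, h5⟩ := triangleMap_spec (interior_subset hp)
    refine F.notMem_singular_of_sector (i := i) hr ?_ ?_ ?_ <;>
      rw [F.toDisc_of_le (by rw [h4]; linarith)]
    · rw [h5]; exact h1
    · have e : F.alpha i (F.triangleMap i p) = p 0 := F.alpha_point _ _ _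
      rw [beta_succ, h5, e]; linarith
    · rw [h4]; exact h2.ne
  affine := fun p hp a ha => by
    obtain ⟨hc, -, -⟩ := triangleMap_spec hp
    have hval : ∀ y ∈ (LatticePolygon.triangle (F.l_pos i)).region,
        F.gauge (F.triangleMap i y) = y 0 ∧ F.tau i (F.triangleMap i y) = y 1 ∧
        F.tau (i + 1) (F.triangleMap i y) = y 1 - F.l i * y 0 ∧ 0 ≤ y 1 ∧
        y 1 - F.l i * y 0 ≤ 0 := by
      intro y hy
      obtain ⟨h1, h2, h3⟩ := (LatticePolygon.mem_triangle _).1 hy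
      obtain ⟨h4, h5, h6⟩ := triangleMap_spec hy
      have h7 : F.tau i (F.triangleMap i y) = y 1 := by
        rw [tau, h5, h6, max_eq_right h2, div_one]
      refine ⟨h5, h7, ?_, h1, by linarith⟩
      rw [F.tau_succ h4, h7, h5, min_eq_left h2]
    have hmem := self_mem_nhdsWithin (a := p) (s := (LatticePolygon.triangle (F.l_pos i)).region)
    rcases a with _ | ⟨j, b⟩
    · refine AffRel.of_coeff (F.v i 0) (F.u i 0) (F.v i 1) (F.u i 1) 0 F.centralShift ?_
        (Eventually.of_forall fun y => ?_)
      · have := F.det_eq i; unfold LatticeVec.det2 at this; linarith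
      · simp [chartFun, triangleMap, point, LatticeVec.toPlane]
        constructor <;> ring
    · have hs : F.triangleMap i p ∈ F.star j := by cases b <;> exact ha.1
      rcases eq_or_eq_of_mem_star_of_mem_cone hs hc with rfl | rfl <;> cases b
      · refine AffRel.of_coeff 0 1 (-1) 0 0 (F.shift j) (by ring) ?_
        filter_upwards [hmem] with y hy
        obtain ⟨h1, h2, -, h3, -⟩ := hval y hy
        simp [chartFun, h1, h2, min_eq_right h3]; ring
      · refine AffRel.of_coeff 0 1 (-1) 0 0 2 (by ring) ?_
        filter_upwards [hmem] with y hy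
        obtain ⟨h1, h2, -, h3, -⟩ := hval y hy
        simp [chartFun, h1, h2]; ring
      · refine AffRel.of_coeff (-F.l i) 1 (-1 + F.c (i + 1) * F.l i) (-F.c (i + 1)) 0
          (F.shift (i + 1)) (by ring) ?_
        filter_upwards [hmem] with y hy
        obtain ⟨h1, -, h2, -, h3⟩ := hval y hy
        simp [chartFun, h1, h2, min_eq_left h3]
        constructor <;> ring
      · refine AffRel.of_coeff (-F.l i) 1 (-1) 0 0 2 (by ring) ?_
        filter_upwards [hmem] with y hy
        obtain ⟨h1, -, h2, -, h3⟩ := hval y hy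
        simp [chartFun, h1, h2]
        constructor <;> ring

/-! ### The rectangles -/

/-- The embedding of the standard rectangle onto the part of a cone outside of the polygon. -/
def rectangleMap (i : ZMod m) (p : Plane) : Plane := F.point i (2 - p 1) ((2 - p 1) * p 0)

section rectangle

variable {F} {i : ZMod m} {p : Plane}

theorem rectangleMap_spec (hp : p ∈ (LatticePolygon.rectangle (F.l_pos i)).region) :
    F.rectangleMap i p ∈ F.cone i ∧ F.gauge (F.rectangleMap i p) = 2 - p 1 ∧
      F.tau i (F.rectangleMap i p) = p 0 := by
  obtain ⟨h1, h2, h3, h4⟩ := (LatticePolygon.mem_rectangle _).1 hp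
  have h5 : 0 ≤ (2 - p 1) * p 0 := mul_nonneg (by linarith) h4
  have h6 : (2 - p 1) * p 0 ≤ F.l i * (2 - p 1) := by
    rw [mul_comm (F.l i : ℝ)]; exact mul_le_mul_of_nonneg_left h2 (by linarith)
  have h7 := F.gauge_point h5 h6
  refine ⟨F.point_mem_cone h5 h6, h7, ?_⟩
  change F.beta i (F.point i _ _) / max (F.gauge (F.point i _ _)) 1 = _
  rw [h7, beta_point, max_eq_left (by linarith), mul_div_cancel_left₀ _ (by linarith)]

theorem tau_bounds_of_mem_cone {x : Plane} (h : x ∈ F.cone i) (h1 : 1 ≤ F.gauge x) :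
    0 ≤ F.tau i x ∧ F.tau i x ≤ F.l i ∧ (F.tau i x = F.l i ↔ F.beta (i + 1) x = 0) := by
  have h2 := F.tau_succ h
  rw [min_eq_right h1, mul_one] at h2
  have h3 := F.tau_nonpos_iff.2 h.2
  refine ⟨F.tau_nonneg_iff.2 h.1, by linarith, ?_⟩
  rw [← tau_eq_zero_iff, h2, sub_eq_zero]

theorem rectangleMap_tau_gauge {x : Plane} (h : x ∈ F.cone i) (h1 : 1 ≤ F.gauge x) :
    F.rectangleMap i ![F.tau i x, 2 - F.gauge x] = x := by
  change F.point i (2 - (2 - F.gauge x)) ((2 - (2 - F.gauge x)) * F.tau i x) = x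
  have h2 := F.max_mul_tau i x
  rw [max_eq_left h1] at h2
  rw [sub_sub_cancel, h2, gauge_eq h, point_alpha_beta]

theorem image_rectangle (Q : Plane → Prop) :
    (fun p => F.toDisc (F.rectangleMap i p)) ''
      {p ∈ (LatticePolygon.rectangle (F.l_pos i)).region | Q p} =
      {x : F.Disc | (x : Plane) ∈ F.cone i ∧ 1 ≤ F.gauge x ∧ Q ![F.tau i x, 2 - F.gauge x]} := by
  ext x
  constructor
  · rintro ⟨p, ⟨hp, hQ⟩, rfl⟩
    obtain ⟨h1, h2, h3⟩ := rectangleMap_spec hp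
    obtain ⟨h4, -, h5, -⟩ := (LatticePolygon.mem_rectangle _).1 hp
    change (F.toDisc _ : Plane) ∈ _ ∧ 1 ≤ F.gauge (F.toDisc _ : Plane) ∧
      Q ![F.tau i (F.toDisc _ : Plane), 2 - F.gauge (F.toDisc _ : Plane)]
    rw [F.toDisc_of_le (by linarith), h2, h3]
    refine ⟨h1, by linarith, ?_⟩
    convert hQ using 1
    ext k; fin_cases k
    · rfl
    · exact sub_sub_cancel _ _
  · rintro ⟨hc, hg, hQ⟩
    obtain ⟨h1, h2, -⟩ := tau_bounds_of_mem_cone hc hg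
    have h3 := x.2
    refine ⟨_, ⟨(LatticePolygon.mem_rectangle _).2 ⟨?_, h2, ?_, h1⟩, hQ⟩, ?_⟩
    · change 0 ≤ 2 - F.gauge x; linarith
    · change 2 - F.gauge x ≤ 1; linarith
    · change F.toDisc (F.rectangleMap i ![F.tau i x, 2 - F.gauge x]) = x
      rw [rectangleMap_tau_gauge hc hg, toDisc_coe]

theorem image_rectangle_region :
    (fun p => F.toDisc (F.rectangleMap i p)) '' (LatticePolygon.rectangle (F.l_pos i)).region =
      {x : F.Disc | (x : Plane) ∈ F.cone i ∧ 1 ≤ F.gauge x} := by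
  have := image_rectangle (F := F) (i := i) fun _ => True
  simpa using this

variable (F) in
theorem rectangleMap_corner (i : ZMod m) :
    F.rectangleMap i (LatticePolygon.rectangleCorner (F.l i) 2).toPlane = (F.v (i + 1)).toPlane ∧
    F.rectangleMap i (LatticePolygon.rectangleCorner (F.l i) 3).toPlane = (F.v i).toPlane := by
  refine ⟨?_, ?_⟩
  · change F.point i (2 - ((1 : ℤ) : ℝ)) ((2 - ((1 : ℤ) : ℝ)) * ((F.l i : ℤ) : ℝ)) = _
    rw [toPlane_v_succ]; norm_num
  · change F.point i (2 - ((1 : ℤ) : ℝ)) ((2 - ((1 : ℤ) : ℝ)) * ((0 : ℤ) : ℝ)) = _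
    rw [toPlane_v]; norm_num

end rectangle

theorem isCell_rectangle (i : ZMod m) :
    F.IsCell hr (LatticePolygon.rectangle (F.l_pos i)) (F.rectangleMap i) where
  continuousOn := by
    refine Continuous.continuousOn ?_
    unfold rectangleMap point; fun_prop
  injOn := fun p hp q hq h => by
    obtain ⟨-, h2, h3⟩ := rectangleMap_spec hp
    obtain ⟨-, h4, h5⟩ := rectangleMap_spec hq
    ext k; fin_cases k
    · exact h3.symm.trans ((congrArg _ h).trans h5)
    · exact sub_right_injective (h2.symm.trans ((congrArg _ h).trans h4))
  gauge_le := fun p hp => by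
    have := ((LatticePolygon.mem_rectangle _).1 hp).1
    rw [(rectangleMap_spec hp).2.1]; linarith
  corner := by
    obtain ⟨h2, h3⟩ := F.rectangleMap_corner i
    have hr2 : r < 2 := by rcases hr with rfl | rfl <;> norm_num
    -- the corners in the boundary have gauge two
    have key : ∀ p ∈ (LatticePolygon.rectangle (F.l_pos i)).region, p 1 = 0 →
        F.toDisc (F.rectangleMap i p) ∉ F.singular hr := by
      intro p hp h0
      have hg := (rectangleMap_spec hp).2.1
      rw [h0, sub_zero] at hg
      refine F.notMem_singular_of_gauge hr ?_ ?_ <;> rw [F.toDisc_of_le hg.le, hg]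
      · norm_num
      · exact hr2.ne'
    have hl := F.l_real_pos i
    refine LatticePolygon.forall_zmod_four.2 ⟨?_, ?_, ?_, ?_⟩
    · refine key _ ((LatticePolygon.mem_rectangle _).2 ?_) ?_
      · change (0 : ℝ) ≤ ((0 : ℤ) : ℝ) ∧ ((0 : ℤ) : ℝ) ≤ F.l i ∧ ((0 : ℤ) : ℝ) ≤ 1 ∧
          (0 : ℝ) ≤ ((0 : ℤ) : ℝ)
        simp
      · change ((0 : ℤ) : ℝ) = 0; simp
    · refine key _ ((LatticePolygon.mem_rectangle _).2 ?_) ?_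
      · change (0 : ℝ) ≤ ((0 : ℤ) : ℝ) ∧ ((F.l i : ℤ) : ℝ) ≤ F.l i ∧ ((0 : ℤ) : ℝ) ≤ 1 ∧
          (0 : ℝ) ≤ ((F.l i : ℤ) : ℝ)
        simp
      · change ((0 : ℤ) : ℝ) = 0; simp
    · change F.toDisc (F.rectangleMap i (LatticePolygon.rectangleCorner (F.l i) 2).toPlane) ∉ _
      rw [h2]; exact F.toDisc_v_notMem_singular hr (i + 1)
    · change F.toDisc (F.rectangleMap i (LatticePolygon.rectangleCorner (F.l i) 3).toPlane) ∉ _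
      rw [h3]; exact F.toDisc_v_notMem_singular hr i
  interior := fun p hp => by
    obtain ⟨h1, h2, h3, h4⟩ := LatticePolygon.mem_interior_rectangle _ hp
    obtain ⟨h5, h6, h7⟩ := rectangleMap_spec (interior_subset hp)
    have h8 : 1 ≤ F.gauge (F.rectangleMap i p) := by rw [h6]; linarith
    refine F.notMem_singular_of_sector (i := i) hr ?_ ?_ ?_ <;>
      rw [F.toDisc_of_le (by rw [h6]; linarith)]
    · rw [← tau_pos_iff, h7]; exact h4
    · rw [← tau_neg_iff, F.tau_succ h5, h7, min_eq_right h8]; linarith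
    · rw [h6]; linarith
  affine := fun p hp a ha => by
    obtain ⟨hc, hg, -⟩ := rectangleMap_spec hp
    have hval : ∀ y ∈ (LatticePolygon.rectangle (F.l_pos i)).region,
        F.gauge (F.rectangleMap i y) = 2 - y 1 ∧ F.tau i (F.rectangleMap i y) = y 0 ∧
        F.tau (i + 1) (F.rectangleMap i y) = y 0 - F.l i ∧ 0 ≤ y 0 ∧ y 0 - F.l i ≤ 0 := by
      intro y hy
      obtain ⟨h1, h2, h3, h4⟩ := (LatticePolygon.mem_rectangle _).1 hy
      obtain ⟨h5, h6, h7⟩ := rectangleMap_spec hy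
      refine ⟨h6, h7, ?_, h4, by linarith⟩
      rw [F.tau_succ h5, h7, h6, min_eq_right (by linarith), mul_one]
    have hmem := self_mem_nhdsWithin (a := p) (s := (LatticePolygon.rectangle (F.l_pos i)).region)
    rcases a with _ | ⟨j, b⟩
    · exfalso
      have h1 : F.gauge (F.rectangleMap i p) < 1 := lt_of_lt_of_le ha (min_le_right _ _)
      have := ((LatticePolygon.mem_rectangle _).1 hp).2.2.1
      linarith
    · have hs : F.rectangleMap i p ∈ F.star j := by cases b <;> exact ha.1
      rcases eq_or_eq_of_mem_star_of_mem_cone hs hc with rfl | rfl <;> cases b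
      · refine AffRel.of_coeff 1 0 0 1 0 (F.shift j - 2) (by ring) ?_
        filter_upwards [hmem] with y hy
        obtain ⟨h1, h2, -, h3, -⟩ := hval y hy
        simp [chartFun, h1, h2, min_eq_right h3]; ring
      · refine AffRel.of_coeff 1 0 0 1 0 0 (by ring) ?_
        filter_upwards [hmem] with y hy
        obtain ⟨h1, h2, -, h3, -⟩ := hval y hy
        simp [chartFun, h1, h2]
      · refine AffRel.of_coeff 1 0 (-F.c (i + 1)) 1 (-F.l i)
          (F.shift (i + 1) - 2 + F.c (i + 1) * F.l i) (by ring) ?_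
        filter_upwards [hmem] with y hy
        obtain ⟨h1, -, h2, -, h3⟩ := hval y hy
        simp [chartFun, h1, h2, min_eq_left h3]
        constructor <;> ring
      · refine AffRel.of_coeff 1 0 0 1 (-F.l i) 0 (by ring) ?_
        filter_upwards [hmem] with y hy
        obtain ⟨h1, -, h2, -, h3⟩ := hval y hy
        simp [chartFun, h1, h2]
        ring

end ReflexiveFan

/-! ### Common faces -/

namespace ReflexiveFan

variable {m : ℕ} [NeZero m] (F : ReflexiveFan m)

/-- The part of a closed cone in the polygon, as a subset of the disc. -/
def innerPart (i : ZMod m) : Set F.Disc := {x | (x : Plane) ∈ F.cone i ∧ F.gauge x ≤ 1}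

/-- The part of a closed cone outside of the open polygon, as a subset of the disc. -/
def outerPart (i : ZMod m) : Set F.Disc := {x | (x : Plane) ∈ F.cone i ∧ 1 ≤ F.gauge x}

variable {F} {i k : ZMod m} {S : Set F.Disc}

theorem beta_succ_eq_zero_iff {x : Plane} (h : x ∈ F.cone i) :
    F.beta (i + 1) x = 0 ↔ F.beta i x = F.l i * F.gauge x := by
  rw [beta_succ, gauge_eq h, sub_eq_zero]

theorem beta_succ_eq_zero {x : Plane} (h : x ∈ F.cone i) (h' : x ∈ F.cone (i + 1)) :
    F.beta (i + 1) x = 0 := le_antisymm h.2 h'.1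

theorem coe_toDisc_v (i : ZMod m) : (F.toDisc (F.v i).toPlane : Plane) = (F.v i).toPlane :=
  F.toDisc_of_le (by rw [gauge_v]; norm_num)

theorem v_succ_mem_cone (i : ZMod m) : (F.v (i + 1)).toPlane ∈ F.cone i :=
  mem_cone_of_succ (F.v_mem_cone _) (F.beta_v _)

/-- The intersection of the inner part of a cone and the outer part of the next one. -/
theorem inner_inter_outer_succ (i : ZMod m) :
    F.innerPart i ∩ F.outerPart (i + 1) = {F.toDisc (F.v (i + 1)).toPlane} := by
  ext x
  constructor
  · rintro ⟨⟨h1, h2⟩, h3, h4⟩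
    refine Subtype.ext ?_
    rw [coe_toDisc_v]
    exact F.eq_v h3 (beta_succ_eq_zero h1 h3) (le_antisymm h2 h4)
  · rintro rfl
    simp only [innerPart, outerPart, mem_inter_iff, mem_ofPred_eq, coe_toDisc_v, gauge_v]
    exact ⟨⟨v_succ_mem_cone i, le_rfl⟩, F.v_mem_cone _, le_rfl⟩

theorem inner_succ_inter_outer (i : ZMod m) :
    F.innerPart (i + 1) ∩ F.outerPart i = {F.toDisc (F.v (i + 1)).toPlane} := by
  ext x
  constructor
  · rintro ⟨⟨h1, h2⟩, h3, h4⟩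
    refine Subtype.ext ?_
    rw [coe_toDisc_v]
    exact F.eq_v h1 (beta_succ_eq_zero h3 h1) (le_antisymm h2 h4)
  · rintro rfl
    simp only [innerPart, outerPart, mem_inter_iff, mem_ofPred_eq, coe_toDisc_v, gauge_v]
    exact ⟨⟨F.v_mem_cone _, le_rfl⟩, v_succ_mem_cone i, le_rfl⟩

theorem inner_inter_outer_of_ne (h1 : i ≠ k) (h2 : k ≠ i + 1) (h3 : i ≠ k + 1) :
    F.innerPart i ∩ F.outerPart k = ∅ := by
  refine eq_empty_of_forall_notMem ?_
  rintro x ⟨⟨hi, -⟩, hk, hg⟩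
  rw [eq_zero_of_mem_cones hi hk h1 h2 h3, gauge_zero] at hg
  linarith

theorem outer_inter_outer_of_ne (h1 : i ≠ k) (h2 : k ≠ i + 1) (h3 : i ≠ k + 1) :
    F.outerPart i ∩ F.outerPart k = ∅ := by
  refine eq_empty_of_forall_notMem ?_
  rintro x ⟨⟨hi, hg⟩, hk, -⟩
  rw [eq_zero_of_mem_cones hi hk h1 h2 h3, gauge_zero] at hg
  linarith

theorem inner_inter_inner_of_ne (h1 : i ≠ k) (h2 : k ≠ i + 1) (h3 : i ≠ k + 1) :
    F.innerPart i ∩ F.innerPart k = {F.toDisc 0} := by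
  have h0 : (F.toDisc 0 : Plane) = 0 := F.toDisc_of_le (by rw [gauge_zero]; norm_num)
  ext x
  constructor
  · rintro ⟨⟨hi, -⟩, hk, -⟩
    refine Subtype.ext ?_
    rw [h0]
    exact eq_zero_of_mem_cones hi hk h1 h2 h3
  · rintro rfl
    simp only [innerPart, mem_inter_iff, mem_ofPred_eq, h0, gauge_zero]
    exact ⟨⟨F.zero_mem_cone _, zero_le_one⟩, F.zero_mem_cone _, zero_le_one⟩

theorem face_triangle_triangle (hik : i ≠ k) :
    F.IsFaceImage (LatticePolygon.triangle (F.l_pos i)) (F.triangleMap i)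
      (F.innerPart i ∩ F.innerPart k) := by
  by_cases h1 : k = i + 1
  · subst h1
    refine isFaceImage_edge (LatticePolygon.triangle_edges (F.l_pos i)).2.2 ?_
    rw [image_triangle]
    ext x
    constructor
    · rintro ⟨⟨h1, h2⟩, h3, -⟩
      exact ⟨h1, h2, (beta_succ_eq_zero_iff h1).1 (beta_succ_eq_zero h1 h3)⟩
    · rintro ⟨h1, h2, h3⟩
      exact ⟨⟨h1, h2⟩, mem_cone_succ_of h1 ((beta_succ_eq_zero_iff h1).2 h3), h2⟩
  by_cases h2 : i = k + 1
  · subst h2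
    refine isFaceImage_edge (LatticePolygon.triangle_edges (F.l_pos (k + 1))).1 ?_
    rw [image_triangle]
    ext x
    constructor
    · rintro ⟨⟨h1, h2⟩, h3, -⟩
      exact ⟨h1, h2, beta_succ_eq_zero h3 h1⟩
    · rintro ⟨h1, h2, h3⟩
      exact ⟨⟨h1, h2⟩, mem_cone_of_succ h1 h3, h2⟩
  · rw [inner_inter_inner_of_ne hik h1 h2]
    refine isFaceImage_corner (0 : ZMod 3) ?_
    exact congrArg (fun z => {F.toDisc z}) (F.triangleMap_corner i).1.symm

theorem face_triangle_rectangle (i k : ZMod m) :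
    F.IsFaceImage (LatticePolygon.triangle (F.l_pos i)) (F.triangleMap i)
      (F.innerPart i ∩ F.outerPart k) := by
  by_cases h0 : i = k
  · subst h0
    refine isFaceImage_edge (LatticePolygon.triangle_edges (F.l_pos i)).2.1 ?_
    rw [image_triangle]
    ext x
    constructor
    · rintro ⟨⟨h1, h2⟩, -, h3⟩
      exact ⟨h1, h2, le_antisymm h2 h3⟩
    · rintro ⟨h1, h2, h3⟩
      exact ⟨⟨h1, h2⟩, h1, h3.ge⟩
  by_cases h1 : k = i + 1
  · subst h1
    rw [inner_inter_outer_succ]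
    refine isFaceImage_corner (2 : ZMod 3) ?_
    exact congrArg (fun z => {F.toDisc z}) (F.triangleMap_corner i).2.2.symm
  by_cases h2 : i = k + 1
  · subst h2
    rw [inner_succ_inter_outer]
    refine isFaceImage_corner (1 : ZMod 3) ?_
    exact congrArg (fun z => {F.toDisc z}) (F.triangleMap_corner (k + 1)).2.1.symm
  · exact isFaceImage_empty (inner_inter_outer_of_ne h0 h1 h2)

theorem face_rectangle_triangle (i k : ZMod m) :
    F.IsFaceImage (LatticePolygon.rectangle (F.l_pos k)) (F.rectangleMap k)
      (F.innerPart i ∩ F.outerPart k) := by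
  by_cases h0 : i = k
  · subst h0
    refine isFaceImage_edge (LatticePolygon.rectangle_edges (F.l_pos i)).2.1 ?_
    rw [image_rectangle]
    ext x
    constructor
    · rintro ⟨⟨h1, h2⟩, -, h3⟩
      refine ⟨h1, h3, ?_⟩
      change 2 - F.gauge x = 1
      linarith
    · rintro ⟨h1, h2, h3⟩
      have h4 : 2 - F.gauge x = 1 := h3
      refine ⟨⟨h1, ?_⟩, h1, h2⟩
      linarith
  by_cases h1 : k = i + 1
  · subst h1
    rw [inner_inter_outer_succ]
    refine isFaceImage_corner (3 : ZMod 4) ?_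
    exact congrArg (fun z => {F.toDisc z}) (F.rectangleMap_corner (i + 1)).2.symm
  by_cases h2 : i = k + 1
  · subst h2
    rw [inner_succ_inter_outer]
    refine isFaceImage_corner (2 : ZMod 4) ?_
    exact congrArg (fun z => {F.toDisc z}) (F.rectangleMap_corner k).1.symm
  · exact isFaceImage_empty (inner_inter_outer_of_ne h0 h1 h2)

theorem face_rectangle_rectangle (hik : i ≠ k) :
    F.IsFaceImage (LatticePolygon.rectangle (F.l_pos i)) (F.rectangleMap i)
      (F.outerPart i ∩ F.outerPart k) := by
  by_cases h1 : k = i + 1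
  · subst h1
    refine isFaceImage_edge (LatticePolygon.rectangle_edges (F.l_pos i)).1 ?_
    rw [image_rectangle]
    ext x
    constructor
    · rintro ⟨⟨h1, h2⟩, h3, -⟩
      exact ⟨h1, h2, (tau_bounds_of_mem_cone h1 h2).2.2.2 (beta_succ_eq_zero h1 h3)⟩
    · rintro ⟨h1, h2, h3⟩
      exact ⟨⟨h1, h2⟩, mem_cone_succ_of h1 ((tau_bounds_of_mem_cone h1 h2).2.2.1 h3), h2⟩
  by_cases h2 : i = k + 1
  · subst h2
    refine isFaceImage_edge (LatticePolygon.rectangle_edges (F.l_pos (k + 1))).2.2 ?_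
    rw [image_rectangle]
    ext x
    constructor
    · rintro ⟨⟨h1, h2⟩, h3, -⟩
      exact ⟨h1, h2, F.tau_eq_zero_iff.2 (beta_succ_eq_zero h3 h1)⟩
    · rintro ⟨h1, h2, h3⟩
      exact ⟨⟨h1, h2⟩, mem_cone_of_succ h1 (F.tau_eq_zero_iff.1 h3), h2⟩
  · exact isFaceImage_empty (outer_inter_outer_of_ne hik h1 h2)

/-! ### The polygon as a cell -/

variable (F)

theorem isCell_polygon : F.IsCell (r := 3 / 2) (Or.inr rfl) F.latticePolygon id where
  continuousOn := continuousOn_id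
  injOn := injOn_id _
  gauge_le := fun y hy => by
    have := F.mem_polygon.1 hy
    change F.gauge y ≤ 2
    linarith
  corner := fun i => F.toDisc_v_notMem_singular _ i
  interior := fun x hx => by
    have h1 : x ∈ interior (polygon F.v) := hx
    rw [F.frontier_polygon.2] at h1
    have h2 : F.gauge x < 1 := h1
    change F.toDisc x ∉ _
    refine F.notMem_singular_of_gauge _ ?_ ?_ <;> rw [F.toDisc_of_le (by linarith)] <;> linarith
  affine := fun x hx a ha => by
    have hx1 : F.gauge x ≤ 1 := F.mem_polygon.1 hx
    have h0 : AffRel (𝓝[polygon F.v] x) id (F.chartFun none) :=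
      AffRel.of_coeff 1 0 0 1 0 F.centralShift (by ring)
        (Eventually.of_forall fun y => by simp [chartFun])
    have hle : ∀ᶠ y in 𝓝[polygon F.v] x, F.gauge y ≤ 1 := by
      filter_upwards [self_mem_nhdsWithin] with y hy
      exact F.mem_polygon.1 hy
    have hst : ∀ {j}, x ∈ F.star j → ∀ᶠ y in 𝓝[polygon F.v] x, y ∈ F.star j := fun h =>
      mem_nhdsWithin_of_mem_nhds ((F.isOpen_star _).mem_nhds h)
    rcases a with _ | ⟨j, _ | _⟩
    · exact h0
    · exact h0.trans (affRel_inner_none (hst ha.1) hle)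
    · refine (h0.trans (affRel_inner_none (hst ha.1) hle)).trans
        ((affRel_fold ?_).symm.mono nhdsWithin_le_nhds)
      refine ha.2.2.resolve_left fun h => ?_
      change 3 / 2 < F.gauge x at h
      linarith

theorem image_polygon : (fun p => F.toDisc (id p)) '' (polygon F.v) =
    {x : F.Disc | F.gauge x ≤ 1} := by
  ext x
  constructor
  · rintro ⟨p, hp, rfl⟩
    have := F.mem_polygon.1 hp
    change F.gauge (F.toDisc p) ≤ 1
    rw [F.toDisc_of_le (by linarith)]
    exact this
  · intro hx
    exact ⟨x, F.mem_polygon.2 hx, F.toDisc_coe x⟩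

theorem image_polygonEdge (i : ZMod m) : (fun p => F.toDisc (id p)) '' (polygonEdge F.v i) =
    {x : F.Disc | F.gauge x ≤ 1} ∩ F.outerPart i := by
  ext x
  constructor
  · rintro ⟨p, hp, rfl⟩
    obtain ⟨h1, h2⟩ := F.mem_polygonEdge.1 hp
    change F.gauge (F.toDisc p) ≤ 1 ∧ (F.toDisc p : Plane) ∈ F.cone i ∧ 1 ≤ F.gauge (F.toDisc p)
    rw [F.toDisc_of_le (by linarith)]
    exact ⟨h2.le, h1, h2.ge⟩
  · rintro ⟨h1, h2, h3⟩
    exact ⟨x, F.mem_polygonEdge.2 ⟨h2, le_antisymm h1 h3⟩, F.toDisc_coe x⟩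

theorem face_polygon_rectangle (i : ZMod m) :
    F.IsFaceImage F.latticePolygon id ({x : F.Disc | F.gauge x ≤ 1} ∩ F.outerPart i) :=
  isFaceImage_edge (f := polygonEdge F.v i) ⟨i, rfl⟩ (F.image_polygonEdge i).symm

theorem face_rectangle_polygon (i : ZMod m) :
    F.IsFaceImage (LatticePolygon.rectangle (F.l_pos i)) (F.rectangleMap i)
      ({x : F.Disc | F.gauge x ≤ 1} ∩ F.outerPart i) := by
  have := F.face_rectangle_triangle i i
  convert this using 1
  ext x
  constructor
  · rintro ⟨h1, h2⟩; exact ⟨⟨h2.1, h1⟩, h2⟩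
  · rintro ⟨h1, h2⟩; exact ⟨h1.2, h2⟩

/-! ### The two tropical surfaces -/

/-- The disc whose inner singular points lie in the interior of the polygon: the polygon is
subdivided into triangles. -/
noncomputable abbrev triangulatedSurface : TropicalSurface :=
  F.tropicalSurface (Or.inl rfl : (1 / 2 : ℝ) = 1 / 2 ∨ (1 / 2 : ℝ) = 3 / 2)
    (Sum.elim (fun i => LatticePolygon.triangle (F.l_pos i))
      fun i => LatticePolygon.rectangle (F.l_pos i))
    (Sum.elim F.triangleMap F.rectangleMap)
    (by
      rintro (i | i)
      · exact F.isCell_triangle _ i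
      · exact F.isCell_rectangle _ i)
    (fun x => by
      obtain ⟨i, hi⟩ := F.exists_mem_cone x
      rcases le_total (F.gauge x) 1 with h | h
      · exact ⟨Sum.inl i, (Set.ext_iff.1 (image_triangle_region (F := F)) x).2 ⟨hi, h⟩⟩
      · exact ⟨Sum.inr i, (Set.ext_iff.1 (image_rectangle_region (F := F)) x).2 ⟨hi, h⟩⟩)
    (by
      rintro (i | i) (k | k) hik
      · exact (congrArg₂ (fun S T => F.IsFaceImage _ (F.triangleMap i) (S ∩ T))
          image_triangle_region image_triangle_region).mpr
          (face_triangle_triangle fun h => hik (congrArg _ h))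
      · exact (congrArg₂ (fun S T => F.IsFaceImage _ (F.triangleMap i) (S ∩ T))
          image_triangle_region image_rectangle_region).mpr (face_triangle_rectangle i k)
      · exact (congrArg₂ (fun S T => F.IsFaceImage _ (F.rectangleMap i) (S ∩ T))
          image_rectangle_region image_triangle_region).mpr
          (inter_comm (F.outerPart i) (F.innerPart k) ▸ face_rectangle_triangle k i)
      · exact (congrArg₂ (fun S T => F.IsFaceImage _ (F.rectangleMap i) (S ∩ T))
          image_rectangle_region image_rectangle_region).mpr
          (face_rectangle_rectangle fun h => hik (congrArg _ h)))

/-- The disc that contains the polygon as a cell. -/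
noncomputable abbrev polygonSurface : TropicalSurface :=
  F.tropicalSurface (Or.inr rfl : (3 / 2 : ℝ) = 1 / 2 ∨ (3 / 2 : ℝ) = 3 / 2)
    (fun j : Option (ZMod m) =>
      j.elim F.latticePolygon fun i => LatticePolygon.rectangle (F.l_pos i))
    (fun j => j.elim id F.rectangleMap)
    (by
      rintro (_ | i)
      · exact F.isCell_polygon
      · exact F.isCell_rectangle _ i)
    (fun x => by
      obtain ⟨i, hi⟩ := F.exists_mem_cone x
      rcases le_total (F.gauge x) 1 with h | h
      · exact ⟨none, (Set.ext_iff.1 F.image_polygon x).2 h⟩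
      · exact ⟨some i, (Set.ext_iff.1 (image_rectangle_region (F := F)) x).2 ⟨hi, h⟩⟩)
    (by
      rintro (_ | i) (_ | k) hik
      · exact absurd rfl hik
      · exact (congrArg₂ (fun S T => F.IsFaceImage _ id (S ∩ T))
          F.image_polygon image_rectangle_region).mpr (F.face_polygon_rectangle k)
      · exact (congrArg₂ (fun S T => F.IsFaceImage _ (F.rectangleMap i) (S ∩ T))
          image_rectangle_region F.image_polygon).mpr
          (inter_comm (F.outerPart i) {x : F.Disc | F.gauge x ≤ 1} ▸ F.face_rectangle_polygon i)
      · exact (congrArg₂ (fun S T => F.IsFaceImage _ (F.rectangleMap i) (S ∩ T))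
          image_rectangle_region image_rectangle_region).mpr
          (face_rectangle_rectangle fun h => hik (congrArg _ h)))

end ReflexiveFan

/-! ### Singular points, edges and boundary circles of the two surfaces -/

namespace ReflexiveFan

variable {m : ℕ} [NeZero m] (F : ReflexiveFan m) {r : ℝ} (hr : r = 1 / 2 ∨ r = 3 / 2)

/-- The multiplicities of the singular points. -/
noncomputable def mult : F.Disc → ℤ :=
  Function.extend F.midPt (fun i => (F.l i : ℤ)) (Function.extend (F.rayPt hr) F.c 0)

theorem mult_midPt (i : ZMod m) : F.mult hr (F.midPt i) = F.l i :=
  F.midPt_injective.extend_apply _ _ _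

theorem mult_rayPt (i : ZMod m) : F.mult hr (F.rayPt hr i) = F.c i := by
  rw [mult, Function.extend_apply' _ _ _ fun ⟨j, hj⟩ => F.midPt_ne_rayPt hr j i hj,
    (F.rayPt_injective hr).extend_apply]

theorem hasMultiplicity_mult {p : F.Disc} (hp : p ∈ F.singular hr) :
    (F.surface hr).HasMultiplicity p (F.mult hr p) := by
  rcases (F.mem_singular hr).1 hp with ⟨i, rfl⟩ | ⟨i, rfl⟩
  · rw [mult_midPt]; exact F.hasMultiplicity_midPt hr i
  · rw [mult_rayPt]; exact F.hasMultiplicity_rayPt hr i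

theorem sum_mult : ∑ p ∈ F.singular hr, F.mult hr p = 12 := by
  rw [singular, Finset.sum_union, Finset.sum_image F.midPt_injective.injOn,
    Finset.sum_image (F.rayPt_injective hr).injOn]
  · simp only [mult_midPt, mult_rayPt]
    exact F.sum_l_add_sum_c
  · rw [Finset.disjoint_left]
    intro p h1 h2
    obtain ⟨i, -, rfl⟩ := Finset.mem_image.1 h1
    obtain ⟨j, -, h⟩ := Finset.mem_image.1 h2
    exact F.midPt_ne_rayPt hr i j h.symm

theorem coe_singular :
    (F.singular hr : Set F.Disc) = Set.range F.midPt ∪ Set.range (F.rayPt hr) := by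
  simp [singular]

theorem boundary_surface : (F.surface hr).boundary = {x : F.Disc | F.gauge x = 2} :=
  Set.ext fun _ => F.mem_boundary_iff hr

theorem isAffineCircle_boundary :
    (F.surface hr).IsAffineCircle (F.surface hr).boundary (boundaryLatticePoints F.v) := by
  have h := F.isAffineCircle_gauge (by norm_num : (1 : ℝ) ≤ 2) hr
    (by rcases hr with rfl | rfl <;> norm_num) le_rfl
  rw [← F.boundary_surface hr, ← F.boundaryLatticePoints_eq] at h
  exact_mod_cast h

theorem midPt_mem_edge (i : ZMod m) : F.midPt i ∈ F.innerPart i ∩ F.outerPart i :=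
  ⟨⟨F.mid_mem_cone i, (F.gauge_mid i).le⟩, F.mid_mem_cone i, (F.gauge_mid i).ge⟩

theorem injective_edge : Function.Injective fun i => F.innerPart i ∩ F.outerPart i := by
  intro i j h
  have h1 : F.midPt i ∈ F.innerPart j ∩ F.outerPart j := by
    have h' : F.innerPart i ∩ F.outerPart i = F.innerPart j ∩ F.outerPart j := h
    rw [← h']; exact F.midPt_mem_edge i
  obtain ⟨h2, h3⟩ := F.mid_mem_star i
  rcases eq_or_eq_of_mem_star_of_mem_cone h2 h1.1.1 with h4 | h4
  · exact h4
  rcases eq_or_eq_of_mem_star_of_mem_cone h3 h1.1.1 with h5 | h5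
  · rw [h4] at h5
    exact absurd h5 (LatticePolygon.add_two_ne_self F.three_le j)
  · exact add_right_cancel h5

theorem iUnion_edge : {x : F.Disc | F.gauge x = 1} = ⋃ i, F.innerPart i ∩ F.outerPart i := by
  ext x
  rw [mem_iUnion]
  constructor
  · intro h
    obtain ⟨i, hi⟩ := F.exists_mem_cone x
    exact ⟨i, ⟨hi, le_of_eq h⟩, hi, ge_of_eq h⟩
  · rintro ⟨i, h1, h2⟩
    exact le_antisymm h1.2 h2.2

theorem edge_mem_edges (i : ZMod m) :
    F.innerPart i ∩ F.outerPart i ∈ F.triangulatedSurface.edges := by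
  refine ⟨Sum.inl i, _, (LatticePolygon.triangle_edges (F.l_pos i)).2.1, ?_⟩
  refine Eq.trans ?_ (image_triangle (F := F) (i := i) fun p => p 0 = 1).symm
  ext x
  constructor
  · rintro ⟨⟨h1, h2⟩, -, h3⟩
    exact ⟨h1, h2, le_antisymm h2 h3⟩
  · rintro ⟨h1, h2, h3⟩
    exact ⟨⟨h1, h2⟩, h1, h3.ge⟩

theorem disjoint_boundary {S : Set F.Disc} (h : ∀ x ∈ S, F.gauge x ≤ 1) :
    Disjoint S (F.surface hr).boundary := by
  rw [Set.disjoint_left]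
  intro x hx hx2
  have h1 := (F.mem_boundary_iff hr).1 hx2
  have h2 := h x hx
  linarith

end ReflexiveFan

theorem proposition4p3 (m : ℕ) [NeZero m] (v : ZMod m → LatticeVec) (hv : IsPolygonData v) :
    (∃ (A : TropicalSurface) (C D : Set A.carrier) (E : ZMod m → Set A.carrier)
        (inner outer : ZMod m → A.carrier) (mult : A.carrier → ℤ),
      (∀ j, (A.cell j).IsConvex) ∧
      -- a disc with an affine circle as boundary
      A.IsDisc ∧ A.IsAffineCircle A.boundary (boundaryLatticePoints v) ∧
      -- an affine circle in the interior, formed by edges, and the open disc that it bounds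
      (∃ L, A.IsAffineCircle C L) ∧ Disjoint C A.boundary ∧
      (∀ i, E i ∈ A.edges) ∧ Function.Injective E ∧ C = (⋃ i, E i) ∧
      A.IsOpenDiscBoundedBy D C ∧
      -- the singular points and their multiplicities
      Function.Injective inner ∧ Function.Injective outer ∧
      (A.sing : Set A.carrier) = Set.range inner ∪ Set.range outer ∧
      (∀ p ∈ A.sing, A.HasMultiplicity p (mult p)) ∧
      (∀ i, outer i ∈ E i ∧ mult (outer i) = edgeLength v i) ∧
      (∀ i, inner i ∈ D ∧ mult (inner i) = cornerOrder v i) ∧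
      ∑ p ∈ A.sing, mult p = 12) ∧
    (∃ (A' : TropicalSurface) (j₀ : A'.Cell)
        (inner outer : ZMod m → A'.carrier) (mult : A'.carrier → ℤ),
      (∀ j, j ≠ j₀ → (A'.cell j).IsConvex) ∧
      -- a disc with an affine circle as boundary
      A'.IsDisc ∧ A'.IsAffineCircle A'.boundary (boundaryLatticePoints v) ∧
      -- the polygon, with all its edges, is a cell in the interior
      (A'.cell j₀).region = polygon v ∧
      (A'.cell j₀).edges = Set.range (polygonEdge v) ∧
      Disjoint (A'.emb j₀ '' polygon v) A'.boundary ∧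
      -- the singular points and their multiplicities
      Function.Injective inner ∧ Function.Injective outer ∧
      (A'.sing : Set A'.carrier) = Set.range inner ∪ Set.range outer ∧
      (∀ p ∈ A'.sing, A'.HasMultiplicity p (mult p)) ∧
      (∀ i, inner i ∈ A'.emb j₀ '' polygonEdge v i ∧ mult (inner i) = edgeLength v i) ∧
      (∀ i, outer i ∉ A'.emb j₀ '' polygon v ∧ mult (outer i) = cornerOrder v i) ∧
      ∑ p ∈ A'.sing, mult p = 12) := by
  let F : ReflexiveFan m := hv.fan
  have hl : ∀ i, (F.l i : ℤ) = edgeLength v i := fun i =>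
    Int.toNat_of_nonneg (hv.edgeLength_pos i).le
  refine ⟨?_, ?_⟩
  · have hr : (1 / 2 : ℝ) = 1 / 2 ∨ (1 / 2 : ℝ) = 3 / 2 := Or.inl rfl
    refine ⟨F.triangulatedSurface, {x : F.Disc | F.gauge x = 1}, {x : F.Disc | F.gauge x < 1},
      fun i => F.innerPart i ∩ F.outerPart i, F.rayPt hr, F.midPt, F.mult hr,
      ?_, F.isDisc_surface hr, F.isAffineCircle_boundary hr,
      ⟨_, F.isAffineCircle_gauge le_rfl hr (by norm_num) (by norm_num)⟩,
      F.disjoint_boundary hr fun x hx => le_of_eq hx, F.edge_mem_edges, F.injective_edge,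
      F.iUnion_edge, F.isOpenDiscBoundedBy_gauge hr, F.rayPt_injective hr, F.midPt_injective,
      (F.coe_singular hr).trans (union_comm _ _), fun p hp => F.hasMultiplicity_mult hr hp,
      fun i => ⟨F.midPt_mem_edge i, (F.mult_midPt hr i).trans (hl i)⟩,
      fun i => ⟨?_, F.mult_rayPt hr i⟩, F.sum_mult hr⟩
    · rintro (i | i)
      · exact LatticePolygon.isConvex_triangle (F.l_pos i)
      · exact LatticePolygon.isConvex_rectangle (F.l_pos i)
    · change F.gauge (F.ray (1 / 2) i) < 1
      rw [F.gauge_ray (by norm_num)]; norm_num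
  · have hr : (3 / 2 : ℝ) = 1 / 2 ∨ (3 / 2 : ℝ) = 3 / 2 := Or.inr rfl
    refine ⟨F.polygonSurface, (none : Option (ZMod m)), F.midPt, F.rayPt hr, F.mult hr,
      ?_, F.isDisc_surface hr, F.isAffineCircle_boundary hr, rfl, rfl,
      F.disjoint_boundary hr fun x hx => (Set.ext_iff.1 F.image_polygon x).1 hx,
      F.midPt_injective, F.rayPt_injective hr,
      F.coe_singular hr, fun p hp => F.hasMultiplicity_mult hr hp,
      fun i => ⟨(Set.ext_iff.1 (F.image_polygonEdge i) _).2
        ⟨(F.midPt_mem_edge i).1.2, (F.midPt_mem_edge i).2⟩, (F.mult_midPt hr i).trans (hl i)⟩,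
      fun i => ⟨fun h => ?_, F.mult_rayPt hr i⟩, F.sum_mult hr⟩
    · rintro (_ | i) hj
      · exact absurd rfl hj
      · exact LatticePolygon.isConvex_rectangle (F.l_pos i)
    · have h1 : F.gauge (F.ray (3 / 2) i) ≤ 1 := (Set.ext_iff.1 F.image_polygon _).1 h
      rw [F.gauge_ray (by norm_num)] at h1
      norm_num at h1
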